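/- Conventions. An ambient space $(M,E)$ of dimension $n$ is the germ, along a compact subset $K$, of a (Hausdorff) complex manifold $M$ of pure dimension $n$, together with the germ of a normal crossings divisor $E\subset M$; its points are the points of $K$. For a closed non-singular analytic subset $N\subseteq M$, $\mathcal O_N$ is the sheaf of holomorphic functions on $N$, $\mathfrak m_{N,P}$ is the maximal ideal of $\mathcal O_{N,P}$, and the multiplicity $\nu_P I$ of an ideal sheaf $I\subseteq\mathcal O_N$ at $P\in N$ is the largest $k$ with $I_P\subseteq \mathfrak m_{N,P}^k$ ($\nu_P 0=\infty$). An idealistic space $\mathcal M=(M,E,\mathcal L)$ over $(M,E)$ is given by a finite list $\mathcal L=\{(I_j,d_j)\}_{j=1}^k$ of sheaves of principal ideals $I_j\subseteq\mathcal O_M$ with integers $d_j\ge 1$, such that at each point at least one $I_j$ has a non-zero stalk. Its singular locus is $\operatorname{Sing}\mathcal M=\{P : \nu_P I_j\ge d_j \text{ for all } j\}$, and its Hironaka order at $P$ is $\delta_P\mathcal M=\min_j \nu_P I_j/d_j$. An immersed idealistic space $\mathcal V=(M,E,N,\mathcal L)$ of dimension $e$ over $(M,E)$ is given by a (possibly empty)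 closed non-singular analytic subset $N\subseteq M$ of pure dimension $e$, having normal crossings with $E$ and not locally contained in any component of $E$, and a list $\mathcal L$ as above on $N$; $\operatorname{Sing}\mathcal V\subseteq N$ and $\delta_P\mathcal V$ are defined by the same formulas, with multiplicities taken in $\mathcal O_N$. A test system over $(M,E)$ is a finite sequence of morphisms $(M_k,E_k)\to\cdots\to(M_0,E_0)=(M,E)$, each of which is either (a) an open projection, i.e. the composition of a projection $U\times(\mathbb C^m,0)\to U$ ($m\ge 0$) and an open inclusion $U\subseteq M_{j-1}$, where $U$ is a germ along a compact subset of the compact set of $M_{j-1}$, and $E_j$ is the inverse image of $E_{j-1}$; or (b) the blowing-up with a non-empty closed non-singular centre $Y\subset M_{j-1}$ having normal crossings with $E_{j-1}$, where $E_j$ is the inverse image of $E_{j-1}\cup Y$. Idealistic spaces are transformed by inverse image under (a), and under a blowing-up $\pi$ with exceptional divisor $D'$ by $(I,d)\mapsto(\mathcal J_{D'}^{-d}\,\pi^{-1}I,\,d)$; in the immersed case $N$ is replaced by its inverse image under (a) and by its strict transform under (b), and the list is transformed by the induced morphism of the subspaces. A test system is permissible if each centre of blowing-up is contained in the singular locus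 of the transform by the preceding steps. Two idealistic spaces, or two immersed idealistic spaces, over the same $(M,E)$ are equivalent if they have exactly the same permissible test systems. Proposition. (1) Let $\mathcal M_\alpha$ and $\mathcal M_\beta$ be two equivalent idealistic spaces over an ambient space $(M,E)$. Then they have the same singular points, and $\delta_P\mathcal M_\alpha=\delta_P\mathcal M_\beta$ for every point $P$ of their common singular locus. (2) Let $\mathcal V_\alpha$ and $\mathcal V_\beta$ be two equivalent immersed idealistic spaces over $(M,E)$ of the same dimension $e$. Then they have the same singular points, and $\delta_P\mathcal V_\alpha=\delta_P\mathcal V_\beta$ for every point $P$ of their common singular locus. -/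

import Mathlib

open Set Filter Topology
open scoped Manifold ContDiff

universe u

namespace Idealistic

noncomputable section

/-! ### Normal crossings in local coordinates -/

section Charts

variable {n : ℕ} {M : Type u} [TopologicalSpace M] [ChartedSpace (Fin n → ℂ) M]

/-- `φ` is a system of holomorphic local coordinates of `M` centred at `P`. -/
def IsCoordAt (φ : OpenPartialHomeomorph M (Fin n → ℂ)) (P : M) : Prop :=
  φ ∈ IsManifold.maximalAtlas 𝓘(ℂ, Fin n → ℂ) ω M ∧ P ∈ φ.source ∧ φ P = 0

/-- In the coordinates `φ`, the set `E` is the union of the coordinate hyperplanes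
`φ i = 0`, `i ∈ a`. -/
def IsHyperplanes (φ : OpenPartialHomeomorph M (Fin n → ℂ)) (a : Finset (Fin n))
    (E : Set M) : Prop :=
  ∀ x ∈ φ.source, x ∈ E ↔ ∃ i ∈ a, φ x i = 0

/-- In the coordinates `φ`, the set `Y` is the coordinate subspace
`φ i = 0` for all `i ∈ b`. -/
def IsCoordSubspace (φ : OpenPartialHomeomorph M (Fin n → ℂ)) (b : Finset (Fin n))
    (Y : Set M) : Prop :=
  ∀ x ∈ φ.source, x ∈ Y ↔ ∀ i ∈ b, φ x i = 0

/-- `E` is a normal crossings divisor of `M` (possibly empty). -/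
def IsNCDivisor (n : ℕ) {M : Type u} [TopologicalSpace M] [ChartedSpace (Fin n → ℂ) M]
    (E : Set M) : Prop :=
  ∀ P : M, ∃ (φ : OpenPartialHomeomorph M (Fin n → ℂ)) (a : Finset (Fin n)),
    IsCoordAt φ P ∧ IsHyperplanes φ a E

/-- `Y` is a non-singular closed analytic subset of `M` having normal crossings with `E`. -/
def IsNCSubset (n : ℕ) {M : Type u} [TopologicalSpace M] [ChartedSpace (Fin n → ℂ) M]
    (E Y : Set M) : Prop :=
  IsClosed Y ∧ ∀ P ∈ Y, ∃ (φ : OpenPartialHomeomorph M (Fin n → ℂ)) (a b : Finset (Fin n)),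
    IsCoordAt φ P ∧ IsHyperplanes φ a E ∧ IsCoordSubspace φ b Y

/-- `N` is a non-singular closed analytic subset of `M`, purely of dimension `e`, having normal
crossings with `E` and transverse to `E`: locally `N` is contained in no component of `E`, that
is, no equation of `E` is among the equations of `N`. -/
def IsTransverseSubspace (n : ℕ) {M : Type u} [TopologicalSpace M]
    [ChartedSpace (Fin n → ℂ) M] (E N : Set M) (e : ℕ) : Prop :=
  IsClosed N ∧ ∀ P ∈ N, ∃ (φ : OpenPartialHomeomorph M (Fin n → ℂ)) (a b : Finset (Fin n)),
    IsCoordAt φ P ∧ IsHyperplanes φ a E ∧ IsCoordSubspace φ b N ∧ Disjoint a b ∧ b.card + e = n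

end Charts

/-! ### Blowing-ups -/

/-- The `i`-th standard affine chart of the blowing-up of `ℂⁿ` along `x j = 0`, `j ∈ b`:
the map `y ↦ x` with `x j = y i * y j` for `j ∈ b`, `j ≠ i`, and `x j = y j` otherwise. -/
def blowChart {n : ℕ} (b : Finset (Fin n)) (i : Fin n) (y : Fin n → ℂ) : Fin n → ℂ :=
  fun j => if j ∈ b ∧ j ≠ i then y i * y j else y j

/-- Homogeneous coordinates, indexed by `b`, of the normal direction of the point with
coordinates `y` of the `i`-th standard affine chart. -/
def blowDir {n : ℕ} (b : Finset (Fin n)) (i : Fin n) (y : Fin n → ℂ) : b → ℂ :=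
  fun j => if (j : Fin n) = i then 1 else y j

/-- `π : M' → M` is the blowing-up of the complex manifold `M` with the non-singular centre `Y`:
it is an isomorphism over the complement of `Y` and, in suitable coordinates of `M` at each point
of `Y`, it is the subset of `M × ℙ(ℂᵇ)` of the pairs `(x, ℓ)` such that the vector
`(φ x j)_{j ∈ b}` belongs to the line `ℓ`, covered by the standard affine charts. -/
structure IsBlowUp (n : ℕ) {M M' : Type u}
    [TopologicalSpace M] [ChartedSpace (Fin n → ℂ) M]
    [TopologicalSpace M'] [ChartedSpace (Fin n → ℂ) M']
    (π : M' → M) (Y : Set M) : Prop where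
  holomorphic : ContMDiff 𝓘(ℂ, Fin n → ℂ) 𝓘(ℂ, Fin n → ℂ) ω π
  bijOn_compl : BijOn π (π ⁻¹' Yᶜ) Yᶜ
  localIso_compl : ∀ Q : M', π Q ∉ Y →
    IsLocalDiffeomorphAt 𝓘(ℂ, Fin n → ℂ) 𝓘(ℂ, Fin n → ℂ) ω π Q
  local_model : ∀ P ∈ Y, ∃ (φ : OpenPartialHomeomorph M (Fin n → ℂ)) (b : Finset (Fin n))
    (ψ : Fin n → OpenPartialHomeomorph M' (Fin n → ℂ)),
    IsCoordAt φ P ∧ IsCoordSubspace φ b Y ∧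
    (∀ i ∈ b, ψ i ∈ IsManifold.maximalAtlas 𝓘(ℂ, Fin n → ℂ) ω M' ∧
      (ψ i).target = {y | blowChart b i y ∈ φ.target} ∧
      ∀ Q ∈ (ψ i).source, φ (π Q) = blowChart b i (ψ i Q)) ∧
    π ⁻¹' φ.source = ⋃ i ∈ b, (ψ i).source ∧
    (∀ i ∈ b, ∀ j ∈ b, ∀ Q ∈ (ψ i).source, ∀ R ∈ (ψ j).source,
      Q = R ↔ π Q = π R ∧ ∃ c : ℂ, blowDir b i (ψ i Q) = c • blowDir b j (ψ j R))

/-! ### Ambient spaces -/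

/-- A representative of an `n`-dimensional ambient space: a complex manifold `M`, considered as a
germ along the compact subset `K`, with a normal crossings divisor `E`. -/
structure Ambient (n : ℕ) where
  M : Type u
  [top : TopologicalSpace M]
  [t2 : T2Space M]
  [charted : ChartedSpace (Fin n → ℂ) M]
  [manifold : IsManifold 𝓘(ℂ, Fin n → ℂ) ω M]
  K : Set M
  isCompact_K : IsCompact K
  E : Set M
  isNCDivisor_E : IsNCDivisor n E

attribute [instance] Ambient.top Ambient.t2 Ambient.charted Ambient.manifold

/-- `σ : A' → A` is an open projection, with `w` the functions given by the projection over the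
second factor: `(σ, w)` identifies the germ of `A'.M` along `A'.K` with the germ of
`A.M × ℂᵐ` along `L × {0}`, for some compact subset `L` of `A.K`. -/
structure IsOpenProjection {n m : ℕ} (A : Ambient.{u} n) (A' : Ambient.{u} (n + m))
    (σ : A'.M → A.M) (w : A'.M → Fin m → ℂ) : Prop where
  injective : Function.Injective fun x => (σ x, w x)
  localIso : IsLocalDiffeomorph 𝓘(ℂ, Fin (n + m) → ℂ)
    (𝓘(ℂ, Fin n → ℂ).prod 𝓘(ℂ, Fin m → ℂ)) ω fun x => (σ x, w x)
  map_K : ∀ x ∈ A'.K, σ x ∈ A.K ∧ w x = 0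
  divisor : A'.E = σ ⁻¹' A.E

/-- `π : A' → A` is the blowing-up of the ambient space `A` with centre `Y`, where `Y` is a
non-singular closed analytic subset having normal crossings with the divisor of `A`, not empty
as a germ along `A.K`. -/
structure IsAmbientBlowUp {n : ℕ} (A A' : Ambient.{u} n) (π : A'.M → A.M) (Y : Set A.M) :
    Prop where
  center : IsNCSubset n A.E Y
  nonempty : (Y ∩ A.K).Nonempty
  blowUp : IsBlowUp n π Y
  map_K : A'.K = π ⁻¹' A.K
  divisor : A'.E = π ⁻¹' (A.E ∪ Y)

/-- Finite test systems over an ambient space, listed from the first transformation on. Passing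
to a smaller neighbourhood of the compact set is the open projection with `m = 0`, so a centre
that is only defined near the compact set can be blown up after such a step. -/
inductive TestSystem : {n : ℕ} → Ambient.{u} n → Type (u + 1)
  | nil {n : ℕ} (A : Ambient.{u} n) : TestSystem A
  | proj {n m : ℕ} {A : Ambient.{u} n} {A' : Ambient.{u} (n + m)}
      (σ : A'.M → A.M) (w : A'.M → Fin m → ℂ) (h : IsOpenProjection A A' σ w)
      (S : TestSystem A') : TestSystem A
  | blowUp {n : ℕ} {A A' : Ambient.{u} n}
      (Y : Set A.M) (π : A'.M → A.M) (h : IsAmbientBlowUp A A' π Y)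
      (S : TestSystem A') : TestSystem A

/-! ### Ideals of holomorphic germs -/

section Ideals

variable (n : ℕ) {M : Type u} [TopologicalSpace M] [ChartedSpace (Fin n → ℂ) M]

/-- The local ring at `P` of the submanifold `N` of `M`: germs at `P` of restrictions to `N` of
holomorphic functions on `M`. For `N = univ` it is the local ring of `M` at `P`. -/
def stalk (N : Set M) (P : M) : Subring ((𝓝[N] P).Germ ℂ) where
  carrier := {g | ∃ f : M → ℂ,
    ContMDiffAt 𝓘(ℂ, Fin n → ℂ) 𝓘(ℂ, ℂ) ω f P ∧ (f : (𝓝[N] P).Germ ℂ) = g}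
  mul_mem' := by
    rintro _ _ ⟨f, hf, rfl⟩ ⟨g, hg, rfl⟩
    exact ⟨f * g, hf.mul hg, rfl⟩
  one_mem' := ⟨1, contMDiffAt_const, rfl⟩
  add_mem' := by
    rintro _ _ ⟨f, hf, rfl⟩ ⟨g, hg, rfl⟩
    exact ⟨f + g, hf.add hg, rfl⟩
  zero_mem' := ⟨0, contMDiffAt_const, rfl⟩
  neg_mem' := by
    rintro _ ⟨f, hf, rfl⟩
    exact ⟨-f, hf.neg, rfl⟩

/-- The ideal of the germs at `P` of holomorphic functions on `N` that vanish on `N ∩ Z`. -/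
def vanishingIdeal (N Z : Set M) (P : M) : Ideal (stalk n N P) where
  carrier := {g | ∃ f : M → ℂ, ContMDiffAt 𝓘(ℂ, Fin n → ℂ) 𝓘(ℂ, ℂ) ω f P ∧
    (f : (𝓝[N] P).Germ ℂ) = g ∧ ∀ᶠ x in 𝓝[N ∩ Z] P, f x = 0}
  add_mem' := by
    rintro ⟨_, _⟩ ⟨_, _⟩ ⟨f, hf, rfl, hf0⟩ ⟨g, hg, rfl, hg0⟩
    refine ⟨f + g, hf.add hg, rfl, ?_⟩
    filter_upwards [hf0, hg0] with x h1 h2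
    simp [h1, h2]
  zero_mem' := ⟨0, contMDiffAt_const, rfl, by simp⟩
  smul_mem' := by
    rintro ⟨_, g, hg, rfl⟩ ⟨_, _⟩ ⟨f, hf, rfl, hf0⟩
    refine ⟨g * f, hg.mul hf, rfl, ?_⟩
    filter_upwards [hf0] with x h1
    simp [h1]

/-- The maximal ideal of the local ring of `N` at a point `P` of `N`. -/
def maxIdeal (N : Set M) (P : M) : Ideal (stalk n N P) := vanishingIdeal n N {P} P

variable {n}

/-- The multiplicity (order) at `P` of an ideal of the local ring of `N` at `P`: the largest `k`
such that the ideal is contained in the `k`-th power of the maximal ideal (`⊤` for `0`). -/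
def order {N : Set M} {P : M} (I : Ideal (stalk n N P)) : ℕ∞ :=
  ⨆ (k : ℕ) (_ : I ≤ maxIdeal n N P ^ k), (k : ℕ∞)

variable (n) in
/-- A family of ideals, one in each local ring of `N` (only the points of `N` matter). -/
abbrev IdealFamily (N : Set M) := ∀ P : M, Ideal (stalk n N P)

/-- The family is the family of stalks of a sheaf of principal ideals of holomorphic functions
on `N`: it is locally generated by one function. -/
def IdealFamily.IsPrincipalSheaf {N : Set M} (I : IdealFamily n N) : Prop :=
  ∀ P ∈ N, ∃ f : M → ℂ, ∀ᶠ Q in 𝓝[N] P,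
    ∃ g : stalk n N Q, (g : (𝓝[N] Q).Germ ℂ) = (f : (𝓝[N] Q).Germ ℂ) ∧ I Q = Ideal.span {g}

/-- A family of ideals with an assigned multiplicity. -/
structure Marked (n : ℕ) {M : Type u} [TopologicalSpace M] [ChartedSpace (Fin n → ℂ) M]
    (N : Set M) where
  I : IdealFamily n N
  d : ℕ

/-- The singular locus, a subset of `N`, of a list of marked ideals on `N`. -/
def singLocus (N : Set M) (L : List (Marked n N)) : Set M :=
  {P | P ∈ N ∧ ∀ J ∈ L, (J.d : ℕ∞) ≤ order (J.I P)}

/-- Hironaka's order at `P` of a list of marked ideals on `N`: the minimum of the quotients of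
the multiplicities by the assigned multiplicities. Zero ideals have quotient `⊤` and do not
contribute. -/
def hironakaOrder (N : Set M) (L : List (Marked n N)) (P : M) : ENNReal :=
  ⨅ J ∈ L, ((order (J.I P) : ℕ∞) : ENNReal) / (J.d : ENNReal)

/-- The conditions on the list of an idealistic space over `N`: all ideals are sheaves of
principal ideals, the assigned multiplicities are positive, and not all ideals vanish at a point
of `N`. -/
def IsIdealisticList (N : Set M) (L : List (Marked n N)) : Prop :=
  (∀ J ∈ L, J.I.IsPrincipalSheaf ∧ 0 < J.d) ∧ ∀ P ∈ N, ∃ J ∈ L, J.I P ≠ ⊥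

variable {n' : ℕ} {M' : Type u} [TopologicalSpace M'] [ChartedSpace (Fin n' → ℂ) M']

/-- The inverse image of a family of ideals on `N` by a holomorphic map `σ : M' → M` that sends
`N'` into `N`: its stalk at `Q` is generated by the germs on `N'` of the functions `f ∘ σ`, where
the germ of `f` at `σ Q` belongs to the given ideal. -/
def IdealFamily.pullback {N : Set M} (I : IdealFamily n N) (σ : M' → M) (N' : Set M') :
    IdealFamily n' N' := fun Q =>
  Ideal.span {g : stalk n' N' Q | ∃ f : M → ℂ, ∃ f' ∈ I (σ Q),
    (f' : (𝓝[N] (σ Q)).Germ ℂ) = (f : (𝓝[N] (σ Q)).Germ ℂ) ∧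
    (g : (𝓝[N'] Q).Germ ℂ) = ((f ∘ σ : M' → ℂ) : (𝓝[N'] Q).Germ ℂ)}

/-- The transform of a marked ideal by an open projection. -/
def Marked.pullback {N : Set M} (J : Marked n N) (σ : M' → M) (N' : Set M') : Marked n' N' :=
  ⟨J.I.pullback σ N', J.d⟩

/-- The controlled transform of a marked ideal on `N` by the blowing-up `π` with centre `Y`,
where `N'` is the strict transform of `N`: the inverse image ideal divided by the `d`-th power of
the ideal of the exceptional divisor `N' ∩ π⁻¹(Y)` of `N'`. The division is the quotient of
ideals, which is the product by the inverse when the centre lies in the singular locus. -/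
def Marked.controlled {N : Set M} (J : Marked n N) (π : M' → M) (Y : Set M) (N' : Set M') :
    Marked n' N' :=
  ⟨fun Q => (J.I.pullback π N' Q).colon (vanishingIdeal n' N' (π ⁻¹' Y) Q ^ J.d : Ideal _), J.d⟩

end Ideals

/-! ### Idealistic spaces -/

/-- A test system is permissible for the list `L` of marked ideals on the whole ambient space:
each centre is contained, as a germ along the compact set, in the singular locus of the transform
of `L` by the previous steps. -/
def TestSystem.Permissible : {n : ℕ} → {A : Ambient.{u} n} → TestSystem A →
    List (Marked n (univ : Set A.M)) → Prop
  | _, _, .nil _, _ => True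
  | _, _, .proj σ _ _ S, L => S.Permissible (L.map fun J => J.pullback σ univ)
  | _, A, .blowUp Y π _ S, L =>
      (∀ᶠ x in 𝓝ˢ A.K, x ∈ Y → x ∈ singLocus univ L) ∧
        S.Permissible (L.map fun J => J.controlled π Y univ)

/-- An idealistic space over the ambient space `A`. -/
structure IdealisticSpace {n : ℕ} (A : Ambient.{u} n) where
  L : List (Marked n (univ : Set A.M))
  isIdealistic : IsIdealisticList univ L

namespace IdealisticSpace

variable {n : ℕ} {A : Ambient.{u} n}

/-- The singular locus. -/
def sing (X : IdealisticSpace A) : Set A.M := singLocus univ X.L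

/-- Hironaka's order at a point. -/
def delta (X : IdealisticSpace A) (P : A.M) : ENNReal := hironakaOrder univ X.L P

/-- Two idealistic spaces are equivalent if they have the same permissible test systems. -/
def Equivalent (X₁ X₂ : IdealisticSpace A) : Prop :=
  ∀ S : TestSystem A, S.Permissible X₁.L ↔ S.Permissible X₂.L

end IdealisticSpace

/-! ### Immersed idealistic spaces -/

/-- The strict transform of `N` by the blowing-up `π` with centre `Y`. -/
def strictTransform {M M' : Type u} [TopologicalSpace M'] (π : M' → M) (Y N : Set M) : Set M' :=
  closure (π ⁻¹' (N \ Y))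

/-- A test system is permissible for the subspace `N` and the list `L` of marked ideals on `N`. -/
def TestSystem.ImmersedPermissible : {n : ℕ} → {A : Ambient.{u} n} → TestSystem A →
    (N : Set A.M) → List (Marked n N) → Prop
  | _, _, .nil _, _, _ => True
  | _, _, .proj σ _ _ S, N, L =>
      S.ImmersedPermissible (σ ⁻¹' N) (L.map fun J => J.pullback σ (σ ⁻¹' N))
  | _, A, .blowUp Y π _ S, N, L =>
      (∀ᶠ x in 𝓝ˢ A.K, x ∈ Y → x ∈ singLocus N L) ∧
        S.ImmersedPermissible (strictTransform π Y N)
          (L.map fun J => J.controlled π Y (strictTransform π Y N))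

/-- An immersed idealistic space of dimension `e` over the ambient space `A`. The subspace `N`
may be empty. -/
structure ImmersedIdealisticSpace {n : ℕ} (A : Ambient.{u} n) (e : ℕ) where
  N : Set A.M
  isTransverse : IsTransverseSubspace n A.E N e
  L : List (Marked n N)
  isIdealistic : IsIdealisticList N L

namespace ImmersedIdealisticSpace

variable {n e e₁ e₂ : ℕ} {A : Ambient.{u} n}

/-- The singular locus. -/
def sing (V : ImmersedIdealisticSpace A e) : Set A.M := singLocus V.N V.L

/-- Hironaka's order at a point of `N`. -/
def delta (V : ImmersedIdealisticSpace A e) (P : A.M) : ENNReal := hironakaOrder V.N V.L P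

/-- Two immersed idealistic spaces are equivalent if they have the same permissible test
systems. -/
def Equivalent (V₁ : ImmersedIdealisticSpace A e₁) (V₂ : ImmersedIdealisticSpace A e₂) : Prop :=
  ∀ S : TestSystem A, S.ImmersedPermissible V₁.N V₁.L ↔ S.ImmersedPermissible V₂.N V₂.L

end ImmersedIdealisticSpace

end

end Idealistic

/-!
The proof is Hironaka's trick: the multiplicities of the ideals at a point `P` can be read off from
the permissible test systems.

Choose coordinates at `P` in which the subspace `S` of the first space is `x j = 0`, `j ∈ c`.
Multiply by a line with coordinate `t`, blow up `s` times the origin and then `r` times the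
intersection of the exceptional divisor `t = 0` with `x j = 0`, `j ∈ c`, following each time the
affine chart in which the exceptional divisor is `t = 0` (`testSystem`). If `f` vanishes on `S` to
the order `ν` and has the assigned multiplicity `d`, then after the first `s` steps the transform of
`f` grows like `t ^ (s (ν - d))`, and each of the further steps takes away the factor `t ^ d`. So
the test system is permissible if `r d ≤ s (ν - d)` for all ideals: this is
`testSystem_permissible`, where growth is measured by `HasEstimate`.

Conversely, let the same test system be permissible for a second space, on a subspace `S'` of the
same dimension, to which the coordinates need not be adapted. The space `S'` is described by a local
holomorphic retraction `ρ` onto it that preserves `t`. The first `s` steps lift `ρ`, and make it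
linear on the exceptional divisor, with values in a space of dimension at most `dim S'`. If the next
centre is contained in the transform of `S'`, then for reasons of dimension `ρ` maps the whole
exceptional divisor into the centre, and `ρ` lifts again. At each step the inverse image of an
element of the ideal is divisible by `t ^ d` (`IsRetraction.exists_quotient`), and going back one
finds that `τ ↦ f (ρ (τ ^ s x, τ))` is of order at least `(s + r - 1) d`, or `s d` if `r = 0`, for
small `x` (`isBigO_curve_of_permissible`). Hence the terms of `f ∘ ρ` of degree `j` vanish if
`s j < (s + r - 1) d`, which bounds the multiplicity of `f` from below (`le_order_of_permissible`).

With `s = 1` and `r = 0` this shows that the singular loci agree. If Hironaka's order of the first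
space were larger than a quotient `k / d` for an ideal of the second one, then suitable large `s`
and `r` would make the test system permissible for the first space and, by equivalence, for the
second one, so that the multiplicity of the ideal would be larger than `k`
(`ImmersedIdealisticSpace.Equivalent.delta_le`).

The first part of the theorem is the case where the subspace is the whole ambient space, since the
strict transform of the whole space is the whole space (`strictTransform_univ`).
-/

namespace Idealistic

/-! ### Analytic functions: Hadamard's lemma and division by a coordinate -/

section Hadamard

variable {E F : Type*} [NormedAddCommGroup E] [NormedSpace ℂ E]
  [NormedAddCommGroup F] [NormedSpace ℂ F]

variable {F' G : Type*} [NormedAddCommGroup F'] [NormedSpace ℂ F']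
  [NormedAddCommGroup G] [NormedSpace ℂ G]

theorem _root_.AnalyticAt.clm_apply {A : E → F →L[ℂ] G} {v : E → F} {x : E}
    (hA : AnalyticAt ℂ A x) (hv : AnalyticAt ℂ v x) : AnalyticAt ℂ (fun y => A y (v y)) x :=
  AnalyticAt.fun_comp (g := fun p : (F →L[ℂ] G) × F => p.1 p.2)
    ((ContinuousLinearMap.id ℂ (F →L[ℂ] G)).analyticAt_bilinear _) (hA.prod hv)

theorem _root_.AnalyticAt.clm_comp {A : E → F' →L[ℂ] G} {B : E → F →L[ℂ] F'} {x : E}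
    (hA : AnalyticAt ℂ A x) (hB : AnalyticAt ℂ B x) :
    AnalyticAt ℂ (fun y => (A y).comp (B y)) x :=
  AnalyticAt.fun_comp (g := fun p : (F' →L[ℂ] G) × (F →L[ℂ] F') => p.1.comp p.2)
    ((ContinuousLinearMap.compL ℂ F F' G).analyticAt_bilinear _) (hA.prod hB)

/-- `f` has a power series at `x₀` without terms of degree less than `k`. -/
def VanishesToOrder (f : E → F) (x₀ : E) (k : ℕ) : Prop :=
  ∃ p : FormalMultilinearSeries ℂ E F, HasFPowerSeriesAt f p x₀ ∧ ∀ j < k, p j = 0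

/-- Hadamard's lemma: `f x = f x₀ + G x (x - x₀)` with `G` analytic, whose power series is the
shift of that of `f`. -/
theorem _root_.HasFPowerSeriesAt.exists_hadamard [CompleteSpace F] {f : E → F}
    {p : FormalMultilinearSeries ℂ E F} {x₀ : E} (hf : HasFPowerSeriesAt f p x₀) :
    ∃ G : E → E →L[ℂ] F, HasFPowerSeriesAt G p.shift x₀ ∧
      ∀ᶠ x in 𝓝 x₀, f x = f x₀ + G x (x - x₀) := by
  obtain ⟨r, hr⟩ := hf
  have hrad : 0 < p.shift.radius := by
    rw [FormalMultilinearSeries.radius_shift]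
    exact hr.r_pos.trans_le hr.r_le
  have hs := (p.shift.hasFPowerSeriesOnBall hrad).comp_sub x₀
  simp only [zero_add] at hs
  refine ⟨fun x => p.shift.sum (x - x₀), hs.hasFPowerSeriesAt, ?_⟩
  have hu := hs.unshift (z := f x₀)
  have hp : FormalMultilinearSeries.unshift p.shift (f x₀) = p := by
    ext n v
    cases n with
    | zero => simpa [FormalMultilinearSeries.unshift] using (hr.coeff_zero v).symm
    | succ n => simp [FormalMultilinearSeries.unshift, FormalMultilinearSeries.shift]
  rw [hp] at hu
  have hmin := lt_min hu.r_pos hr.r_pos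
  have h1 := hu.mono hmin (min_le_left _ _)
  have h2 := hr.mono hmin (min_le_right _ _)
  filter_upwards [Metric.eball_mem_nhds x₀ hmin] with x hx
  exact (h2.unique h1) hx

theorem VanishesToOrder.analyticAt {f : E → F} {x₀ : E} {k : ℕ} (h : VanishesToOrder f x₀ k) :
    AnalyticAt ℂ f x₀ := by
  obtain ⟨p, hp, -⟩ := h
  exact hp.analyticAt

theorem VanishesToOrder.exists_hadamard [CompleteSpace F] {f : E → F} {x₀ : E} {k : ℕ}
    (h : VanishesToOrder f x₀ (k + 1)) :
    ∃ G : E → E →L[ℂ] F, VanishesToOrder G x₀ k ∧ ∀ᶠ x in 𝓝 x₀, f x = G x (x - x₀) := by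
  obtain ⟨p, hp, h0⟩ := h
  obtain ⟨G, hG, hfG⟩ := hp.exists_hadamard
  refine ⟨G, ⟨_, hG, fun j hj => ?_⟩, ?_⟩
  · ext v w
    simp [FormalMultilinearSeries.shift, h0 (j + 1) (by omega)]
  · have : f x₀ = 0 := by
      rw [← hp.coeff_zero (fun _ => 0), h0 0 (by omega)]; rfl
    simpa [this] using hfG

theorem isBigO_pow_pow_punctured {a b : ℕ} (h : a ≤ b) :
    (fun τ : ℂ => τ ^ b) =O[𝓝[≠] 0] fun τ => τ ^ a := by
  have h1 : ∀ᶠ τ : ℂ in 𝓝[≠] 0, ‖τ‖ < 1 :=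
    nhdsWithin_le_nhds (continuous_norm.tendsto' (0 : ℂ) 0 norm_zero (Iio_mem_nhds one_pos))
  refine Asymptotics.IsBigO.of_bound 1 (h1.mono fun τ hτ => ?_)
  rw [norm_pow, norm_pow, one_mul]
  exact pow_le_pow_of_le_one (norm_nonneg _) hτ.le h

/-- The order of vanishing of `f` can be read off from the order of growth of `f` along the curves
`τ ↦ x₀ + τ ^ s • x`. -/
theorem vanishesToOrder_of_isBigO_curve {f : E → F} {x₀ : E} (hf : AnalyticAt ℂ f x₀)
    {s m k : ℕ} (hs : 0 < s) (hk : ∀ j < k, s * j < m)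
    (h : ∀ᶠ x in 𝓝 (0 : E), (fun τ : ℂ => f (x₀ + τ ^ s • x)) =O[𝓝[≠] 0] fun τ => τ ^ m) :
    VanishesToOrder f x₀ k := by
  obtain ⟨q, hq⟩ := hf
  -- the homogeneous term of degree `j` contributes the term of degree `s * j < m` along the curve
  have hdiag : ∀ j < k, ∀ y, q j (fun _ => y) = 0 := by
    intro j
    induction j using Nat.strong_induction_on with
    | _ j ih =>
      intro hj
      have h1 := hq.isBigO_sub_partialSum_pow (j + 1)
      have h2 : ∀ y, q.partialSum (j + 1) y = q j (fun _ => y) := fun y => by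
        rw [FormalMultilinearSeries.partialSum, Finset.sum_range_succ, Finset.sum_eq_zero, zero_add]
        exact fun i hi => ih i (Finset.mem_range.1 hi) ((Finset.mem_range.1 hi).trans hj) y
      simp only [h2] at h1
      have h0 : ∀ᶠ x in 𝓝 (0 : E), q j (fun _ => x) = 0 := by
        filter_upwards [h] with x hx
        have h3 : Tendsto (fun τ : ℂ => τ ^ s • x) (𝓝[≠] 0) (𝓝 0) := by
          have : ContinuousAt (fun τ : ℂ => τ ^ s • x) 0 := by fun_prop
          simpa [ContinuousAt, hs.ne'] using this.tendsto.mono_left nhdsWithin_le_nhds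
        have h4 : (fun τ : ℂ => q j (fun _ => τ ^ s • x)) =O[𝓝[≠] 0]
            fun τ => τ ^ (s * j + 1) := by
          have h5 : (fun τ : ℂ => f (x₀ + τ ^ s • x)) =O[𝓝[≠] 0] fun τ => τ ^ (s * j + 1) := by
            exact hx.trans (isBigO_pow_pow_punctured (hk j hj))
          have h6 : (fun τ : ℂ => f (x₀ + τ ^ s • x) - q j (fun _ => τ ^ s • x)) =O[𝓝[≠] 0]
              fun τ => τ ^ (s * j + 1) := by
            have h9 : s * j + 1 ≤ s * (j + 1) := by rw [mul_add_one]; omega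
            refine (h1.comp_tendsto h3).trans (.trans ?_ (isBigO_pow_pow_punctured h9))
            refine Asymptotics.IsBigO.of_bound (‖x‖ ^ (j + 1)) (.of_forall fun τ => ?_)
            simp [norm_smul, mul_pow, pow_mul, mul_comm]
          simpa using h5.sub h6
        obtain ⟨C, hC⟩ := h4.bound
        have h7 : ∀ᶠ τ : ℂ in 𝓝[≠] 0, ‖q j (fun _ => x)‖ ≤ C * ‖τ‖ := by
          filter_upwards [hC, self_mem_nhdsWithin] with τ hτ hτ0
          have : q j (fun _ => τ ^ s • x) = τ ^ (s * j) • q j (fun _ => x) := by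
            rw [ContinuousMultilinearMap.map_smul_univ]
            simp [pow_mul]
          rw [this, norm_smul, norm_pow, norm_pow, pow_succ, mul_left_comm] at hτ
          exact le_of_mul_le_mul_left hτ (pow_pos (norm_pos_iff.2 hτ0) _)
        have h8 : Tendsto (fun τ : ℂ => C * ‖τ‖) (𝓝[≠] 0) (𝓝 0) := by
          have : ContinuousAt (fun τ : ℂ => C * ‖τ‖) 0 := by fun_prop
          simpa [ContinuousAt] using this.tendsto.mono_left nhdsWithin_le_nhds
        exact norm_le_zero_iff.1 (ge_of_tendsto h8 h7)
      refine Asymptotics.IsBigO.continuousMultilinearMap_apply_eq_zero ?_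
      exact (Asymptotics.isBigO_zero _ _).congr' (h0.mono fun x hx => hx.symm) .rfl
  refine ⟨fun j => if j < k then 0 else q j, ?_, fun j hj => if_pos hj⟩
  obtain ⟨r, hr⟩ := hq
  refine ⟨r, ⟨hr.r_le.trans (FormalMultilinearSeries.radius_le_of_le fun j => ?_), hr.r_pos, ?_⟩⟩
  · split_ifs <;> simp
  · intro y hy
    convert hr.hasSum hy using 2 with j
    split_ifs with hj
    · simp [hdiag j hj]
    · rfl

theorem vanishesToOrder_of_isBigO {f : E → F} {x₀ : E} (hf : AnalyticAt ℂ f x₀)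
    {k : ℕ} (h : f =O[𝓝 x₀] fun x => ‖x - x₀‖ ^ k) :
    VanishesToOrder f x₀ k := by
  refine vanishesToOrder_of_isBigO_curve hf (s := 1) (m := k) one_pos (by simp)
    (.of_forall fun x => ?_)
  have h3 : Tendsto (fun τ : ℂ => x₀ + τ ^ 1 • x) (𝓝[≠] 0) (𝓝 x₀) := by
    have : ContinuousAt (fun τ : ℂ => x₀ + τ ^ 1 • x) 0 := by fun_prop
    simpa [ContinuousAt] using this.tendsto.mono_left nhdsWithin_le_nhds
  refine (h.comp_tendsto h3).trans ?_
  refine Asymptotics.IsBigO.of_bound (‖x‖ ^ k) (.of_forall fun τ => ?_)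
  simp [norm_smul, mul_pow, mul_comm]

/-- A power series with values in integrals: if `g` is analytic at `0` and `ℓ τ`, `τ ∈ [0, 1]`, are
linear contractions, then `x ↦ ∫ g (ℓ τ x) dτ` is analytic at `0`. -/
theorem analyticAt_integral_comp_clm [CompleteSpace F] {g : E → F} (hg : AnalyticAt ℂ g 0)
    {ℓ : ℝ → E →L[ℂ] E} (hℓ : Continuous ℓ) (hℓ1 : ∀ τ ∈ Icc (0 : ℝ) 1, ‖ℓ τ‖ ≤ 1) :
    AnalyticAt ℂ (fun x => ∫ τ in Icc (0 : ℝ) 1, g (ℓ τ x)) 0 := by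
  obtain ⟨p, r, hr⟩ := hg
  let T : (n : ℕ) → ℝ → E [×n]→L[ℂ] F := fun n τ => (p n).compContinuousLinearMap fun _ => ℓ τ
  have hTc : ∀ n, Continuous (T n) := by
    intro n
    have := (ContinuousMultilinearMap.compContinuousLinearMapContinuousMultilinear ℂ
      (fun _ : Fin n => E) (fun _ => E) F).cont.comp (continuous_pi fun _ => hℓ)
    exact this.clm_apply continuous_const
  have hTn : ∀ n, ∀ τ ∈ Icc (0 : ℝ) 1, ‖T n τ‖ ≤ ‖p n‖ := by
    intro n τ hτ
    refine (ContinuousMultilinearMap.norm_compContinuousLinearMap_le _ _).trans ?_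
    refine mul_le_of_le_one_right (norm_nonneg _) ?_
    exact Finset.prod_le_one (fun _ _ => norm_nonneg _) fun _ _ => hℓ1 τ hτ
  have hTi : ∀ n, MeasureTheory.IntegrableOn (T n) (Icc (0 : ℝ) 1) := fun n =>
    (hTc n).continuousOn.integrableOn_compact isCompact_Icc
  let q : FormalMultilinearSeries ℂ E F := fun n => ∫ τ in Icc (0 : ℝ) 1, T n τ
  have hqn : ∀ n, ‖q n‖ ≤ ‖p n‖ := by
    intro n
    have := MeasureTheory.norm_setIntegral_le_of_norm_le_const (μ := MeasureTheory.volume)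
      (by simp) (hTn n)
    simpa using this
  refine ⟨q, r, ⟨hr.r_le.trans (FormalMultilinearSeries.radius_le_of_le hqn), hr.r_pos, ?_⟩⟩
  intro y hy
  have hball : ∀ τ ∈ Icc (0 : ℝ) 1, ℓ τ y ∈ Metric.eball (0 : E) r := by
    intro τ hτ
    rw [mem_eball_zero_iff] at hy ⊢
    refine lt_of_le_of_lt ?_ hy
    rw [enorm_le_iff_norm_le]
    exact (ContinuousLinearMap.le_opNorm _ _).trans
      (mul_le_of_le_one_left (norm_nonneg _) (hℓ1 τ hτ))
  have hsum : Summable fun n => ‖p n‖ * ‖y‖ ^ n := by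
    refine p.summable_norm_mul_pow (r := ‖y‖₊) ?_
    exact lt_of_lt_of_le (mem_eball_zero_iff.1 hy) hr.r_le
  have key := MeasureTheory.hasSum_integral_of_summable_integral_norm
    (μ := MeasureTheory.volume.restrict (Icc (0 : ℝ) 1))
    (F := fun n τ => T n τ fun _ => y) ?_ ?_
  · have e1 : ∀ n, ∫ τ in Icc (0 : ℝ) 1, (T n τ fun _ => y) = q n fun _ => y := fun n =>
      (ContinuousMultilinearMap.integral_apply (hTi n) _).symm
    have e2 : ∫ τ in Icc (0 : ℝ) 1, ∑' n, (T n τ fun _ => y)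
        = ∫ τ in Icc (0 : ℝ) 1, g (ℓ τ y) := by
      refine MeasureTheory.setIntegral_congr_fun measurableSet_Icc fun τ hτ => ?_
      simpa [T] using (hr.hasSum (hball τ hτ)).tsum_eq
    simp only [e1, e2] at key
    simpa using key
  · intro n
    exact ((ContinuousMultilinearMap.apply ℂ (fun _ : Fin n => E) F fun _ => y).continuous.comp
      (hTc n)).continuousOn.integrableOn_compact isCompact_Icc
  · refine Summable.of_nonneg_of_le (fun n => ?_) (fun n => ?_) hsum
    · exact MeasureTheory.integral_nonneg fun _ => norm_nonneg _
    · have h1 : ∀ τ ∈ Icc (0 : ℝ) 1, ‖(T n τ fun _ => y)‖ ≤ ‖p n‖ * ‖y‖ ^ n := by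
        intro τ hτ
        refine ((T n τ).le_opNorm _).trans ?_
        simpa using mul_le_mul_of_nonneg_right (hTn n τ hτ) (by positivity)
      have h2 := MeasureTheory.norm_setIntegral_le_of_norm_le_const (μ := MeasureTheory.volume)
        (f := fun τ => ‖(T n τ fun _ => y)‖) (s := Icc (0 : ℝ) 1) (by simp)
        (fun τ hτ => by simpa using h1 τ hτ)
      refine (le_abs_self _).trans ?_
      simpa using h2

end Hadamard

section Division

variable {N : ℕ}

/-- The linear map that multiplies the coordinate `i` by `τ`. -/
noncomputable def scaleCoord (i : Fin N) (τ : ℝ) : (Fin N → ℂ) →L[ℂ] (Fin N → ℂ) :=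
  ContinuousLinearMap.id ℂ _ +
    ((τ : ℂ) - 1) • (ContinuousLinearMap.single ℂ (fun _ : Fin N => ℂ) i).comp
      (ContinuousLinearMap.proj i)

theorem scaleCoord_apply (i : Fin N) (τ : ℝ) (x : Fin N → ℂ) :
    scaleCoord i τ x = x + (((τ : ℂ) - 1) * x i) • Pi.single i (1 : ℂ) := by
  ext j
  by_cases h : j = i
  · subst h; simp [scaleCoord]
  · simp [scaleCoord, h]

/-- An analytic function that vanishes on the coordinate hyperplane `x i = 0` is divisible by
`x i`: the quotient is `∫ (∂ᵢ Φ) (x with x i replaced by τ x i) dτ`. -/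
theorem exists_eq_coord_mul {Φ : (Fin N → ℂ) → ℂ} {x₀ : Fin N → ℂ} {i : Fin N}
    (hΦ : AnalyticAt ℂ Φ x₀) (hx₀ : x₀ i = 0) (h : ∀ᶠ x in 𝓝 x₀, x i = 0 → Φ x = 0) :
    ∃ Ψ : (Fin N → ℂ) → ℂ, AnalyticAt ℂ Ψ x₀ ∧ ∀ᶠ x in 𝓝 x₀, Φ x = x i * Ψ x := by
  set f : (Fin N → ℂ) → ℂ := fun x => Φ (x₀ + x) with hf
  have hadd : Tendsto (fun x => x₀ + x) (𝓝 0) (𝓝 x₀) := by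
    have : ContinuousAt (fun x => x₀ + x) 0 := by fun_prop
    simpa [ContinuousAt] using this
  have hsub : Tendsto (fun x => x - x₀) (𝓝 x₀) (𝓝 0) := by
    have : ContinuousAt (fun x => x - x₀) x₀ := by fun_prop
    simpa [ContinuousAt] using this
  have hfa : AnalyticAt ℂ f 0 := by
    refine AnalyticAt.fun_comp (by simpa using hΦ) (by fun_prop)
  have hf0 : ∀ᶠ x in 𝓝 (0 : Fin N → ℂ), x i = 0 → f x = 0 := by
    filter_upwards [hadd.eventually h] with x hx hxi
    exact hx (by simp [hx₀, hxi])
  let g : (Fin N → ℂ) → ℂ := fun x => fderiv ℂ f x (Pi.single i 1)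
  have hg : AnalyticAt ℂ g 0 :=
    (ContinuousLinearMap.apply ℂ ℂ (Pi.single i (1 : ℂ) : Fin N → ℂ)).analyticAt _
      |>.fun_comp hfa.fderiv
  have hℓc : Continuous (scaleCoord (N := N) i) := by
    unfold scaleCoord; fun_prop
  have hℓ1 : ∀ τ ∈ Icc (0 : ℝ) 1, ‖scaleCoord (N := N) i τ‖ ≤ 1 := by
    intro τ hτ
    refine ContinuousLinearMap.opNorm_le_bound _ zero_le_one fun x => ?_
    rw [one_mul, pi_norm_le_iff_of_nonneg (norm_nonneg _)]
    intro j
    rw [scaleCoord_apply]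
    by_cases hj : j = i
    · subst hj
      have : x j + (↑τ - 1) * x j = τ * x j := by ring
      simp only [Pi.add_apply, Pi.smul_apply, Pi.single_eq_same, smul_eq_mul, mul_one, this,
        norm_mul, Complex.norm_real, Real.norm_of_nonneg hτ.1]
      exact (mul_le_of_le_one_left (norm_nonneg _) hτ.2).trans (norm_le_pi_norm x j)
    · simpa [hj] using norm_le_pi_norm x j
  have hint := analyticAt_integral_comp_clm hg hℓc hℓ1
  refine ⟨fun x => ∫ τ in Icc (0 : ℝ) 1, g (scaleCoord i τ (x - x₀)), ?_, ?_⟩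
  · refine AnalyticAt.fun_comp (g := fun x => ∫ τ in Icc (0 : ℝ) 1, g (scaleCoord i τ x))
      (by simpa using hint) (by fun_prop)
  · have hfd : ∀ᶠ x in 𝓝 (0 : Fin N → ℂ), AnalyticAt ℂ f x := hfa.eventually_analyticAt
    obtain ⟨ε, hε, hball⟩ := Metric.eventually_nhds_iff_ball.1 (hfd.and hf0)
    have key : ∀ x ∈ Metric.ball (0 : Fin N → ℂ) ε,
        f x = x i * ∫ τ in Icc (0 : ℝ) 1, g (scaleCoord i τ x) := by
      intro x hx
      have hmem : ∀ τ ∈ Icc (0 : ℝ) 1, scaleCoord i τ x ∈ Metric.ball (0 : Fin N → ℂ) ε := by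
        intro τ hτ
        rw [mem_ball_zero_iff] at hx ⊢
        exact lt_of_le_of_lt ((ContinuousLinearMap.le_opNorm _ _).trans
          (mul_le_of_le_one_left (norm_nonneg _) (hℓ1 τ hτ))) hx
      have hder : ∀ τ ∈ uIcc (0 : ℝ) 1, HasDerivAt (fun τ : ℝ => f (scaleCoord i τ x))
          (x i * g (scaleCoord i τ x)) τ := by
        intro τ hτ
        rw [uIcc_of_le zero_le_one] at hτ
        have h1 := (hball _ (hmem τ hτ)).1.differentiableAt.hasFDerivAt.restrictScalars ℝ
        have h2 : HasDerivAt (fun τ : ℝ => scaleCoord i τ x) (x i • Pi.single i (1 : ℂ)) τ := by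
          simp only [scaleCoord_apply]
          have h3 : HasDerivAt (fun τ : ℝ => ((τ : ℂ) - 1) * x i) (x i) τ := by
            simpa using ((Complex.ofRealCLM.hasDerivAt (x := τ)).sub_const 1).mul_const (x i)
          simpa using (h3.smul_const (Pi.single i (1 : ℂ) : Fin N → ℂ)).const_add x
        have h4 := h1.comp_hasDerivAt τ h2
        simpa [g, Function.comp_def] using h4
      have hcont : ContinuousOn (fun τ : ℝ => x i * g (scaleCoord i τ x)) (uIcc 0 1) := by
        rw [uIcc_of_le zero_le_one]
        intro τ hτ
        have h1 : ContinuousAt g (scaleCoord i τ x) :=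
          (hball _ (hmem τ hτ)).1.fderiv.continuousAt.clm_apply continuousAt_const
        have h2 : ContinuousAt (fun τ : ℝ => scaleCoord i τ x) τ :=
          (hℓc.clm_apply continuous_const).continuousAt
        exact (continuousAt_const.mul
          (ContinuousAt.comp' (f := fun τ : ℝ => scaleCoord i τ x) h1 h2)).continuousWithinAt
      have hI := intervalIntegral.integral_eq_sub_of_hasDerivAt hder hcont.intervalIntegrable
      have h0 : f (scaleCoord i 0 x) = 0 :=
        (hball _ (hmem 0 (by simp))).2 (by simp [scaleCoord_apply])
      have h1 : scaleCoord i 1 x = x := by simp [scaleCoord_apply]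
      rw [h0, h1, sub_zero, intervalIntegral.integral_const_mul,
        intervalIntegral.integral_of_le zero_le_one,
        ← MeasureTheory.integral_Icc_eq_integral_Ioc] at hI
      exact hI.symm
    filter_upwards [hsub.eventually (Metric.ball_mem_nhds 0 hε)] with x hx
    have := key _ hx
    simpa [hf, hx₀] using this

theorem tendsto_add_single (x : Fin N → ℂ) (t : Fin N) :
    Tendsto (fun τ : ℂ => x + τ • (Pi.single t 1 : Fin N → ℂ)) (𝓝[≠] 0) (𝓝 x) := by
  have : ContinuousAt (fun τ : ℂ => x + τ • (Pi.single t 1 : Fin N → ℂ)) 0 := by fun_prop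
  simpa [ContinuousAt] using this.tendsto.mono_left nhdsWithin_le_nhds

/-- Division by a power of a coordinate; the hypothesis is an estimate along the lines transverse
to the hyperplane `x i = 0`, without uniformity. -/
theorem exists_eq_coord_pow_mul {x₀ : Fin N → ℂ} {i : Fin N} (hx₀ : x₀ i = 0) (m : ℕ) :
    ∀ {Φ : (Fin N → ℂ) → ℂ}, AnalyticAt ℂ Φ x₀ →
    (∀ᶠ x in 𝓝 x₀, x i = 0 →
      (fun τ : ℂ => Φ (x + τ • Pi.single i 1)) =O[𝓝[≠] 0] fun τ => τ ^ m) →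
    ∃ Ψ : (Fin N → ℂ) → ℂ, AnalyticAt ℂ Ψ x₀ ∧ ∀ᶠ x in 𝓝 x₀, Φ x = x i ^ m * Ψ x := by
  induction m with
  | zero => exact fun {Φ} hΦ _ => ⟨Φ, hΦ, by simp⟩
  | succ m ih =>
    intro Φ hΦ h
    have h0 : ∀ᶠ x in 𝓝 x₀, x i = 0 → Φ x = 0 := by
      filter_upwards [h, hΦ.eventually_analyticAt] with x hx hax hxi
      have h1 : Tendsto (fun τ : ℂ => Φ (x + τ • Pi.single i 1)) (𝓝[≠] 0) (𝓝 (Φ x)) :=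
        hax.continuousAt.tendsto.comp (tendsto_add_single x i)
      have h2 : Tendsto (fun τ : ℂ => τ ^ (m + 1)) (𝓝[≠] 0) (𝓝 0) := by
        have : ContinuousAt (fun τ : ℂ => τ ^ (m + 1)) 0 := by fun_prop
        simpa [ContinuousAt] using this.tendsto.mono_left nhdsWithin_le_nhds
      exact tendsto_nhds_unique h1 ((hx hxi).trans_tendsto h2)
    obtain ⟨Ψ, hΨ, hΦΨ⟩ := exists_eq_coord_mul hΦ hx₀ h0
    obtain ⟨Θ, hΘ, hΨΘ⟩ := ih hΨ (by
      filter_upwards [h, hΦΨ.eventually_nhds] with x hx hxΨ hxi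
      obtain ⟨C, hC⟩ := (hx hxi).bound
      refine Asymptotics.IsBigO.of_bound C ?_
      filter_upwards [hC, (tendsto_add_single x i).eventually hxΨ, self_mem_nhdsWithin]
        with τ hτ hτΨ hτ0
      rw [hτΨ] at hτ
      simp only [Pi.add_apply, hxi, Pi.smul_apply, Pi.single_eq_same, smul_eq_mul, mul_one,
        zero_add, norm_mul, norm_pow, pow_succ'] at hτ
      rw [mul_left_comm] at hτ
      simpa using le_of_mul_le_mul_left hτ (norm_pos_iff.2 hτ0))
    refine ⟨Θ, hΘ, ?_⟩
    filter_upwards [hΦΨ, hΨΘ] with x h1 h2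
    rw [h1, h2]; ring

end Division

/-! ### Local rings and powers of the maximal ideal in coordinates -/

theorem contMDiffAt_iff_analyticAt {E F : Type*} [NormedAddCommGroup E] [NormedSpace ℂ E]
    [NormedAddCommGroup F] [NormedSpace ℂ F] [CompleteSpace F] {f : E → F} {x : E} :
    ContMDiffAt 𝓘(ℂ, E) 𝓘(ℂ, F) ω f x ↔ AnalyticAt ℂ f x := by
  rw [contMDiffAt_iff_contDiffAt, ← contDiffWithinAt_univ,
    contDiffWithinAt_omega_iff_analyticWithinAt, analyticWithinAt_univ]

theorem analyticAt_coord {ι : Type*} [Fintype ι] (i : ι) (x : ι → ℂ) :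
    AnalyticAt ℂ (fun x : ι → ℂ => x i) x :=
  (ContinuousLinearMap.proj (R := ℂ) (φ := fun _ : ι => ℂ) i).analyticAt x

section Stalk

variable {n : ℕ} {M : Type u} [TopologicalSpace M] [ChartedSpace (Fin n → ℂ) M]

/-- The germ on `N` at `P` of a function that is holomorphic at `P`. -/
def germOf (N : Set M) {P : M} {f : M → ℂ} (hf : ContMDiffAt 𝓘(ℂ, Fin n → ℂ) 𝓘(ℂ, ℂ) ω f P) :
    stalk n N P := ⟨(f : (𝓝[N] P).Germ ℂ), f, hf, rfl⟩

/-- Some element of the ideal `I` is the germ on `N` of the function `f`. -/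
def InIdeal {N : Set M} {P : M} (I : Ideal (stalk n N P)) (f : M → ℂ) : Prop :=
  ∃ g ∈ I, (g : (𝓝[N] P).Germ ℂ) = (f : (𝓝[N] P).Germ ℂ)

theorem InIdeal.mono {N : Set M} {P : M} {I J : Ideal (stalk n N P)} {f : M → ℂ}
    (h : InIdeal I f) (hIJ : I ≤ J) : InIdeal J f := by
  obtain ⟨g, hg, hgf⟩ := h
  exact ⟨g, hIJ hg, hgf⟩

theorem exists_rep {N : Set M} {P : M} (g : stalk n N P) :
    ∃ f : M → ℂ, ContMDiffAt 𝓘(ℂ, Fin n → ℂ) 𝓘(ℂ, ℂ) ω f P ∧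
      (g : (𝓝[N] P).Germ ℂ) = (f : (𝓝[N] P).Germ ℂ) := by
  obtain ⟨f, hf, h⟩ := g.2
  exact ⟨f, hf, h.symm⟩

theorem le_order_iff {N : Set M} {P : M} {I : Ideal (stalk n N P)} {k : ℕ} :
    (k : ℕ∞) ≤ order I ↔ I ≤ maxIdeal n N P ^ k := by
  refine ⟨fun h => ?_, fun h => le_iSup₂_of_le k h le_rfl⟩
  by_contra hI
  have hk : k ≠ 0 := by
    rintro rfl
    simp at hI
  have : order I ≤ ((k - 1 : ℕ) : ℕ∞) := by
    refine iSup₂_le fun j hj => ?_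
    have : j < k := by
      by_contra hjk
      exact hI (hj.trans (Ideal.pow_le_pow_right (not_lt.1 hjk)))
    exact_mod_cast Nat.le_sub_one_of_lt this
  have h2 : k ≤ k - 1 := by exact_mod_cast h.trans this
  omega

theorem isBigO_one_of_rep {N : Set M} {P : M} (g : stalk n N P) {f : M → ℂ}
    (hf : (g : (𝓝[N] P).Germ ℂ) = (f : (𝓝[N] P).Germ ℂ)) :
    f =O[𝓝[N] P] fun _ => (1 : ℝ) := by
  obtain ⟨f', hf', hgf'⟩ := exists_rep g
  have h1 : f =ᶠ[𝓝[N] P] f' := Germ.coe_eq.1 (hf.symm.trans hgf')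
  refine (Asymptotics.IsBigO.mono ?_ nhdsWithin_le_nhds).congr' h1.symm .rfl
  exact hf'.continuousAt.norm.isBoundedUnder_le.isBigO_one ℝ

variable {φ : OpenPartialHomeomorph M (Fin n → ℂ)} {P : M}

theorem analyticAt_comp_symm (hφ : φ ∈ IsManifold.maximalAtlas 𝓘(ℂ, Fin n → ℂ) ω M)
    (hP : P ∈ φ.source) {f : M → ℂ} (hf : ContMDiffAt 𝓘(ℂ, Fin n → ℂ) 𝓘(ℂ, ℂ) ω f P) :
    AnalyticAt ℂ (f ∘ φ.symm) (φ P) := by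
  rw [← contMDiffAt_iff_analyticAt]
  refine ContMDiffAt.comp _ ?_ (contMDiffAt_symm_of_mem_maximalAtlas hφ (φ.map_source hP))
  rwa [φ.left_inv hP]

theorem contMDiffAt_comp_chart (hφ : φ ∈ IsManifold.maximalAtlas 𝓘(ℂ, Fin n → ℂ) ω M)
    (hP : P ∈ φ.source) {F : (Fin n → ℂ) → ℂ} (hF : AnalyticAt ℂ F (φ P)) :
    ContMDiffAt 𝓘(ℂ, Fin n → ℂ) 𝓘(ℂ, ℂ) ω (F ∘ φ) P := by
  rw [← contMDiffAt_iff_analyticAt] at hF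
  exact hF.comp P (contMDiffAt_of_mem_maximalAtlas hφ hP)

/-- An element of the `k`-th power of the maximal ideal vanishes to order `k`. -/
theorem isBigO_of_mem_maxIdeal_pow (hφ : φ ∈ IsManifold.maximalAtlas 𝓘(ℂ, Fin n → ℂ) ω M)
    (hP : P ∈ φ.source) {N : Set M} (hPN : P ∈ N) {k : ℕ} {f : M → ℂ}
    (hf : InIdeal (maxIdeal n N P ^ k) f) :
    f =O[𝓝[N] P] fun q => ‖φ q - φ P‖ ^ k := by
  obtain ⟨g, hg, hgf⟩ := hf
  induction k generalizing g f with
  | zero => simpa using isBigO_one_of_rep g hgf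
  | succ k ih =>
    rw [pow_succ] at hg
    refine Submodule.mul_induction_on (C := fun g : stalk n N P => ∀ f : M → ℂ,
      (g : (𝓝[N] P).Germ ℂ) = (f : (𝓝[N] P).Germ ℂ) →
        f =O[𝓝[N] P] fun q => ‖φ q - φ P‖ ^ (k + 1)) hg ?_ ?_ f hgf
    · intro a ha b hb f hf
      obtain ⟨f₁, -, hf₁⟩ := exists_rep a
      obtain ⟨f₂, hf₂, hbf, h0⟩ := hb
      have h1 := ih a ha hf₁
      have h2 : f₂ =O[𝓝[N] P] fun q => ‖φ q - φ P‖ := by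
        have hP0 : f₂ P = 0 := by
          refine h0.self_of_nhdsWithin ⟨hPN, rfl⟩
        have h3 := (analyticAt_comp_symm hφ hP hf₂).differentiableAt.isBigO_sub
        have h4 := h3.comp_tendsto (φ.continuousAt hP)
        refine (h4.mono nhdsWithin_le_nhds).norm_right.congr' ?_ .rfl
        filter_upwards [nhdsWithin_le_nhds (φ.open_source.mem_nhds hP)] with q hq
        simp [φ.left_inv hq, φ.left_inv hP, hP0]
      have h5 : f =ᶠ[𝓝[N] P] fun q => f₁ q * f₂ q := by
        refine Germ.coe_eq.1 (hf.symm.trans ?_)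
        rw [Subring.coe_mul, hf₁, ← hbf]; rfl
      simpa only [pow_succ] using (h1.mul h2).congr' h5.symm .rfl
    · intro a b ha hb f hf
      obtain ⟨f₁, -, hf₁⟩ := exists_rep a
      obtain ⟨f₂, -, hf₂⟩ := exists_rep b
      have h5 : f =ᶠ[𝓝[N] P] fun q => f₁ q + f₂ q := by
        refine Germ.coe_eq.1 (hf.symm.trans ?_)
        rw [Subring.coe_add, hf₁, hf₂]; rfl
      exact ((ha f₁ hf₁).add (hb f₂ hf₂)).congr' h5.symm .rfl

/-- A function that vanishes to order `k` belongs to the `k`-th power of the maximal ideal, by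
Hadamard's lemma. -/
theorem germOf_mem_maxIdeal_pow (hφ : φ ∈ IsManifold.maximalAtlas 𝓘(ℂ, Fin n → ℂ) ω M)
    (hP : P ∈ φ.source) (N : Set M) {k : ℕ} {F : (Fin n → ℂ) → ℂ}
    (hF : VanishesToOrder F (φ P) k) :
    germOf N (contMDiffAt_comp_chart hφ hP hF.analyticAt) ∈ maxIdeal n N P ^ k := by
  induction k generalizing F with
  | zero => simp
  | succ k ih =>
    obtain ⟨G, hG, hFG⟩ := hF.exists_hadamard
    have hGi : ∀ i, VanishesToOrder (fun x => G x (Pi.single i 1)) (φ P) k := by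
      intro i
      obtain ⟨p, ⟨r, hp⟩, h0⟩ := hG
      refine ⟨_, ((ContinuousLinearMap.apply ℂ ℂ
        (Pi.single i (1 : ℂ) : Fin n → ℂ)).comp_hasFPowerSeriesOnBall hp).hasFPowerSeriesAt,
        fun j hj => ?_⟩
      ext v
      simp [h0 j hj]
    have hxi : ∀ i, AnalyticAt ℂ (fun x : Fin n → ℂ => x i - φ P i) (φ P) := fun i =>
      (analyticAt_coord i _).sub analyticAt_const
    have hsum : germOf N (contMDiffAt_comp_chart hφ hP hF.analyticAt) = ∑ i,
        germOf N (contMDiffAt_comp_chart hφ hP (hGi i).analyticAt) *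
          germOf N (contMDiffAt_comp_chart hφ hP (hxi i)) := by
      apply Subtype.ext
      have e1 : ((∑ i, germOf N (contMDiffAt_comp_chart hφ hP (hGi i).analyticAt) *
          germOf N (contMDiffAt_comp_chart hφ hP (hxi i)) : stalk n N P) : (𝓝[N] P).Germ ℂ) =
          ((∑ i, fun q => G (φ q) (Pi.single i 1) * (φ q i - φ P i) : M → ℂ) :
            (𝓝[N] P).Germ ℂ) := by
        rw [AddSubmonoidClass.coe_finsetSum]
        exact (map_sum (Germ.coeRingHom (R := ℂ) (𝓝[N] P)) _ _).symm
      rw [e1]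
      refine Germ.coe_eq.2 (nhdsWithin_le_nhds ?_)
      filter_upwards [(φ.continuousAt hP).eventually hFG] with q hq
      rw [Function.comp_apply, hq, Finset.sum_apply]
      conv_lhs => rw [pi_eq_sum_univ' (φ q - φ P)]
      simp only [map_sum, map_smul, Pi.sub_apply, smul_eq_mul]
      exact Finset.sum_congr rfl fun i _ => mul_comm _ _
    rw [hsum, pow_succ]
    refine Ideal.sum_mem _ fun i _ => Ideal.mul_mem_mul (ih (hGi i)) ?_
    refine ⟨_, contMDiffAt_comp_chart hφ hP (hxi i), rfl, ?_⟩
    have : ∀ᶠ q in 𝓝[N ∩ {P}] P, q = P := by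
      filter_upwards [self_mem_nhdsWithin] with q hq using hq.2
    exact this.mono fun q hq => by simp [hq]

/-- The criterion for a germ on a subspace `N` to belong to a power of the maximal ideal, in
terms of a holomorphic retraction `ρ` onto `N`, in the coordinates `φ`. -/
theorem mem_maxIdeal_pow_of_retraction
    (hφ : φ ∈ IsManifold.maximalAtlas 𝓘(ℂ, Fin n → ℂ) ω M) (hP : P ∈ φ.source) {N : Set M}
    {ρ : (Fin n → ℂ) → (Fin n → ℂ)} (hρN : ∀ᶠ q in 𝓝[N] P, ρ (φ q) = φ q) {k : ℕ}
    {g : stalk n N P} {f : M → ℂ} (hf : (g : (𝓝[N] P).Germ ℂ) = (f : (𝓝[N] P).Germ ℂ))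
    (h : VanishesToOrder (f ∘ φ.symm ∘ ρ) (φ P) k) : g ∈ maxIdeal n N P ^ k := by
  have hg : g = germOf N (contMDiffAt_comp_chart hφ hP h.analyticAt) := by
    apply Subtype.ext
    rw [hf]
    refine Germ.coe_eq.2 ?_
    filter_upwards [hρN, nhdsWithin_le_nhds (φ.open_source.mem_nhds hP)] with q hq hqs
    simp [hq, φ.left_inv hqs]
  rw [hg]
  exact germOf_mem_maxIdeal_pow hφ hP N h

end Stalk

/-! ### Recentring coordinates -/

section Recenter

variable {n : ℕ} {M : Type u} [TopologicalSpace M]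

/-- The coordinates `φ - φ Q`. -/
noncomputable def recenter (φ : OpenPartialHomeomorph M (Fin n → ℂ)) (Q : M) :
    OpenPartialHomeomorph M (Fin n → ℂ) :=
  φ.transHomeomorph (Homeomorph.subRight (φ Q))

theorem recenter_apply (φ : OpenPartialHomeomorph M (Fin n → ℂ)) (Q x : M) :
    recenter φ Q x = φ x - φ Q := rfl

variable [ChartedSpace (Fin n → ℂ) M] [IsManifold 𝓘(ℂ, Fin n → ℂ) ω M]
  {φ : OpenPartialHomeomorph M (Fin n → ℂ)} {Q : M}

theorem recenter_mem_maximalAtlas (hφ : φ ∈ IsManifold.maximalAtlas 𝓘(ℂ, Fin n → ℂ) ω M)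
    (v : Fin n → ℂ) :
    φ.transHomeomorph (Homeomorph.subRight v) ∈
      IsManifold.maximalAtlas 𝓘(ℂ, Fin n → ℂ) ω M := by
  have h1 : ContMDiff 𝓘(ℂ, Fin n → ℂ) 𝓘(ℂ, Fin n → ℂ) ω fun y : Fin n → ℂ => y - v :=
    (contDiff_id.sub contDiff_const).contMDiff
  have h2 : ContMDiff 𝓘(ℂ, Fin n → ℂ) 𝓘(ℂ, Fin n → ℂ) ω fun y : Fin n → ℂ => y + v :=
    (contDiff_id.add contDiff_const).contMDiff
  refine OpenPartialHomeomorph.mem_maximalAtlas_of_contMDiffOn _ ?_ ?_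
  · exact h1.comp_contMDiffOn (contMDiffOn_of_mem_maximalAtlas hφ)
  · exact (contMDiffOn_symm_of_mem_maximalAtlas hφ).comp h2.contMDiffOn fun y hy => hy

/-- Coordinates in which `E` is a union of coordinate hyperplanes can be centred at any point of
their domain. -/
theorem exists_recentered (hφ : φ ∈ IsManifold.maximalAtlas 𝓘(ℂ, Fin n → ℂ) ω M)
    (hQ : Q ∈ φ.source) {a : Finset (Fin n)} {E : Set M} (hE : IsHyperplanes φ a E) :
    ∃ (ψ : OpenPartialHomeomorph M (Fin n → ℂ)) (a' : Finset (Fin n)),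
      IsCoordAt ψ Q ∧ IsHyperplanes ψ a' E ∧
      ∀ (b : Finset (Fin n)) (Y : Set M), IsCoordSubspace φ b Y → Q ∈ Y →
        IsCoordSubspace ψ b Y := by
  classical
  -- the domain is shrunk so that the equations of `E` that do not vanish at `Q` vanish nowhere
  let U : Set M := φ.source ∩ φ ⁻¹' {y | ∀ i ∈ a, φ Q i ≠ 0 → y i ≠ 0}
  have hU : IsOpen U := by
    refine φ.isOpen_inter_preimage ?_
    have : {y : Fin n → ℂ | ∀ i ∈ a, φ Q i ≠ 0 → y i ≠ 0} =
        ⋂ i ∈ a, {y : Fin n → ℂ | φ Q i ≠ 0 → y i ≠ 0} := by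
      ext y; simp
    rw [this]
    refine isOpen_biInter_finset fun i _ => ?_
    by_cases h : φ Q i = 0
    · simp [h]
    · simpa [h] using isOpen_ne_fun (continuous_apply i) continuous_const
  have hsrc : ∀ x, x ∈ ((recenter φ Q).restr U).source → x ∈ U := by
    intro x hx
    rw [OpenPartialHomeomorph.restr_source, hU.interior_eq] at hx
    exact hx.2
  refine ⟨(recenter φ Q).restr U, a.filter fun i => φ Q i = 0, ⟨?_, ?_, ?_⟩, ?_, ?_⟩
  · exact restr_mem_maximalAtlas _ (recenter_mem_maximalAtlas hφ _) hU
  · rw [OpenPartialHomeomorph.restr_source, hU.interior_eq]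
    exact ⟨hQ, hQ, fun i _ h => h⟩
  · simp [recenter_apply]
  · intro x hx
    have hxU := hsrc x hx
    rw [hE x hxU.1]
    simp only [OpenPartialHomeomorph.restr_apply, recenter_apply, Pi.sub_apply,
      Finset.mem_filter]
    constructor
    · rintro ⟨i, hi, h0⟩
      have : φ Q i = 0 := by
        by_contra h
        exact hxU.2 i hi h h0
      exact ⟨i, ⟨hi, this⟩, by simp [h0, this]⟩
    · rintro ⟨i, ⟨hi, h1⟩, h2⟩
      exact ⟨i, hi, by simpa [h1] using h2⟩
  · intro b Y hY hQY x hx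
    have h0 := (hY Q hQ).1 hQY
    rw [hY x (hsrc x hx).1]
    refine forall₂_congr fun i hi => ?_
    simp [recenter_apply, h0 i hi]

end Recenter

/-! ### Open neighbourhoods of the origin as ambient spaces -/

section Model

variable {N : ℕ}

/-- An open neighbourhood of the origin of `ℂᴺ`. -/
structure OpenNhd (N : ℕ) where
  carrier : Set (Fin N → ℂ)
  isOpen : IsOpen carrier
  zero_mem : (0 : Fin N → ℂ) ∈ carrier

/-- The open set `W` as a manifold in the universe `u`. -/
def Mod (W : OpenNhd N) : Type u := ULift.{u} W.carrier

namespace Mod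

variable (W : OpenNhd N)

instance : TopologicalSpace (Mod.{u} W) := inferInstanceAs (TopologicalSpace (ULift W.carrier))

instance : T2Space (Mod.{u} W) := inferInstanceAs (T2Space (ULift W.carrier))

/-- The point of `Mod W` with given coordinates. -/
def mk {W : OpenNhd N} (x : Fin N → ℂ) (h : x ∈ W.carrier) : Mod.{u} W := ⟨x, h⟩

instance : Nonempty (Mod.{u} W) := ⟨mk 0 W.zero_mem⟩

variable {W}

/-- The inclusion of `W` in `ℂᴺ`. -/
def e (x : Mod.{u} W) : Fin N → ℂ := x.down.1

@[simp] theorem e_mk (x : Fin N → ℂ) (h : x ∈ W.carrier) : e (mk.{u} x h) = x := rfl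

theorem e_mem (x : Mod.{u} W) : e x ∈ W.carrier := x.down.2

theorem isOpenEmbedding_e : IsOpenEmbedding (e : Mod.{u} W → Fin N → ℂ) :=
  W.isOpen.isOpenEmbedding_subtypeVal.comp Homeomorph.ulift.isOpenEmbedding

theorem range_e : range (e : Mod.{u} W → Fin N → ℂ) = W.carrier := by
  ext x
  exact ⟨by rintro ⟨y, rfl⟩; exact e_mem y, fun h => ⟨mk x h, rfl⟩⟩

theorem e_injective : Function.Injective (e : Mod.{u} W → Fin N → ℂ) :=
  isOpenEmbedding_e.injective

theorem continuous_e : Continuous (e : Mod.{u} W → Fin N → ℂ) := isOpenEmbedding_e.continuous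

noncomputable instance : ChartedSpace (Fin N → ℂ) (Mod.{u} W) :=
  isOpenEmbedding_e.singletonChartedSpace

instance : IsManifold 𝓘(ℂ, Fin N → ℂ) ω (Mod.{u} W) :=
  isOpenEmbedding_e.isManifold_singleton

/-- The inclusion in `ℂᴺ` as a chart. -/
noncomputable def chart (W : OpenNhd N) : OpenPartialHomeomorph (Mod.{u} W) (Fin N → ℂ) :=
  isOpenEmbedding_e.toOpenPartialHomeomorph e

@[simp] theorem coe_chart : (chart.{u} W : Mod W → Fin N → ℂ) = e := rfl

@[simp] theorem chart_target : (chart.{u} W).target = W.carrier := by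
  simp [chart, range_e]

theorem e_chart_symm {x : Fin N → ℂ} (h : x ∈ W.carrier) : e ((chart.{u} W).symm x) = x :=
  (chart.{u} W).right_inv (by simpa using h)

@[simp] theorem chart_symm_e (x : Mod.{u} W) : (chart W).symm (e x) = x :=
  (chart W).left_inv (mem_univ x)

theorem chart_mem_maximalAtlas :
    chart.{u} W ∈ IsManifold.maximalAtlas 𝓘(ℂ, Fin N → ℂ) ω (Mod W) :=
  StructureGroupoid.subset_maximalAtlas _ (mem_singleton _)

theorem contMDiff_e : ContMDiff 𝓘(ℂ, Fin N → ℂ) 𝓘(ℂ, Fin N → ℂ) ω (e : Mod.{u} W → _) := by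
  rw [← contMDiffOn_univ]
  exact contMDiffOn_of_mem_maximalAtlas chart_mem_maximalAtlas

theorem contMDiffOn_chart_symm :
    ContMDiffOn 𝓘(ℂ, Fin N → ℂ) 𝓘(ℂ, Fin N → ℂ) ω (chart.{u} W).symm W.carrier := by
  simpa using contMDiffOn_symm_of_mem_maximalAtlas (chart_mem_maximalAtlas (W := W))

variable (W)

/-- The origin. -/
def origin : Mod.{u} W := mk 0 W.zero_mem

/-- The union of the coordinate hyperplanes `x i = 0`, `i ∈ a`. -/
def hyperplanes (a : Finset (Fin N)) : Set (Mod.{u} W) := {x | ∃ i ∈ a, e x i = 0}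

/-- The coordinate subspace `x i = 0`, `i ∈ b`. -/
def subspace (b : Finset (Fin N)) : Set (Mod.{u} W) := {x | ∀ i ∈ b, e x i = 0}

/-- The germ of `W` along the origin, with a union of coordinate hyperplanes, as an ambient
space. -/
noncomputable abbrev ambient (a : Finset (Fin N)) : Ambient.{u} N where
  M := Mod.{u} W
  K := {origin W}
  isCompact_K := isCompact_singleton
  E := hyperplanes W a
  isNCDivisor_E P := by
    obtain ⟨ψ, a', h1, h2, -⟩ := exists_recentered (Q := P) (chart_mem_maximalAtlas (W := W))
      (mem_univ P) (a := a) (E := hyperplanes W a) fun x _ => Iff.rfl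
    exact ⟨ψ, a', h1, h2⟩

theorem isNCSubset_subspace (a b : Finset (Fin N)) :
    IsNCSubset N (hyperplanes.{u} W a) (subspace W b) := by
  refine ⟨?_, fun P hP => ?_⟩
  · have : subspace.{u} W b = ⋂ i ∈ b, {x | e x i = 0} := by ext x; simp [subspace]
    rw [this]
    exact isClosed_biInter fun i _ =>
      isClosed_eq ((continuous_apply i).comp continuous_e) continuous_const
  · obtain ⟨ψ, a', h1, h2, h3⟩ := exists_recentered (Q := P) (chart_mem_maximalAtlas (W := W))
      (mem_univ P) (a := a) (E := hyperplanes W a) fun x _ => Iff.rfl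
    exact ⟨ψ, a', b, h1, h2, h3 b _ (fun x _ => Iff.rfl) hP⟩

end Mod

end Model

/-! ### The blowing-up of an open subset of affine space along a coordinate subspace -/

section BlowUp

variable {N : ℕ}

/-- The orthogonal projection matrix onto the line spanned by the non-zero vector `v`. -/
noncomputable def lineMat (v : Fin N → ℂ) : Fin N → Fin N → ℂ :=
  fun j k => v j * star (v k) / (v ⬝ᵥ star v)

open scoped ComplexOrder in
theorem dotProduct_star_ne_zero {v : Fin N → ℂ} (hv : v ≠ 0) : v ⬝ᵥ star v ≠ 0 :=
  fun h => hv (dotProduct_self_star_eq_zero.1 h)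

theorem lineMat_smul {c : ℂ} (hc : c ≠ 0) (v : Fin N → ℂ) : lineMat (c • v) = lineMat v := by
  have hc' : star c ≠ 0 := by simpa using hc
  ext j k
  simp only [lineMat, Pi.smul_apply, smul_eq_mul, star_mul', star_smul, smul_dotProduct,
    dotProduct_smul]
  rw [show c * v j * (star c * star (v k)) = (c * star c) * (v j * star (v k)) by ring,
    show star c * (c * (v ⬝ᵥ star v)) = (c * star c) * (v ⬝ᵥ star v) by ring,
    mul_div_mul_left _ _ (mul_ne_zero hc hc')]

theorem lineMat_diag_ne_zero {v : Fin N → ℂ} {i : Fin N} : lineMat v i i ≠ 0 ↔ v i ≠ 0 := by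
  constructor
  · intro h h0
    simp [lineMat, h0] at h
  · intro h
    have hv : v ≠ 0 := fun h0 => h (by simp [h0])
    have : v ⬝ᵥ star v ≠ 0 := dotProduct_star_ne_zero hv
    exact div_ne_zero (mul_ne_zero h (by simpa using h)) this

theorem lineMat_div {v : Fin N → ℂ} {i : Fin N} (h : v i ≠ 0) (j : Fin N) :
    lineMat v j i / lineMat v i i = v j / v i := by
  have hv : v ≠ 0 := fun h0 => h (by simp [h0])
  have h1 : v ⬝ᵥ star v ≠ 0 := dotProduct_star_ne_zero hv
  have h2 : star (v i) ≠ 0 := by simpa using h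
  simp only [lineMat]
  field_simp

theorem continuousAt_lineMat {v : Fin N → ℂ} (hv : v ≠ 0) : ContinuousAt lineMat v := by
  have h1 : v ⬝ᵥ star v ≠ 0 := dotProduct_star_ne_zero hv
  refine continuousAt_pi.2 fun j => continuousAt_pi.2 fun k => ?_
  unfold lineMat
  refine ContinuousAt.div (by fun_prop) ?_ h1
  unfold dotProduct
  fun_prop

/-- The vector that spans the line of the point with coordinates `y` of the `i`-th standard affine
chart: the extension by zero of `blowDir b i y`. -/
def blowVec (b : Finset (Fin N)) (i : Fin N) (y : Fin N → ℂ) : Fin N → ℂ :=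
  fun j => if j = i then 1 else if j ∈ b then y j else 0

theorem blowVec_self (b : Finset (Fin N)) (i : Fin N) (y : Fin N → ℂ) : blowVec b i y i = 1 :=
  if_pos rfl

theorem blowVec_ne_zero (b : Finset (Fin N)) (i : Fin N) (y : Fin N → ℂ) : blowVec b i y ≠ 0 :=
  fun h => one_ne_zero ((blowVec_self b i y).symm.trans (congrFun h i))

theorem blowVec_of_notMem {b : Finset (Fin N)} {i : Fin N} (hi : i ∈ b) (y : Fin N → ℂ)
    {j : Fin N} (hj : j ∉ b) : blowVec b i y j = 0 := by
  have : j ≠ i := fun h => hj (h ▸ hi)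
  simp [blowVec, this, hj]

theorem blowDir_eq (b : Finset (Fin N)) (i : Fin N) (y : Fin N → ℂ) (j : b) :
    blowDir b i y j = blowVec b i y j := by
  simp [blowDir, blowVec]

theorem blowChart_of_mem {b : Finset (Fin N)} {i j : Fin N} (hj : j ∈ b) (y : Fin N → ℂ) :
    blowChart b i y j = y i * blowVec b i y j := by
  by_cases h : j = i
  · subst h; simp [blowChart, blowVec]
  · simp [blowChart, blowVec, h, hj]

theorem blowChart_of_notMem {b : Finset (Fin N)} {i j : Fin N} (hj : j ∉ b) (y : Fin N → ℂ) :
    blowChart b i y j = y j := by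
  simp [blowChart, hj]

theorem blowChart_self (b : Finset (Fin N)) (i : Fin N) (y : Fin N → ℂ) :
    blowChart b i y i = y i := by
  simp [blowChart]

theorem blowChart_zero (b : Finset (Fin N)) (i : Fin N) : blowChart b i 0 = 0 := by
  ext j; simp [blowChart]

theorem analyticAt_blowChart (b : Finset (Fin N)) (i : Fin N) (y : Fin N → ℂ) :
    AnalyticAt ℂ (blowChart b i) y := by
  refine analyticAt_pi_iff.2 fun j => ?_
  unfold blowChart
  split_ifs
  · exact (analyticAt_coord i y).mul (analyticAt_coord j y)
  · exact analyticAt_coord j y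

theorem analyticAt_blowVec (b : Finset (Fin N)) (i : Fin N) (y : Fin N → ℂ) :
    AnalyticAt ℂ (blowVec b i) y := by
  refine analyticAt_pi_iff.2 fun j => ?_
  unfold blowVec
  split_ifs
  · exact analyticAt_const
  · exact analyticAt_coord j y
  · exact analyticAt_const

theorem continuous_blowChart (b : Finset (Fin N)) (i : Fin N) : Continuous (blowChart b i) :=
  continuous_iff_continuousAt.2 fun y => (analyticAt_blowChart b i y).continuousAt

theorem continuous_blowVec (b : Finset (Fin N)) (i : Fin N) : Continuous (blowVec b i) :=
  continuous_iff_continuousAt.2 fun y => (analyticAt_blowVec b i y).continuousAt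

/-- The coordinates in the `i`-th standard affine chart of the pair `(x, [v])`. -/
noncomputable def affineCoord (b : Finset (Fin N)) (i : Fin N) (x v : Fin N → ℂ) : Fin N → ℂ :=
  fun j => if j ∈ b ∧ j ≠ i then v j / v i else x j

/-- The vector `v` spans a line that contains `(x j)_{j ∈ b}`. -/
def IsLineThrough (b : Finset (Fin N)) (x v : Fin N → ℂ) : Prop :=
  v ≠ 0 ∧ (∀ j ∉ b, v j = 0) ∧ ∃ c : ℂ, ∀ j ∈ b, x j = c * v j

theorem isLineThrough_blowVec {b : Finset (Fin N)} {i : Fin N} (hi : i ∈ b) (y : Fin N → ℂ) :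
    IsLineThrough b (blowChart b i y) (blowVec b i y) :=
  ⟨blowVec_ne_zero b i y, fun _ hj => blowVec_of_notMem hi y hj, y i,
    fun _ hj => blowChart_of_mem hj y⟩

theorem IsLineThrough.exists_ne_zero {b : Finset (Fin N)} {x v : Fin N → ℂ}
    (h : IsLineThrough b x v) : ∃ i ∈ b, v i ≠ 0 := by
  obtain ⟨i, hi⟩ := Function.ne_iff.1 h.1
  exact ⟨i, by_contra fun hb => hi (h.2.1 i hb), hi⟩

theorem IsLineThrough.blowVec_affineCoord {b : Finset (Fin N)} {x v : Fin N → ℂ}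
    (h : IsLineThrough b x v) {i : Fin N} (hvi : v i ≠ 0) :
    blowVec b i (affineCoord b i x v) = (v i)⁻¹ • v := by
  ext j
  by_cases hji : j = i
  · subst hji; simp [blowVec, hvi]
  · by_cases hj : j ∈ b
    · simp [blowVec, affineCoord, hji, hj, div_eq_inv_mul]
    · simp [blowVec, hji, hj, h.2.1 j hj]

theorem IsLineThrough.blowChart_affineCoord {b : Finset (Fin N)} {x v : Fin N → ℂ}
    (h : IsLineThrough b x v) {i : Fin N} (hi : i ∈ b) (hvi : v i ≠ 0) :
    blowChart b i (affineCoord b i x v) = x := by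
  obtain ⟨c, hc⟩ := h.2.2
  ext j
  by_cases hj : j ∈ b
  · rw [blowChart_of_mem hj, h.blowVec_affineCoord hvi]
    have : affineCoord b i x v i = x i := by simp [affineCoord]
    rw [this, hc j hj, hc i hi, Pi.smul_apply, smul_eq_mul]
    field_simp
  · rw [blowChart_of_notMem hj]
    simp [affineCoord, hj]

theorem affineCoord_blow {b : Finset (Fin N)} {i : Fin N} (y : Fin N → ℂ) :
    affineCoord b i (blowChart b i y) (blowVec b i y) = y := by
  ext j
  by_cases hj : j ∈ b ∧ j ≠ i
  · simp [affineCoord, hj, blowVec]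
  · simp [affineCoord, blowChart, hj]

/-- In an affine chart, the inverse image of the divisor `x j = 0`, `j ∈ a`, and of the centre is
the union of the coordinate hyperplanes of `insert i a`. -/
theorem blowChart_mem_divisor_iff {a b : Finset (Fin N)} {i : Fin N} (hi : i ∈ b)
    (y : Fin N → ℂ) :
    ((∃ j ∈ a, blowChart b i y j = 0) ∨ ∀ j ∈ b, blowChart b i y j = 0) ↔
      ∃ j ∈ insert i a, y j = 0 := by
  constructor
  · rintro (⟨j, hj, h0⟩ | h)
    · by_cases hjb : j ∈ b ∧ j ≠ i
      · simp only [blowChart, if_pos hjb, mul_eq_zero] at h0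
        rcases h0 with h0 | h0
        · exact ⟨i, Finset.mem_insert_self _ _, h0⟩
        · exact ⟨j, Finset.mem_insert_of_mem hj, h0⟩
      · simp only [blowChart, if_neg hjb] at h0
        exact ⟨j, Finset.mem_insert_of_mem hj, h0⟩
    · exact ⟨i, Finset.mem_insert_self _ _, by simpa [blowChart] using h i hi⟩
  · rintro ⟨j, hj, h0⟩
    rcases Finset.mem_insert.1 hj with rfl | hj
    · exact .inr fun k hk => by rw [blowChart_of_mem hk, h0, zero_mul]
    · refine .inl ⟨j, hj, ?_⟩
      simp [blowChart, h0]

/-- The blowing-up of the open set `W` along the coordinate subspace `x j = 0`, `j ∈ b`, as the set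
of the pairs `(x, p)` of a point of `W` and the projection matrix `p` onto a line of `ℂᵇ` that
contains `(x j)_{j ∈ b}`. The projection matrices serve as a Hausdorff and compact model of the
projective space of the lines. -/
def Bl (W : OpenNhd N) (b : Finset (Fin N)) : Type u :=
  ULift.{u} {q : (Fin N → ℂ) × (Fin N → Fin N → ℂ) //
    q.1 ∈ W.carrier ∧ ∃ v, IsLineThrough b q.1 v ∧ q.2 = lineMat v}

namespace Bl

variable {W : OpenNhd N} {b : Finset (Fin N)}

instance : TopologicalSpace (Bl.{u} W b) := inferInstanceAs (TopologicalSpace (ULift _))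

instance : T2Space (Bl.{u} W b) := inferInstanceAs (T2Space (ULift _))

/-- The pair `(x, p)` that is a point of the blowing-up. -/
def val (q : Bl.{u} W b) : (Fin N → ℂ) × (Fin N → Fin N → ℂ) := q.down.1

theorem isEmbedding_val : IsEmbedding (val : Bl.{u} W b → _) :=
  IsEmbedding.subtypeVal.comp Homeomorph.ulift.isEmbedding

theorem val_injective : Function.Injective (val : Bl.{u} W b → _) := isEmbedding_val.injective

theorem continuous_val : Continuous (val : Bl.{u} W b → _) := isEmbedding_val.continuous

/-- The point of the blowing-up given by `x` and the line spanned by `v`. -/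
noncomputable def mk (x v : Fin N → ℂ) (hx : x ∈ W.carrier) (hv : IsLineThrough b x v) :
    Bl.{u} W b :=
  ⟨(x, lineMat v), hx, v, hv, rfl⟩

@[simp] theorem val_mk (x v : Fin N → ℂ) (hx : x ∈ W.carrier) (hv : IsLineThrough b x v) :
    (mk.{u} x v hx hv).val = (x, lineMat v) := rfl

theorem exists_eq_mk (q : Bl.{u} W b) : ∃ x v hx hv, q = mk x v hx hv := by
  obtain ⟨⟨⟨x, p⟩, hx, v, hv, hp⟩⟩ := q
  change p = lineMat v at hp
  subst hp
  exact ⟨x, v, hx, hv, rfl⟩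

/-- The blowing-up map. -/
def proj (q : Bl.{u} W b) : Mod.{u} W := Mod.mk q.val.1 q.down.2.1

@[simp] theorem e_proj (q : Bl.{u} W b) : Mod.e q.proj = q.val.1 := rfl

theorem continuous_proj : Continuous (proj : Bl.{u} W b → _) :=
  Mod.isOpenEmbedding_e.isInducing.continuous_iff.2 (continuous_fst.comp continuous_val)

/-- The inverse of the `i`-th standard affine chart, with a junk value outside its domain. -/
noncomputable def chartInv {i : Fin N} (hi : i ∈ b) (y : Fin N → ℂ) : Bl.{u} W b :=
  open Classical in
  if h : blowChart b i y ∈ W.carrier then mk _ _ h (isLineThrough_blowVec hi y)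
  else mk _ _ (by rw [blowChart_zero]; exact W.zero_mem) (isLineThrough_blowVec hi 0)

theorem val_chartInv {i : Fin N} (hi : i ∈ b) {y : Fin N → ℂ}
    (h : blowChart b i y ∈ W.carrier) :
    (chartInv.{u} hi y : Bl W b).val = (blowChart b i y, lineMat (blowVec b i y)) := by
  rw [chartInv, dif_pos h, val_mk]

/-- The coordinates of the `i`-th standard affine chart. -/
noncomputable def coord (i : Fin N) (q : Bl.{u} W b) : Fin N → ℂ :=
  affineCoord b i q.val.1 fun j => q.val.2 j i

theorem coord_mk {i : Fin N} {x v : Fin N → ℂ} (hx : x ∈ W.carrier) (hv : IsLineThrough b x v)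
    (hvi : v i ≠ 0) : coord i (mk.{u} x v hx hv) = affineCoord b i x v := by
  ext j
  simp [coord, affineCoord, lineMat_div hvi]

theorem coord_chartInv {i : Fin N} (hi : i ∈ b) {y : Fin N → ℂ}
    (h : blowChart b i y ∈ W.carrier) : coord i (chartInv.{u} hi y : Bl W b) = y := by
  rw [chartInv, dif_pos h, coord_mk _ _ (by simp [blowVec_self]), affineCoord_blow]

theorem blowChart_coord {i : Fin N} (hi : i ∈ b) {q : Bl.{u} W b} (hq : q.val.2 i i ≠ 0) :
    blowChart b i (coord i q) = q.val.1 := by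
  obtain ⟨x, v, hx, hv, rfl⟩ := exists_eq_mk q
  have hvi := lineMat_diag_ne_zero.1 hq
  rw [coord_mk hx hv hvi, hv.blowChart_affineCoord hi hvi, val_mk]

theorem lineMat_coord {i : Fin N} {q : Bl.{u} W b} (hq : q.val.2 i i ≠ 0) :
    lineMat (blowVec b i (coord i q)) = q.val.2 := by
  obtain ⟨x, v, hx, hv, rfl⟩ := exists_eq_mk q
  have hvi := lineMat_diag_ne_zero.1 hq
  rw [coord_mk hx hv hvi, hv.blowVec_affineCoord hvi, val_mk, lineMat_smul (inv_ne_zero hvi)]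

/-- The `i`-th standard affine chart. -/
noncomputable def affineChart {i : Fin N} (hi : i ∈ b) :
    OpenPartialHomeomorph (Bl.{u} W b) (Fin N → ℂ) where
  toFun := coord i
  invFun := chartInv hi
  source := {q | q.val.2 i i ≠ 0}
  target := {y | blowChart b i y ∈ W.carrier}
  map_source' q hq := by
    change blowChart b i (coord i q) ∈ W.carrier
    rw [blowChart_coord hi hq]
    exact q.down.2.1
  map_target' y hy := by
    change (chartInv hi y).val.2 i i ≠ 0
    rw [val_chartInv hi hy, lineMat_diag_ne_zero, blowVec_self]
    exact one_ne_zero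
  left_inv' q hq := by
    have h : blowChart b i (coord i q) ∈ W.carrier := by
      rw [blowChart_coord hi hq]
      exact q.down.2.1
    apply val_injective
    rw [val_chartInv hi h, blowChart_coord hi hq, lineMat_coord hq]
  right_inv' y hy := coord_chartInv hi hy
  open_source := by
    refine isOpen_ne_fun ?_ continuous_const
    have := continuous_val.{u} (W := W) (b := b)
    fun_prop
  open_target := W.isOpen.preimage (continuous_blowChart b i)
  continuousOn_toFun := by
    have hc := continuous_val.{u} (W := W) (b := b)
    refine continuousOn_pi.2 fun j => ?_
    unfold coord affineCoord
    split_ifs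
    · exact ContinuousOn.div (by fun_prop) (by fun_prop) fun q hq => hq
    · fun_prop
  continuousOn_invFun := by
    refine isEmbedding_val.isInducing.continuousOn_iff.2 ?_
    refine ContinuousOn.congr (f := fun y => (blowChart b i y, lineMat (blowVec b i y))) ?_
      fun y hy => val_chartInv hi hy
    refine (continuous_blowChart b i).continuousOn.prodMk fun y _ => ?_
    exact (ContinuousAt.comp (continuousAt_lineMat (blowVec_ne_zero b i y))
      (continuous_blowVec b i).continuousAt).continuousWithinAt

theorem exists_mem_source (q : Bl.{u} W b) : ∃ (i : Fin N) (_ : i ∈ b), q.val.2 i i ≠ 0 := by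
  obtain ⟨x, v, hx, hv, rfl⟩ := exists_eq_mk q
  obtain ⟨i, hi, hvi⟩ := hv.exists_ne_zero
  exact ⟨i, hi, lineMat_diag_ne_zero.2 hvi⟩

noncomputable instance : ChartedSpace (Fin N → ℂ) (Bl.{u} W b) where
  atlas := {φ | ∃ (i : Fin N) (hi : i ∈ b), φ = affineChart hi}
  chartAt q := affineChart (exists_mem_source q).choose_spec.choose
  mem_chart_source q := (exists_mem_source q).choose_spec.choose_spec
  chart_mem_atlas _ := ⟨_, _, rfl⟩

instance : IsManifold 𝓘(ℂ, Fin N → ℂ) ω (Bl.{u} W b) := by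
  refine isManifold_of_contDiffOn _ _ _ ?_
  rintro _ _ ⟨i, hi, rfl⟩ ⟨k, hk, rfl⟩
  simp only [modelWithCornersSelf_coe, modelWithCornersSelf_coe_symm, Function.id_comp,
    Function.comp_id, preimage_id, range_id, inter_univ]
  have hsrc : ∀ y ∈ ((affineChart.{u} (W := W) hi).symm.trans (affineChart hk)).source,
      blowChart b i y ∈ W.carrier ∧ blowVec b i y k ≠ 0 := by
    intro y hy
    have h1 : blowChart b i y ∈ W.carrier := hy.1
    have h2 : (chartInv.{u} hi y : Bl W b).val.2 k k ≠ 0 := hy.2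
    rw [val_chartInv hi h1] at h2
    exact ⟨h1, lineMat_diag_ne_zero.1 h2⟩
  refine ContDiffOn.congr (f := fun y => affineCoord b k (blowChart b i y) (blowVec b i y)) ?_ ?_
  · intro y hy
    refine ContDiffAt.contDiffWithinAt ?_
    rw [← contMDiffAt_iff_contDiffAt, contMDiffAt_iff_analyticAt]
    refine analyticAt_pi_iff.2 fun j => ?_
    unfold affineCoord
    split_ifs
    · exact (analyticAt_pi_iff.1 (analyticAt_blowVec b i y) j).div
        (analyticAt_pi_iff.1 (analyticAt_blowVec b i y) k) (hsrc y hy).2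
    · exact analyticAt_pi_iff.1 (analyticAt_blowChart b i y) j
  · intro y hy
    obtain ⟨h1, h2⟩ := hsrc y hy
    change coord k (chartInv hi y) = _
    rw [chartInv, dif_pos h1, coord_mk _ _ h2]

theorem affineChart_mem_maximalAtlas {i : Fin N} (hi : i ∈ b) :
    affineChart.{u} (W := W) hi ∈ IsManifold.maximalAtlas 𝓘(ℂ, Fin N → ℂ) ω (Bl W b) :=
  StructureGroupoid.subset_maximalAtlas _ ⟨i, hi, rfl⟩

theorem contMDiffOn_chartInv {i : Fin N} (hi : i ∈ b) :
    ContMDiffOn 𝓘(ℂ, Fin N → ℂ) 𝓘(ℂ, Fin N → ℂ) ω (chartInv.{u} (W := W) hi)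
      {y | blowChart b i y ∈ W.carrier} :=
  contMDiffOn_symm_of_mem_maximalAtlas (affineChart_mem_maximalAtlas hi)

theorem contMDiffOn_coord {i : Fin N} (hi : i ∈ b) :
    ContMDiffOn 𝓘(ℂ, Fin N → ℂ) 𝓘(ℂ, Fin N → ℂ) ω (coord.{u} (W := W) (b := b) i)
      {q | q.val.2 i i ≠ 0} :=
  contMDiffOn_of_mem_maximalAtlas (affineChart_mem_maximalAtlas hi)

end Bl

end BlowUp

section BlowUpMap

variable {N : ℕ}

theorem Mod.contMDiffAt_of_e_comp {E H X : Type*} [NormedAddCommGroup E] [NormedSpace ℂ E]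
    [TopologicalSpace H] {I : ModelWithCorners ℂ E H} [TopologicalSpace X] [ChartedSpace H X]
    {W : OpenNhd N} {f : X → Mod.{u} W} {x : X}
    (h : ContMDiffAt I 𝓘(ℂ, Fin N → ℂ) ω (fun y => e (f y)) x) :
    ContMDiffAt I 𝓘(ℂ, Fin N → ℂ) ω f x := by
  have h1 := (contMDiffOn_chart_symm (W := W)).contMDiffAt (W.isOpen.mem_nhds (e_mem (f x)))
  have h2 := h1.comp x h
  have h3 : (chart W).symm ∘ (fun y => e (f y)) = f := funext fun y => chart_symm_e (f y)
  rwa [h3] at h2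

namespace Bl

variable {W : OpenNhd N} {b : Finset (Fin N)}

theorem contMDiff_proj :
    ContMDiff 𝓘(ℂ, Fin N → ℂ) 𝓘(ℂ, Fin N → ℂ) ω (proj : Bl.{u} W b → Mod.{u} W) := by
  intro q
  obtain ⟨i, hi, hq⟩ := exists_mem_source q
  refine Mod.contMDiffAt_of_e_comp ?_
  have hmem := (affineChart.{u} (W := W) hi).open_source.mem_nhds hq
  have h1 := (contMDiffOn_coord (W := W) hi).contMDiffAt hmem
  have h2 : ContMDiffAt 𝓘(ℂ, Fin N → ℂ) 𝓘(ℂ, Fin N → ℂ) ω (blowChart b i) (coord i q) :=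
    contMDiffAt_iff_analyticAt.2 (analyticAt_blowChart b i _)
  refine (h2.comp q h1).congr_of_eventuallyEq ?_
  filter_upwards [hmem] with q' hq'
  exact (blowChart_coord hi hq').symm

/-- The affine coordinates of the point of the blowing-up over a point with `x i ≠ 0`. -/
noncomputable def liftCoord (b : Finset (Fin N)) (i : Fin N) (x : Fin N → ℂ) : Fin N → ℂ :=
  affineCoord b i x x

theorem blowChart_liftCoord {i : Fin N} {x : Fin N → ℂ} (hx : x i ≠ 0) :
    blowChart b i (liftCoord b i x) = x := by
  ext j
  by_cases hj : j ∈ b ∧ j ≠ i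
  · simp only [blowChart, if_pos hj]
    simp only [liftCoord, affineCoord, if_pos hj, ne_eq, not_true_eq_false, and_false, if_false]
    field_simp
  · simp [blowChart, hj, liftCoord, affineCoord]

theorem liftCoord_blowChart {i : Fin N} {y : Fin N → ℂ} (hy : y i ≠ 0) :
    liftCoord b i (blowChart b i y) = y := by
  ext j
  by_cases hj : j ∈ b ∧ j ≠ i
  · simp only [liftCoord, affineCoord, if_pos hj]
    simp only [blowChart, if_pos hj, ne_eq, not_true_eq_false, and_false, if_false]
    field_simp
  · simp [blowChart, hj, liftCoord, affineCoord]

theorem analyticAt_liftCoord {i : Fin N} {x : Fin N → ℂ} (hx : x i ≠ 0) :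
    AnalyticAt ℂ (liftCoord b i) x := by
  refine analyticAt_pi_iff.2 fun j => ?_
  unfold liftCoord affineCoord
  split_ifs
  · exact (analyticAt_coord j x).div (analyticAt_coord i x) hx
  · exact analyticAt_coord j x

theorem mem_source_of_ne_zero {i : Fin N} (hi : i ∈ b) {q : Bl.{u} W b} (h : q.val.1 i ≠ 0) :
    q.val.2 i i ≠ 0 := by
  obtain ⟨x, v, hx, hv, rfl⟩ := exists_eq_mk q
  obtain ⟨c, hc⟩ := hv.2.2
  refine lineMat_diag_ne_zero.2 fun h0 => h ?_
  simp [hc i hi, h0]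

theorem chartInv_liftCoord {i : Fin N} (hi : i ∈ b) {q : Bl.{u} W b} (h : q.val.1 i ≠ 0) :
    chartInv hi (liftCoord b i q.val.1) = q := by
  have hq := mem_source_of_ne_zero hi h
  rw [← blowChart_coord hi hq, liftCoord_blowChart]
  · exact (affineChart hi).left_inv hq
  · rwa [← blowChart_self b i (coord i q), blowChart_coord hi hq]

theorem proj_chartInv_liftCoord {i : Fin N} (hi : i ∈ b) {x : Mod.{u} W} (h : Mod.e x i ≠ 0) :
    proj (chartInv.{u} (W := W) hi (liftCoord b i (Mod.e x))) = x := by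
  apply Mod.e_injective
  rw [e_proj, val_chartInv hi, blowChart_liftCoord h]
  rw [blowChart_liftCoord h]
  exact Mod.e_mem x

/-- The blowing-up map restricts to an isomorphism over the complement of `x i = 0`. -/
noncomputable def projDiffeo {i : Fin N} (hi : i ∈ b) :
    PartialDiffeomorph 𝓘(ℂ, Fin N → ℂ) 𝓘(ℂ, Fin N → ℂ) (Bl.{u} W b) (Mod.{u} W) ω where
  toFun := proj
  invFun x := chartInv hi (liftCoord b i (Mod.e x))
  source := {q | q.val.1 i ≠ 0}
  target := {x | Mod.e x i ≠ 0}
  map_source' q hq := hq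
  map_target' x hx := by
    change Mod.e (proj _) i ≠ 0
    rwa [proj_chartInv_liftCoord hi hx]
  left_inv' q hq := chartInv_liftCoord hi hq
  right_inv' x hx := proj_chartInv_liftCoord hi hx
  open_source := by
    have := continuous_val.{u} (W := W) (b := b)
    exact isOpen_ne_fun (by fun_prop) continuous_const
  open_target := by
    have := Mod.continuous_e.{u} (W := W)
    exact isOpen_ne_fun (by fun_prop) continuous_const
  contMDiffOn_toFun := contMDiff_proj.contMDiffOn
  contMDiffOn_invFun x hx := by
    have hmem : blowChart b i (liftCoord b i (Mod.e x)) ∈ W.carrier := by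
      rw [blowChart_liftCoord hx]
      exact Mod.e_mem x
    have h1 := (contMDiffOn_chartInv (W := W) hi).contMDiffAt
      ((affineChart.{u} (W := W) hi).open_target.mem_nhds hmem)
    have h2 : ContMDiffAt 𝓘(ℂ, Fin N → ℂ) 𝓘(ℂ, Fin N → ℂ) ω (liftCoord b i) (Mod.e x) :=
      contMDiffAt_iff_analyticAt.2 (analyticAt_liftCoord hx)
    exact (h1.comp x (h2.comp x Mod.contMDiff_e.contMDiffAt)).contMDiffWithinAt

theorem exists_ne_zero_of_notMem {x : Mod.{u} W} (hx : x ∉ Mod.subspace W b) :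
    ∃ i ∈ b, Mod.e x i ≠ 0 := by
  simpa [Mod.subspace] using hx

/-- The standard model is a blowing-up. Its affine charts are recentred like the chart of `W`: the
centre is a linear subspace, so the translation by a point of it commutes with `blowChart`. -/
theorem isBlowUp_proj {t : Fin N} (ht : t ∈ b) :
    IsBlowUp N (proj : Bl.{u} W b → Mod.{u} W) (Mod.subspace W b) where
  holomorphic := contMDiff_proj
  bijOn_compl := by
    refine ⟨fun q hq => hq, fun q hq r hr hqr => ?_, fun x hx => ?_⟩
    · obtain ⟨i, hi, h⟩ := exists_ne_zero_of_notMem hq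
      have h' : r.proj.e i ≠ 0 := by rwa [← hqr]
      rw [← chartInv_liftCoord hi h, ← chartInv_liftCoord hi h']
      rw [← e_proj, ← e_proj, hqr]
    · obtain ⟨i, hi, h⟩ := exists_ne_zero_of_notMem hx
      refine ⟨_, ?_, proj_chartInv_liftCoord hi h⟩
      rw [mem_preimage, proj_chartInv_liftCoord hi h]
      exact hx
  localIso_compl q hq := by
    obtain ⟨i, hi, h⟩ := exists_ne_zero_of_notMem hq
    exact ⟨projDiffeo hi, h, fun _ _ => rfl⟩
  local_model P hP := by
    classical
    have hP' : ∀ j ∈ b, Mod.e P j = 0 := hP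
    -- the chart with an index outside `b` is irrelevant
    refine ⟨recenter (Mod.chart W) P, b, fun i => if hi : i ∈ b then
      (affineChart hi).transHomeomorph (Homeomorph.subRight (Mod.e P)) else
      (affineChart ht).transHomeomorph (Homeomorph.subRight (Mod.e P)), ?_, ?_, ?_, ?_, ?_⟩
    · refine ⟨recenter_mem_maximalAtlas Mod.chart_mem_maximalAtlas _, mem_univ _, ?_⟩
      simp [recenter_apply]
    · intro x _
      refine forall₂_congr fun i hi => ?_
      simp [recenter_apply, hP' i hi]
    · intro i hi
      beta_reduce
      rw [dif_pos hi]
      have hsub : ∀ y, blowChart b i (y + Mod.e P) = blowChart b i y + Mod.e P := by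
        intro y
        ext j
        by_cases hj : j ∈ b ∧ j ≠ i
        · simp [blowChart, hj, hP' i hi, hP' j hj.1]
        · simp [blowChart, hj]
      refine ⟨recenter_mem_maximalAtlas (affineChart_mem_maximalAtlas hi) _, ?_, ?_⟩
      · ext y
        change blowChart b i (y + Mod.e P) ∈ W.carrier ↔
          blowChart b i y + Mod.e P ∈ (Mod.chart W).target
        rw [hsub, Mod.chart_target]
      · intro q hq
        change Mod.e q.proj - Mod.e P = blowChart b i (coord i q - Mod.e P)
        rw [eq_comm, eq_sub_iff_add_eq, ← hsub, sub_add_cancel, blowChart_coord hi hq, e_proj]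
    · refine (eq_univ_of_forall fun q => ?_).trans (eq_univ_of_forall fun q => ?_).symm
      · exact mem_univ _
      · obtain ⟨i, hi, hq⟩ := exists_mem_source q
        refine mem_biUnion hi ?_
        beta_reduce
        rw [dif_pos hi]
        exact hq
    · intro i hi k hk q hq r hr
      beta_reduce at hq hr ⊢
      rw [dif_pos hi] at hq ⊢
      rw [dif_pos hk] at hr ⊢
      have hq' : q.val.2 i i ≠ 0 := hq
      have hr' : r.val.2 k k ≠ 0 := hr
      change q = r ↔ q.proj = r.proj ∧ ∃ c : ℂ, blowDir b i (coord i q - Mod.e P) =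
        c • blowDir b k (coord k r - Mod.e P)
      have hvec : ∀ (i : Fin N) (y : Fin N → ℂ), blowVec b i (y - Mod.e P) = blowVec b i y := by
        intro i y
        ext j
        unfold blowVec
        split_ifs with h1 h2
        · rfl
        · simp [hP' j h2]
        · rfl
      have hdir : ∀ c : ℂ, blowDir b i (coord i q - Mod.e P) =
          c • blowDir b k (coord k r - Mod.e P) ↔
          blowVec b i (coord i q) = c • blowVec b k (coord k r) := by
        intro c
        constructor
        · intro h
          ext j
          by_cases hj : j ∈ b
          · have := congrFun h ⟨j, hj⟩
            simpa [blowDir_eq, hvec] using this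
          · simp [blowVec_of_notMem hi _ hj, blowVec_of_notMem hk _ hj]
        · intro h
          ext j
          simpa [blowDir_eq, hvec] using congrFun h j
      simp only [hdir]
      constructor
      · rintro rfl
        refine ⟨rfl, ?_⟩
        obtain ⟨x, v, hx, hv, rfl⟩ := exists_eq_mk q
        have hvi := lineMat_diag_ne_zero.1 hq'
        have hvk := lineMat_diag_ne_zero.1 hr'
        refine ⟨v k / v i, ?_⟩
        rw [coord_mk hx hv hvi, coord_mk hx hv hvk, hv.blowVec_affineCoord hvi,
          hv.blowVec_affineCoord hvk, smul_smul]
        congr 1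
        field_simp
      · rintro ⟨h1, c, hc⟩
        have hc0 : c ≠ 0 := by
          rintro rfl
          rw [zero_smul] at hc
          exact blowVec_ne_zero _ _ _ hc
        apply val_injective
        refine Prod.ext ?_ ?_
        · rw [← e_proj, h1, e_proj]
        · rw [← lineMat_coord hq', ← lineMat_coord hr', hc, lineMat_smul hc0]

theorem isCompact_fiber : IsCompact (proj ⁻¹' {Mod.origin W} : Set (Bl.{u} W b)) := by
  -- the fibre is the set of the projection matrices onto the lines spanned by unit vectors
  rw [isEmbedding_val.isCompact_iff]
  let S : Set (Fin N → ℂ) := Metric.sphere 0 1 ∩ {v | ∀ j ∉ b, v j = 0}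
  have hS : IsCompact S := by
    refine (isCompact_sphere 0 1).inter_right ?_
    simp only [ofPred_forall]
    exact isClosed_iInter fun j => isClosed_iInter fun _ =>
      isClosed_eq (continuous_apply j) continuous_const
  have himg : val '' (proj ⁻¹' {Mod.origin W} : Set (Bl.{u} W b)) =
      (fun v => ((0 : Fin N → ℂ), lineMat v)) '' S := by
    ext p
    constructor
    · rintro ⟨q, hq, rfl⟩
      obtain ⟨x, v, hx, hv, rfl⟩ := exists_eq_mk q
      have hx0 : x = 0 := congrArg Mod.e (hq : proj _ = _)
      have hn : (‖v‖ : ℂ) ≠ 0 := by simpa using hv.1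
      refine ⟨(‖v‖ : ℂ)⁻¹ • v, ⟨?_, fun j hj => by simp [hv.2.1 j hj]⟩, ?_⟩
      · have : ‖v‖ ≠ 0 := by simpa using hv.1
        simp [norm_smul, this]
      · simp [lineMat_smul (inv_ne_zero hn), hx0]
    · rintro ⟨v, ⟨hv1, hv⟩, rfl⟩
      have hv0 : v ≠ 0 := by
        rintro rfl
        simp at hv1
      exact ⟨mk 0 v W.zero_mem ⟨hv0, hv, 0, by simp⟩, rfl, rfl⟩
  rw [himg]
  refine hS.image_of_continuousOn fun v hv => ?_
  have hv0 : v ≠ 0 := by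
    rintro rfl
    simp [S] at hv
  exact (continuousAt_const.prodMk (continuousAt_lineMat hv0)).continuousWithinAt

/-- The blown-up ambient space. -/
noncomputable abbrev ambient (W : OpenNhd N) (a b : Finset (Fin N)) : Ambient.{u} N where
  M := Bl.{u} W b
  K := proj ⁻¹' {Mod.origin W}
  isCompact_K := isCompact_fiber
  E := proj ⁻¹' (Mod.hyperplanes W a ∪ Mod.subspace W b)
  isNCDivisor_E q := by
    obtain ⟨i, hi, hq⟩ := exists_mem_source q
    have hE : IsHyperplanes (affineChart.{u} (W := W) hi) (insert i a)
        (proj ⁻¹' (Mod.hyperplanes W a ∪ Mod.subspace W b)) := by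
      intro r hr
      have hr' : r.val.1 = blowChart b i (coord i r) := (blowChart_coord hi hr).symm
      change ((∃ j ∈ a, r.val.1 j = 0) ∨ ∀ j ∈ b, r.val.1 j = 0) ↔
        ∃ j ∈ insert i a, coord i r j = 0
      rw [hr']
      exact blowChart_mem_divisor_iff hi _
    obtain ⟨ψ, a', h1, h2, -⟩ := exists_recentered (affineChart_mem_maximalAtlas hi) hq hE
    exact ⟨ψ, a', h1, h2⟩

end Bl

end BlowUpMap

/-! ### The test systems -/

section Chain

variable {N : ℕ}

/-- The domain of the `t`-th standard affine chart of the blowing-up of `W`. -/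
def OpenNhd.next (W : OpenNhd N) (b : Finset (Fin N)) (t : Fin N) : OpenNhd N where
  carrier := {y | blowChart b t y ∈ W.carrier}
  isOpen := W.isOpen.preimage (continuous_blowChart b t)
  zero_mem := by
    rw [mem_ofPred_eq, blowChart_zero]
    exact W.zero_mem

/-- The inclusion of the `t`-th standard affine chart in the blowing-up. -/
noncomputable def incl (W : OpenNhd N) {b : Finset (Fin N)} {t : Fin N} (ht : t ∈ b)
    (y : Mod.{u} (W.next b t)) : Bl.{u} W b :=
  Bl.chartInv ht (Mod.e y)

/-- The blowing-up map in the `t`-th standard affine chart. -/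
noncomputable def chartMap (W : OpenNhd N) {b : Finset (Fin N)} {t : Fin N} (ht : t ∈ b)
    (y : Mod.{u} (W.next b t)) : Mod.{u} W :=
  Bl.proj (incl W ht y)

variable {W : OpenNhd N} {b : Finset (Fin N)} {t : Fin N} {ht : t ∈ b}

theorem val_incl (y : Mod.{u} (W.next b t)) : (incl W ht y).val =
    (blowChart b t (Mod.e y), lineMat (blowVec b t (Mod.e y))) :=
  Bl.val_chartInv ht (Mod.e_mem y)

theorem e_chartMap (y : Mod.{u} (W.next b t)) :
    Mod.e (chartMap W ht y) = blowChart b t (Mod.e y) := by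
  rw [chartMap, Bl.e_proj, val_incl]

theorem coord_incl (y : Mod.{u} (W.next b t)) : Bl.coord t (incl W ht y) = Mod.e y :=
  Bl.coord_chartInv ht (Mod.e_mem y)

theorem incl_mem_source (y : Mod.{u} (W.next b t)) :
    incl W ht y ∈ (Bl.affineChart.{u} (W := W) ht).source :=
  (Bl.affineChart ht).map_target (Mod.e_mem y)

theorem incl_injective : Function.Injective (incl.{u} W ht) := fun x y h =>
  Mod.e_injective (by rw [← coord_incl (ht := ht) x, h, coord_incl])

theorem contMDiff_incl :
    ContMDiff 𝓘(ℂ, Fin N → ℂ) 𝓘(ℂ, Fin N → ℂ) ω (incl.{u} W ht) := by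
  intro y
  exact ((Bl.contMDiffOn_chartInv (W := W) ht).contMDiffAt
    ((Bl.affineChart.{u} (W := W) ht).open_target.mem_nhds (Mod.e_mem y))).comp y
      Mod.contMDiff_e.contMDiffAt

theorem continuous_incl : Continuous (incl.{u} W ht) := contMDiff_incl.continuous

theorem incl_chart_symm {q : Bl.{u} W b} (hq : q.val.2 t t ≠ 0) :
    incl W ht ((Mod.chart (W.next b t)).symm (Bl.coord t q)) = q := by
  have h : Bl.coord t q ∈ (W.next b t).carrier := (Bl.affineChart.{u} (W := W) ht).map_source hq
  rw [incl, Mod.e_chart_symm h]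
  exact (Bl.affineChart.{u} (W := W) ht).left_inv hq

theorem isOpenEmbedding_incl : IsOpenEmbedding (incl.{u} W ht) := by
  have h : incl.{u} W ht = (Bl.affineChart ht).symm ∘ Mod.e := rfl
  refine .of_continuous_injective_isOpenMap continuous_incl incl_injective fun U hU => ?_
  rw [h, image_comp]
  refine (Bl.affineChart ht).symm.isOpen_image_of_subset_source
    (Mod.isOpenEmbedding_e.isOpenMap U hU) ?_
  rintro _ ⟨y, -, rfl⟩
  exact Mod.e_mem y

variable (W) in
theorem isAmbientBlowUp_proj (a : Finset (Fin N)) (ht : t ∈ b) :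
    IsAmbientBlowUp (Mod.ambient.{u} W a) (Bl.ambient W a b) Bl.proj (Mod.subspace W b) where
  center := Mod.isNCSubset_subspace W a b
  nonempty := ⟨Mod.origin W, fun _ _ => rfl, rfl⟩
  blowUp := Bl.isBlowUp_proj ht
  map_K := rfl
  divisor := rfl

variable (W) in
theorem isOpenProjection_incl (a : Finset (Fin N)) (ht : t ∈ b) :
    IsOpenProjection (m := 0) (Bl.ambient.{u} W a b) (Mod.ambient (W.next b t) (insert t a))
      (incl W ht) (fun _ => Fin.elim0) where
  injective _ _ h := incl_injective (ht := ht) (Prod.ext_iff.1 h).1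
  localIso := by
    let Φ : PartialDiffeomorph 𝓘(ℂ, Fin N → ℂ) (𝓘(ℂ, Fin N → ℂ).prod 𝓘(ℂ, Fin 0 → ℂ))
        (Mod.{u} (W.next b t)) (Bl.{u} W b × (Fin 0 → ℂ)) ω :=
      { toFun := fun x => (incl W ht x, Fin.elim0)
        invFun := fun p => (Mod.chart _).symm (Bl.coord t p.1)
        source := univ
        target := {p | p.1.val.2 t t ≠ 0}
        map_source' := fun x _ => incl_mem_source (ht := ht) x
        map_target' := fun _ _ => mem_univ _
        left_inv' := fun x _ => by simp [coord_incl]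
        right_inv' := fun p hp => Prod.ext (incl_chart_symm (ht := ht) hp) (Subsingleton.elim _ _)
        open_source := isOpen_univ
        open_target := (Bl.affineChart.{u} (W := W) ht).open_source.preimage continuous_fst
        contMDiffOn_toFun := (contMDiff_incl.prodMk contMDiff_const).contMDiffOn
        contMDiffOn_invFun := by
          refine Mod.contMDiffOn_chart_symm.comp
            ((Bl.contMDiffOn_coord ht).comp contMDiffOn_fst fun p hp => hp) fun p hp => ?_
          exact (Bl.affineChart.{u} (W := W) ht).map_source hp }
    exact fun x => ⟨Φ, mem_univ x, fun _ _ => rfl⟩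
  map_K x hx := by
    have hx0 : x = Mod.origin (W.next b t) := hx
    subst hx0
    refine ⟨?_, Subsingleton.elim _ _⟩
    change chartMap W ht (Mod.origin _) = Mod.origin W
    apply Mod.e_injective
    rw [e_chartMap]
    exact blowChart_zero b t
  divisor := by
    ext (y : Mod.{u} (W.next b t))
    change (∃ j ∈ insert t a, Mod.e y j = 0) ↔ ((∃ j ∈ a, Mod.e (chartMap W ht y) j = 0) ∨
      ∀ j ∈ b, Mod.e (chartMap W ht y) j = 0)
    rw [e_chartMap, blowChart_mem_divisor_iff ht]

/-- The test system that blows up, for the successive sets `b` of the list, the coordinate subspace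
`x j = 0`, `j ∈ b`, and passes to the `t`-th standard affine chart. -/
noncomputable def chain (t : Fin N) : List {b : Finset (Fin N) // t ∈ b} → (W : OpenNhd N) →
    (a : Finset (Fin N)) → TestSystem (Mod.ambient.{u} W a)
  | [], _, _ => .nil _
  | b :: bs, W, a => .blowUp (Mod.subspace W b.1) Bl.proj (isAmbientBlowUp_proj W a b.2)
      (.proj (m := 0) (A := Bl.ambient W a b.1) (incl W b.2) (fun _ => Fin.elim0)
        (isOpenProjection_incl W a b.2) (chain t bs (W.next b.1 t) (insert t a)))

/-- The transform of the subspace `S` in the `t`-th affine chart of a blowing-up. -/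
def nextSet (W : OpenNhd N) {b : Finset (Fin N)} {t : Fin N} (ht : t ∈ b) (S : Set (Mod.{u} W)) :
    Set (Mod.{u} (W.next b t)) :=
  incl W ht ⁻¹' strictTransform (Bl.proj : Bl.{u} W b → _) (Mod.subspace W b) S

/-- The controlled transform of a marked ideal in the `t`-th affine chart of a blowing-up. -/
noncomputable def nextMarked (W : OpenNhd N) {b : Finset (Fin N)} {t : Fin N} (ht : t ∈ b)
    {S : Set (Mod.{u} W)} (J : Marked N S) : Marked N (nextSet W ht S) :=
  (J.controlled (n' := N) (Bl.proj : Bl.{u} W b → _) (Mod.subspace W b)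
    (strictTransform (Bl.proj : Bl.{u} W b → _) (Mod.subspace W b) S)).pullback (incl W ht)
    (nextSet W ht S)

theorem chain_cons_permissible {b : {b : Finset (Fin N) // t ∈ b}}
    {bs : List {b : Finset (Fin N) // t ∈ b}} {a : Finset (Fin N)} {S : Set (Mod.{u} W)}
    {L : List (Marked N S)} :
    (chain t (b :: bs) W a).ImmersedPermissible S L ↔
      (∀ᶠ x in 𝓝 (Mod.origin W), x ∈ Mod.subspace W b.1 → x ∈ singLocus S L) ∧
      (chain t bs (W.next b.1 t) (insert t a)).ImmersedPermissible (nextSet W b.2 S)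
        (L.map fun J => nextMarked W b.2 J) := by
  have h : (L.map fun J => nextMarked W b.2 J) = (L.map fun J => J.controlled (n' := N)
      (Bl.proj : Bl.{u} W b.1 → _) (Mod.subspace W b.1)
        (strictTransform (Bl.proj : Bl.{u} W b.1 → _) (Mod.subspace W b.1) S)).map
          fun J => J.pullback (incl W b.2) (nextSet W b.2 S) := by
    rw [List.map_map]; rfl
  rw [h, ← nhdsSet_singleton]
  rfl

/-- Inside the affine chart the transform of a subspace is the closure of the inverse image of its
part outside the centre. -/
theorem nextSet_eq (W : OpenNhd N) {b : Finset (Fin N)} {t : Fin N} (ht : t ∈ b)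
    (S : Set (Mod.{u} W)) :
    nextSet W ht S = closure {y | chartMap W ht y ∈ S ∧ Mod.e y t ≠ 0} := by
  unfold nextSet strictTransform
  rw [isOpenEmbedding_incl.isOpenMap.preimage_closure_eq_closure_preimage continuous_incl]
  congr 1
  ext y
  refine and_congr_right fun _ => not_congr ?_
  change (∀ j ∈ b, Mod.e (chartMap W ht y) j = 0) ↔ _
  rw [e_chartMap]
  constructor
  · intro h
    simpa [blowChart_self] using h t ht
  · intro h j hj
    rw [blowChart_of_mem hj, h, zero_mul]

end Chain

section FirstStep

variable {n : ℕ} {M : Type u} [TopologicalSpace M] [ChartedSpace (Fin n → ℂ) M]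
  {φ : OpenPartialHomeomorph M (Fin n → ℂ)} {P : M}

/-- The domain of the coordinates `φ` and of an additional coordinate. -/
def cylinder (hφ : IsCoordAt φ P) : OpenNhd (n + 1) where
  carrier := {x | Fin.init x ∈ φ.target}
  isOpen := φ.open_target.preimage (continuous_pi fun i => continuous_apply _)
  zero_mem := by
    have h : (Fin.init (0 : Fin (n + 1) → ℂ) : Fin n → ℂ) = φ P := by
      rw [hφ.2.2]; rfl
    rw [mem_ofPred_eq, h]
    exact φ.map_source hφ.2.1

/-- The projection of the cylinder over the coordinate domain. -/
noncomputable def cylinderProj (hφ : IsCoordAt φ P) (x : Mod.{u} (cylinder hφ)) : M :=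
  φ.symm (Fin.init (Mod.e x))

theorem chart_cylinderProj (hφ : IsCoordAt φ P) (x : Mod.{u} (cylinder hφ)) :
    φ (cylinderProj hφ x) = Fin.init (Mod.e x) := φ.right_inv (Mod.e_mem x)

theorem cylinderProj_mem_source (hφ : IsCoordAt φ P) (x : Mod.{u} (cylinder hφ)) :
    cylinderProj hφ x ∈ φ.source := φ.map_target (Mod.e_mem x)

theorem cylinderProj_origin (hφ : IsCoordAt φ P) :
    cylinderProj hφ (Mod.origin.{u} (cylinder hφ)) = P := by
  have h : (Fin.init (Mod.e (Mod.origin.{u} (cylinder hφ))) : Fin n → ℂ) = φ P := by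
    rw [hφ.2.2]; rfl
  rw [cylinderProj, h, φ.left_inv hφ.2.1]

theorem contMDiff_init :
    ContMDiff 𝓘(ℂ, Fin (n + 1) → ℂ) 𝓘(ℂ, Fin n → ℂ) ω
      (Fin.init : (Fin (n + 1) → ℂ) → (Fin n → ℂ)) := fun _ =>
  contMDiffAt_iff_analyticAt.2 (analyticAt_pi_iff.2 fun _ => analyticAt_coord _ _)

theorem contMDiff_cylinderProj (hφ : IsCoordAt φ P) :
    ContMDiff 𝓘(ℂ, Fin (n + 1) → ℂ) 𝓘(ℂ, Fin n → ℂ) ω (cylinderProj.{u} hφ) := by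
  rw [← contMDiffOn_univ]
  exact (contMDiffOn_symm_of_mem_maximalAtlas hφ.1).comp
    (contMDiff_init.comp Mod.contMDiff_e).contMDiffOn fun x _ => Mod.e_mem x

end FirstStep

theorem isOpenProjection_cylinderProj {n : ℕ} {A : Ambient.{u} n}
    {φ : OpenPartialHomeomorph A.M (Fin n → ℂ)} {P : A.M} (hP : P ∈ A.K) (hφ : IsCoordAt φ P)
    {a : Finset (Fin n)} (ha : IsHyperplanes φ a A.E) :
    IsOpenProjection (m := 1) A (Mod.ambient.{u} (cylinder hφ) (a.map Fin.castSuccEmb))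
      (cylinderProj hφ) (fun x _ => Mod.e x (Fin.last n)) where
  injective := by
    intro (x : Mod.{u} (cylinder hφ)) (y : Mod.{u} (cylinder hφ)) h
    obtain ⟨h1, h2⟩ := Prod.ext_iff.1 h
    have h3 : Fin.init (Mod.e x) = Fin.init (Mod.e y) := by
      rw [← chart_cylinderProj hφ, ← chart_cylinderProj hφ]
      exact congrArg φ h1
    apply Mod.e_injective
    rw [← Fin.snoc_init_self (Mod.e x), ← Fin.snoc_init_self (Mod.e y), h3]
    congr 1
    exact congrFun h2 0
  localIso := by
    have hmem : ∀ p : A.M × (Fin 1 → ℂ), p.1 ∈ φ.source →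
        (Fin.snoc (φ p.1) (p.2 0) : Fin (n + 1) → ℂ) ∈ (cylinder hφ).carrier := by
      intro p hp
      change Fin.init (Fin.snoc (φ p.1) (p.2 0) : Fin (n + 1) → ℂ) ∈ φ.target
      rw [Fin.init_snoc]
      exact φ.map_source hp
    let Φ : PartialDiffeomorph 𝓘(ℂ, Fin (n + 1) → ℂ)
        (𝓘(ℂ, Fin n → ℂ).prod 𝓘(ℂ, Fin 1 → ℂ))
        (Mod.{u} (cylinder hφ)) (A.M × (Fin 1 → ℂ)) ω :=
      { toFun := fun x => (cylinderProj hφ x, fun _ => Mod.e x (Fin.last n))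
        invFun := fun p => (Mod.chart _).symm (Fin.snoc (φ p.1) (p.2 0))
        source := univ
        target := {p | p.1 ∈ φ.source}
        map_source' := fun x _ => cylinderProj_mem_source hφ x
        map_target' := fun _ _ => mem_univ _
        left_inv' := fun x _ => by
          simp only [chart_cylinderProj, Fin.snoc_init_self, Mod.chart_symm_e]
        right_inv' := fun p hp => by
          refine Prod.ext ?_ ?_
          · simp only [cylinderProj]
            rw [Mod.e_chart_symm (hmem p hp), Fin.init_snoc, φ.left_inv hp]
          · ext i
            rw [Subsingleton.elim i 0]
            simp only
            rw [Mod.e_chart_symm (hmem p hp), Fin.snoc_last]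
        open_source := isOpen_univ
        open_target := φ.open_source.preimage continuous_fst
        contMDiffOn_toFun := by
          refine ((contMDiff_cylinderProj hφ).prodMk ?_).contMDiffOn
          have h : ContMDiff 𝓘(ℂ, Fin (n + 1) → ℂ) 𝓘(ℂ, Fin 1 → ℂ) ω
              (fun (x : Fin (n + 1) → ℂ) (_ : Fin 1) => x (Fin.last n)) := fun _ =>
            contMDiffAt_iff_analyticAt.2 (analyticAt_pi_iff.2 fun _ => analyticAt_coord _ _)
          exact h.comp Mod.contMDiff_e
        contMDiffOn_invFun := by
          refine Mod.contMDiffOn_chart_symm.comp ?_ hmem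
          refine contMDiffOn_pi_space.2 fun i => ?_
          refine Fin.lastCases ?_ (fun i => ?_) i
          · simp only [Fin.snoc_last]
            exact (contMDiffOn_pi_space.1 contMDiffOn_snd 0)
          · simp only [Fin.snoc_castSucc]
            exact contMDiffOn_pi_space.1 ((contMDiffOn_of_mem_maximalAtlas hφ.1).comp
              contMDiffOn_fst fun p hp => hp) i }
    exact fun x => ⟨Φ, mem_univ x, fun _ _ => rfl⟩
  map_K x hx := by
    have hx0 : x = Mod.origin (cylinder hφ) := hx
    subst hx0
    exact ⟨by rwa [cylinderProj_origin], rfl⟩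
  divisor := by
    ext (x : Mod.{u} (cylinder hφ))
    change (∃ j ∈ a.map Fin.castSuccEmb, Mod.e x j = 0) ↔ cylinderProj hφ x ∈ A.E
    rw [ha _ (cylinderProj_mem_source hφ x), chart_cylinderProj]
    simp [Fin.init]

/-! ### Estimates and elements of transformed ideals -/

section Transform

variable {n n' : ℕ} {M M' : Type u} [TopologicalSpace M] [ChartedSpace (Fin n → ℂ) M]
  [TopologicalSpace M'] [ChartedSpace (Fin n' → ℂ) M'] {N : Set M} {N' : Set M'} {Q : M'}

/-- An estimate for the elements of a stalk passes to the inverse image. -/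
theorem isBigO_pullback {I : IdealFamily n N} {σ : M' → M}
    (hσ : Tendsto σ (𝓝[N'] Q) (𝓝[N] (σ Q))) {v : M → ℂ} {w : M → ℝ}
    (h : ∀ f, InIdeal (I (σ Q)) f → (fun q => v q * f q) =O[𝓝[N] (σ Q)] w) {g : M' → ℂ}
    (hg : InIdeal (I.pullback (n' := n') σ N' Q) g) :
    (fun q => v (σ q) * g q) =O[𝓝[N'] Q] fun q => w (σ q) := by
  obtain ⟨a, ha, hag⟩ := hg
  refine Submodule.span_induction (p := fun (a : stalk n' N' Q) _ => ∀ g : M' → ℂ,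
    (a : (𝓝[N'] Q).Germ ℂ) = (g : (𝓝[N'] Q).Germ ℂ) →
      (fun q => v (σ q) * g q) =O[𝓝[N'] Q] fun q => w (σ q)) ?_ ?_ ?_ ?_ ha g hag
  · rintro a ⟨f, f', hf', hff', haf⟩ g hg
    have h1 : g =ᶠ[𝓝[N'] Q] f ∘ σ := Germ.coe_eq.1 (hg.symm.trans haf)
    refine ((h f ⟨f', hf', hff'⟩).comp_tendsto hσ).congr' ?_ .rfl
    filter_upwards [h1] with q hq
    simp [hq]
  · intro g hg
    have h1 : (fun _ => (0 : ℂ)) =ᶠ[𝓝[N'] Q] g := Germ.coe_eq.1 hg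
    refine (Asymptotics.isBigO_zero _ _).congr' ?_ .rfl
    filter_upwards [h1] with q hq
    simp [← hq]
  · intro a b _ _ ha hb g hg
    obtain ⟨f₁, -, hf₁⟩ := exists_rep a
    obtain ⟨f₂, -, hf₂⟩ := exists_rep b
    have h5 : g =ᶠ[𝓝[N'] Q] fun q => f₁ q + f₂ q := by
      refine Germ.coe_eq.1 (hg.symm.trans ?_)
      rw [Subring.coe_add, hf₁, hf₂]; rfl
    refine ((ha f₁ hf₁).add (hb f₂ hf₂)).congr' ?_ .rfl
    filter_upwards [h5] with q hq
    rw [hq]; ring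
  · intro a b _ hb g hg
    obtain ⟨f₁, -, hf₁⟩ := exists_rep a
    obtain ⟨f₂, -, hf₂⟩ := exists_rep b
    have h5 : g =ᶠ[𝓝[N'] Q] fun q => f₁ q * f₂ q := by
      refine Germ.coe_eq.1 (hg.symm.trans ?_)
      rw [smul_eq_mul, Subring.coe_mul, hf₁, hf₂]; rfl
    have h6 := (isBigO_one_of_rep a hf₁).mul (hb f₂ hf₂)
    simp only [one_mul] at h6
    refine h6.congr' ?_ .rfl
    filter_upwards [h5] with q hq
    rw [hq]; ring

/-- An estimate for the elements of a stalk passes to the controlled transform, up to the `d`-th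
power of a function that vanishes on the exceptional divisor. -/
theorem isBigO_controlled {J : Marked n N} {π : M' → M} {Y : Set M}
    (hπ : Tendsto π (𝓝[N'] Q) (𝓝[N] (π Q))) {τ : M' → ℂ}
    (hτ : ContMDiffAt 𝓘(ℂ, Fin n' → ℂ) 𝓘(ℂ, ℂ) ω τ Q) (hτ0 : ∀ q ∈ π ⁻¹' Y, τ q = 0)
    {w : M → ℝ} (h : ∀ f, InIdeal (J.I (π Q)) f → f =O[𝓝[N] (π Q)] w) {g : M' → ℂ}
    (hg : InIdeal ((J.controlled (n' := n') π Y N').I Q) g) :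
    (fun q => τ q ^ J.d * g q) =O[𝓝[N'] Q] fun q => w (π q) := by
  obtain ⟨a, ha, hag⟩ := hg
  have hτI : germOf N' hτ ∈ vanishingIdeal n' N' (π ⁻¹' Y) Q := by
    refine ⟨τ, hτ, rfl, ?_⟩
    filter_upwards [self_mem_nhdsWithin] with q hq using hτ0 q hq.2
  have h1 := Submodule.mem_colon.1 ha _ (Ideal.pow_mem_pow hτI J.d)
  have h2 := isBigO_pullback (v := fun _ => 1) (w := w) hπ (by simpa using h)
    (g := fun q => τ q ^ J.d * g q) ⟨_, h1, ?_⟩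
  · simpa using h2
  · rw [smul_eq_mul, mul_comm, Subring.coe_mul, Subring.coe_pow, hag]
    rfl

end Transform

section ChartTransform

variable {N : ℕ} {W : OpenNhd N} {b : Finset (Fin N)} {t : Fin N} {ht : t ∈ b}
  {S : Set (Mod.{u} W)}

theorem val_incl_self (y : Mod.{u} (W.next b t)) : (incl W ht y).val.1 t = Mod.e y t := by
  rw [val_incl]
  exact blowChart_self b t _

theorem contMDiff_coord_comp_proj :
    ContMDiff 𝓘(ℂ, Fin N → ℂ) 𝓘(ℂ, ℂ) ω fun q : Bl.{u} W b => q.val.1 t := by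
  have h : ContMDiff 𝓘(ℂ, Fin N → ℂ) 𝓘(ℂ, ℂ) ω fun x : Fin N → ℂ => x t := fun _ =>
    contMDiffAt_iff_analyticAt.2 (analyticAt_coord _ _)
  exact h.comp (Mod.contMDiff_e.comp Bl.contMDiff_proj)

theorem tendsto_proj_strictTransform (hS : IsClosed S) (q : Bl.{u} W b) :
    Tendsto Bl.proj (𝓝[strictTransform Bl.proj (Mod.subspace W b) S] q) (𝓝[S] q.proj) := by
  refine (Bl.continuous_proj.continuousWithinAt).tendsto_nhdsWithin fun r hr => ?_
  have h1 : strictTransform (Bl.proj : Bl.{u} W b → _) (Mod.subspace W b) S ⊆ Bl.proj ⁻¹' S :=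
    closure_minimal (fun _ h => h.1) (hS.preimage Bl.continuous_proj)
  exact h1 hr

theorem isClosed_nextSet : IsClosed (nextSet W ht S) :=
  isClosed_closure.preimage continuous_incl

/-- An estimate for the elements of an ideal gives an estimate, with the factor `t ^ d`, for the
elements of its transform. -/
theorem isBigO_nextMarked (hS : IsClosed S) {J : Marked N S} {y : Mod.{u} (W.next b t)}
    {w : Mod.{u} W → ℝ}
    (h : ∀ f, InIdeal (J.I (chartMap W ht y)) f → f =O[𝓝[S] (chartMap W ht y)] w)
    {g : Mod.{u} (W.next b t) → ℂ} (hg : InIdeal ((nextMarked W ht J).I y) g) :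
    (fun q => Mod.e q t ^ J.d * g q) =O[𝓝[nextSet W ht S] y] fun q => w (chartMap W ht q) := by
  have h1 : Tendsto (incl W ht) (𝓝[nextSet W ht S] y)
      (𝓝[strictTransform Bl.proj (Mod.subspace W b) S] (incl W ht y)) :=
    continuous_incl.continuousWithinAt.tendsto_nhdsWithin fun _ hq => hq
  have h2 := isBigO_pullback h1 (v := fun q => q.val.1 t ^ J.d) (w := fun q => w q.proj)
    (fun f hf => isBigO_controlled (Y := Mod.subspace W b)
      (tendsto_proj_strictTransform hS _)
      (contMDiff_coord_comp_proj _) (fun q hq => hq t ht) h hf) hg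
  refine h2.congr_left fun q => ?_
  rw [val_incl_self]

/-- On a subspace with a retraction that preserves the exceptional divisor `x t = 0`, the ideal of
the exceptional divisor is generated by the coordinate `t`. -/
theorem vanishingIdeal_le_span {y : Mod.{u} (W.next b t)} (hyt : Mod.e y t = 0)
    {ρ : (Fin N → ℂ) → (Fin N → ℂ)} (hρ : AnalyticAt ℂ ρ (Mod.e y))
    (hρy : ρ (Mod.e y) = Mod.e y) (hρt : ∀ᶠ x in 𝓝 (Mod.e y), ρ x t = x t)
    (hρS : ∀ᶠ x in 𝓝 (Mod.e y), ∃ q ∈ nextSet W ht S, Mod.e q = ρ x)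
    (hρid : ∀ᶠ q in 𝓝[nextSet W ht S] y, ρ (Mod.e q) = Mod.e q) :
    vanishingIdeal N (strictTransform Bl.proj (Mod.subspace W b) S)
      (Bl.proj ⁻¹' Mod.subspace W b) (incl W ht y) ≤
      Ideal.span {germOf _ (contMDiff_coord_comp_proj (t := t) (incl W ht y))} := by
  rintro v ⟨f, hf, hvf, h0⟩
  have hmap : 𝓝[strictTransform Bl.proj (Mod.subspace W b) S] (incl W ht y) =
      map (incl W ht) (𝓝[nextSet W ht S] y) :=
    (isOpenEmbedding_incl.map_nhdsWithin_preimage_eq _ _).symm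
  have hcy : Bl.affineChart ht (incl W ht y) = Mod.e y := coord_incl y
  have hV : AnalyticAt ℂ (f ∘ Bl.chartInv ht) (Mod.e y) := by
    rw [← hcy]
    exact analyticAt_comp_symm (Bl.affineChart_mem_maximalAtlas ht) (incl_mem_source y) hf
  have hVρ : AnalyticAt ℂ ((f ∘ Bl.chartInv ht) ∘ ρ) (Mod.e y) := by
    refine AnalyticAt.comp ?_ hρ
    rwa [hρy]
  have htend : Tendsto (fun x => Bl.chartInv ht (ρ x)) (𝓝 (Mod.e y)) (𝓝 (incl W ht y)) := by
    have h1 : ContinuousAt (Bl.chartInv.{u} (W := W) ht) (ρ (Mod.e y)) := by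
      rw [hρy]
      exact (Bl.affineChart ht).continuousOn_invFun.continuousAt
        ((Bl.affineChart.{u} (W := W) ht).open_target.mem_nhds (Mod.e_mem y))
    have h2 := ContinuousAt.comp (g := Bl.chartInv.{u} (W := W) ht) h1 hρ.continuousAt
    simpa [ContinuousAt, hρy, incl, Function.comp_def] using h2
  obtain ⟨Ψ, hΨ, hVΨ⟩ := exists_eq_coord_mul hVρ hyt (by
    filter_upwards [htend.eventually (eventually_nhdsWithin_iff.1 h0), hρt, hρS]
      with x h1 h2 ⟨q, hq, hqx⟩ hxt
    refine h1 ⟨?_, ?_⟩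
    · rw [← hqx]
      exact hq
    · intro j hj
      rw [← hqx]
      change Mod.e (chartMap W ht q) j = 0
      rw [e_chartMap, blowChart_of_mem hj, hqx, h2, hxt, zero_mul])
  have hr : ContMDiffAt 𝓘(ℂ, Fin N → ℂ) 𝓘(ℂ, ℂ) ω (Ψ ∘ Bl.coord t) (incl W ht y) :=
    contMDiffAt_comp_chart (Bl.affineChart_mem_maximalAtlas ht) (incl_mem_source y)
      (by rwa [hcy])
  refine Ideal.mem_span_singleton'.2 ⟨germOf _ hr, Subtype.ext ?_⟩
  rw [← hvf, Subring.coe_mul]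
  have h2 : (fun q : Bl.{u} W b => Ψ (Bl.coord t q) * q.val.1 t)
      =ᶠ[𝓝[strictTransform Bl.proj (Mod.subspace W b) S] (incl W ht y)] f := by
    rw [hmap]
    refine eventually_map.2 ?_
    have h3 := Mod.continuous_e.continuousAt.eventually hVΨ
    filter_upwards [hρid, nhdsWithin_le_nhds h3] with q h4 h5
    rw [Function.comp_apply, h4] at h5
    rw [coord_incl, val_incl_self, mul_comm, ← h5]
    rfl
  exact Germ.coe_eq.2 h2

/-- A function on the strict transform whose product with `t ^ d` is the inverse image of an
element of an ideal belongs to the controlled transform of the ideal. -/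
theorem inIdeal_nextMarked {J : Marked N S} {y : Mod.{u} (W.next b t)} (hyt : Mod.e y t = 0)
    {ρ : (Fin N → ℂ) → (Fin N → ℂ)} (hρ : AnalyticAt ℂ ρ (Mod.e y))
    (hρy : ρ (Mod.e y) = Mod.e y) (hρt : ∀ᶠ x in 𝓝 (Mod.e y), ρ x t = x t)
    (hρS : ∀ᶠ x in 𝓝 (Mod.e y), ∃ q ∈ nextSet W ht S, Mod.e q = ρ x)
    (hρid : ∀ᶠ q in 𝓝[nextSet W ht S] y, ρ (Mod.e q) = Mod.e q)
    {F F' : (Fin N → ℂ) → ℂ} (hF : InIdeal (J.I (chartMap W ht y)) (F ∘ Mod.e))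
    (hF' : AnalyticAt ℂ F' (Mod.e y))
    (hFF' : ∀ᶠ q in 𝓝[nextSet W ht S] y,
      F (blowChart b t (Mod.e q)) = Mod.e q t ^ J.d * F' (Mod.e q)) :
    InIdeal ((nextMarked W ht J).I y) (F' ∘ Mod.e) := by
  have hmap : 𝓝[strictTransform Bl.proj (Mod.subspace W b) S] (incl W ht y) =
      map (incl W ht) (𝓝[nextSet W ht S] y) :=
    (isOpenEmbedding_incl.map_nhdsWithin_preimage_eq _ _).symm
  have hf : ContMDiffAt 𝓘(ℂ, Fin N → ℂ) 𝓘(ℂ, ℂ) ω (F' ∘ Bl.coord t) (incl W ht y) :=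
    contMDiffAt_comp_chart (Bl.affineChart_mem_maximalAtlas ht) (incl_mem_source y)
      (by rwa [show Bl.affineChart ht (incl W ht y) = Mod.e y from coord_incl y])
  have hmem : germOf (strictTransform Bl.proj (Mod.subspace W b) S) hf ∈
      (J.controlled Bl.proj (Mod.subspace W b)
        (strictTransform (Bl.proj : Bl.{u} W b → _) (Mod.subspace W b) S)).I (incl W ht y) := by
    refine Submodule.mem_colon.2 fun p hp => ?_
    have h1 : p ∈ Ideal.span
        {germOf (strictTransform Bl.proj (Mod.subspace W b) S)
          (contMDiff_coord_comp_proj (t := t) (incl W ht y)) ^ J.d} := by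
      rw [← Ideal.span_singleton_pow]
      exact Ideal.pow_right_mono (vanishingIdeal_le_span hyt hρ hρy hρt hρS hρid) _ hp
    obtain ⟨r, rfl⟩ := Ideal.mem_span_singleton.1 h1
    rw [smul_eq_mul, ← mul_assoc]
    refine Ideal.mul_mem_right _ _ (Ideal.subset_span ?_)
    obtain ⟨f', hf', hfF⟩ := hF
    refine ⟨F ∘ Mod.e, f', hf', hfF, ?_⟩
    rw [Subring.coe_mul, Subring.coe_pow]
    have h2 : (fun q : Bl.{u} W b => F' (Bl.coord t q) * q.val.1 t ^ J.d)
        =ᶠ[𝓝[strictTransform Bl.proj (Mod.subspace W b) S] (incl W ht y)]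
          (F ∘ Mod.e) ∘ Bl.proj := by
      rw [hmap]
      refine eventually_map.2 ?_
      filter_upwards [hFF'] with q hq
      rw [coord_incl, Function.comp_apply, Function.comp_apply, val_incl_self, mul_comm, ← hq,
        ← e_chartMap (ht := ht)]
      rfl
    exact Germ.coe_eq.2 h2
  refine ⟨germOf _ (contMDiffAt_comp_chart Mod.chart_mem_maximalAtlas (mem_univ y) hF'),
    Ideal.subset_span ⟨F' ∘ Bl.coord t, _, hmem, rfl, ?_⟩, rfl⟩
  refine Germ.coe_eq.2 (.of_forall fun q => ?_)
  simp [coord_incl]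

end ChartTransform

/-! ### Sufficiency: test systems in adapted coordinates -/

section Coordinates

variable {N : ℕ}

/-- The projection of `ℂᴺ` that replaces the coordinates in `c` by `0`. -/
noncomputable def killCoords (c : Finset (Fin N)) : (Fin N → ℂ) →L[ℂ] (Fin N → ℂ) :=
  ContinuousLinearMap.pi fun j => if j ∈ c then 0 else ContinuousLinearMap.proj j

theorem killCoords_apply (c : Finset (Fin N)) (x : Fin N → ℂ) (j : Fin N) :
    killCoords c x j = if j ∈ c then 0 else x j := by
  simp only [killCoords, ContinuousLinearMap.coe_pi']
  split_ifs <;> rfl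

theorem norm_killCoords_le (c : Finset (Fin N)) (x : Fin N → ℂ) : ‖killCoords c x‖ ≤ ‖x‖ := by
  rw [pi_norm_le_iff_of_nonneg (norm_nonneg _)]
  intro j
  rw [killCoords_apply]
  split_ifs
  · simp
  · exact norm_le_pi_norm x j

theorem killCoords_eq_self {c : Finset (Fin N)} {x : Fin N → ℂ} (h : ∀ j ∈ c, x j = 0) :
    killCoords c x = x := by
  ext j
  rw [killCoords_apply]
  split_ifs with hj
  · exact (h j hj).symm
  · rfl

/-- A factor `x t ^ d` can be cancelled in an estimate, by continuity also where `x t = 0`. -/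
theorem eventually_le_of_mul_pow_le {t : Fin N} {G : (Fin N → ℂ) → ℂ} {x₀ : Fin N → ℂ}
    (hG : AnalyticAt ℂ G x₀) {v : (Fin N → ℂ) → ℝ} (hv : Continuous v) {d : ℕ} {C : ℝ}
    (h : ∀ᶠ x in 𝓝 x₀, ‖x t ^ d * G x‖ ≤ C * (‖x t‖ ^ d * v x)) :
    ∀ᶠ x in 𝓝 x₀, ‖G x‖ ≤ C * v x := by
  have key : ∀ x : Fin N → ℂ, x t ≠ 0 → ‖x t ^ d * G x‖ ≤ C * (‖x t‖ ^ d * v x) →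
      ‖G x‖ ≤ C * v x := by
    intro x hx hle
    rw [norm_mul, norm_pow, mul_left_comm] at hle
    exact le_of_mul_le_mul_left hle (pow_pos (norm_pos_iff.2 hx) d)
  filter_upwards [h.eventually_nhds, hG.eventually_analyticAt] with x hx hGx
  by_cases hxt : x t = 0
  · have h1 := tendsto_add_single x t
    have h2 := (hGx.continuousAt.norm.tendsto.comp h1)
    have h3 := ((continuous_const (y := C)).mul hv).continuousAt.tendsto.comp h1
    refine le_of_tendsto_of_tendsto h2 h3 ?_
    filter_upwards [h1.eventually hx, self_mem_nhdsWithin] with τ h4 h5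
    refine key _ ?_ h4
    simpa [hxt] using h5
  · exact key x hxt hx.self_of_nhds

namespace Mod

theorem e_origin (W : OpenNhd N) : e (origin.{u} W) = 0 := e_mk _ _

theorem tendsto_chart_symm {W : OpenNhd N} {α : Type*} {l : Filter α} {x : α → Fin N → ℂ}
    {y : Mod.{u} W} (h : Tendsto x l (𝓝 (e y))) :
    Tendsto (fun i => (chart W).symm (x i)) l (𝓝 y) ∧
      ∀ᶠ i in l, e ((chart.{u} W).symm (x i)) = x i := by
  constructor
  · have h1 : ContinuousAt (chart.{u} W).symm (e y) :=
      (chart W).continuousAt_symm (by simpa using e_mem y)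
    simpa [Function.comp_def] using h1.tendsto.comp h
  · filter_upwards [h.eventually (W.isOpen.mem_nhds (e_mem y))] with i hi
    exact e_chart_symm hi

end Mod

end Coordinates

section Sufficiency

variable {N : ℕ} {W : OpenNhd N} {b c : Finset (Fin N)} {t : Fin N}

theorem isClosed_subspace : IsClosed (Mod.subspace.{u} W c) :=
  (Mod.isNCSubset_subspace W ∅ c).1

theorem tendsto_killCoords {Q : Mod.{u} W} (hQ : Q ∈ Mod.subspace W c) :
    Tendsto (fun x => (Mod.chart W).symm (killCoords c x)) (𝓝 (Mod.e Q))
      (𝓝[Mod.subspace W c] Q) := by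
  have h1 : Tendsto (killCoords c) (𝓝 (Mod.e Q)) (𝓝 (Mod.e Q)) := by
    have := (killCoords c).continuous.tendsto (Mod.e Q)
    rwa [killCoords_eq_self hQ] at this
  obtain ⟨h2, h3⟩ := Mod.tendsto_chart_symm h1
  refine tendsto_nhdsWithin_iff.2 ⟨h2, h3.mono fun x hx j hj => ?_⟩
  rw [hx, killCoords_apply, if_pos hj]

/-- The criterion for the multiplicity of an ideal on a coordinate subspace. -/
theorem le_order_of_isBigO {Q : Mod.{u} W} (hQ : Q ∈ Mod.subspace W c)
    {I : Ideal (stalk N (Mod.subspace W c) Q)} {d : ℕ}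
    (h : ∀ f, InIdeal I f → f =O[𝓝[Mod.subspace W c] Q] fun q => ‖Mod.e q - Mod.e Q‖ ^ d) :
    (d : ℕ∞) ≤ order I := by
  refine le_order_iff.2 fun g hg => ?_
  obtain ⟨f, hf, hgf⟩ := exists_rep g
  refine mem_maxIdeal_pow_of_retraction (φ := Mod.chart W) Mod.chart_mem_maximalAtlas (mem_univ Q)
    (ρ := killCoords c) ?_ hgf ?_
  · filter_upwards [self_mem_nhdsWithin] with q hq using killCoords_eq_self hq
  · have h1 : AnalyticAt ℂ (f ∘ (Mod.chart W).symm) (Mod.e Q) :=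
      analyticAt_comp_symm Mod.chart_mem_maximalAtlas (mem_univ Q) hf
    have h2 : AnalyticAt ℂ ((f ∘ (Mod.chart W).symm) ∘ killCoords c) (Mod.e Q) := by
      refine AnalyticAt.comp ?_ ((killCoords c).analyticAt _)
      rwa [killCoords_eq_self hQ]
    refine vanishesToOrder_of_isBigO h2 ?_
    have h3 := (h f ⟨g, hg, hgf⟩).comp_tendsto (tendsto_killCoords hQ)
    refine h3.trans (Asymptotics.IsBigO.of_bound 1 ?_)
    have h4 := (Mod.tendsto_chart_symm (W := W) (y := Q) (x := killCoords c) (l := 𝓝 (Mod.e Q))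
      (by simpa [killCoords_eq_self hQ] using (killCoords c).continuous.tendsto (Mod.e Q))).2
    filter_upwards [h4] with x hx
    have h5 : killCoords c x - Mod.e Q = killCoords c (x - Mod.e Q) := by
      rw [map_sub, killCoords_eq_self hQ]
    simp only [Function.comp_apply, hx, h5, norm_pow, norm_norm, one_mul]
    exact pow_le_pow_left₀ (norm_nonneg _) (norm_killCoords_le c _) d

theorem nextSet_subspace (ht : t ∈ b) (hcb : c ⊆ b) (htc : t ∉ c) :
    nextSet W ht (Mod.subspace.{u} W c) = Mod.subspace (W.next b t) c := by
  have hiff : ∀ y : Mod.{u} (W.next b t), Mod.e y t ≠ 0 →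
      (chartMap W ht y ∈ Mod.subspace W c ↔ y ∈ Mod.subspace (W.next b t) c) := by
    intro y hy
    refine forall₂_congr fun j hj => ?_
    have hjt : j ≠ t := fun h => htc (h ▸ hj)
    rw [e_chartMap]
    simp [blowChart, hcb hj, hjt, hy]
  rw [nextSet_eq]
  refine Subset.antisymm (closure_minimal (fun y hy => (hiff y hy.2).1 hy.1) isClosed_subspace)
    fun y hy => ?_
  obtain ⟨h1, h2⟩ := Mod.tendsto_chart_symm (tendsto_add_single (Mod.e y) t)
  by_cases hyt : Mod.e y t = 0
  · refine mem_closure_of_tendsto h1 ?_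
    filter_upwards [h2, self_mem_nhdsWithin] with τ hτ hτ0
    have h3 : Mod.e ((Mod.chart (W.next b t)).symm
        (Mod.e y + τ • (Pi.single t 1 : Fin N → ℂ))) t ≠ 0 := by
      rw [hτ]
      simpa [hyt] using hτ0
    refine ⟨(hiff _ h3).2 fun j hj => ?_, h3⟩
    have hjt : j ≠ t := fun h => htc (h ▸ hj)
    rw [hτ]
    simpa [hjt] using hy j hj
  · exact subset_closure ⟨(hiff y hyt).2 hy, hyt⟩

/-- The elements of the ideal of `J` at `Q` are, on the subspace `S`, of the order of growth of
`|x t| ^ m ‖x'‖ ^ ν`, where `x'` are the coordinates other than `t`. -/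
def HasEstimate (t : Fin N) {S : Set (Mod.{u} W)} (J : Marked N S) (m ν : ℕ) (Q : Mod.{u} W) :
    Prop :=
  ∀ f, InIdeal (J.I Q) f →
    f =O[𝓝[S] Q] fun q => ‖Mod.e q t‖ ^ m * ‖killCoords {t} (Mod.e q)‖ ^ ν

/-- The effect of a blowing-up on the exponents: `m` becomes `m' = m + κ ν - d`, where `κ` is the
power of `t` in the inverse image of `‖x'‖`. -/
theorem HasEstimate.next {ht : t ∈ b} (hcb : c ⊆ b) (htc : t ∉ c)
    {J : Marked N (Mod.subspace.{u} W c)} {m ν m' κ : ℕ}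
    (hκ : ∀ y ∈ Mod.subspace.{u} (W.next b t) c,
      ‖killCoords {t} (blowChart b t (Mod.e y))‖ =
        ‖Mod.e y t‖ ^ κ * ‖killCoords {t} (Mod.e y)‖)
    (hm : m + κ * ν = J.d + m') {y : Mod.{u} (W.next b t)}
    (hy : y ∈ Mod.subspace (W.next b t) c) (h : HasEstimate t J m ν (chartMap W ht y)) :
    HasEstimate t (nextMarked W ht J) m' ν y := by
  intro g hg
  have h1 := isBigO_nextMarked isClosed_subspace h hg
  obtain ⟨a, ha, hag⟩ := hg
  obtain ⟨f, hf, haf⟩ := exists_rep a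
  have hgf : g =ᶠ[𝓝[nextSet W ht (Mod.subspace W c)] y] f := Germ.coe_eq.1 (hag.symm.trans haf)
  rw [nextSet_subspace ht hcb htc] at h1 hgf ⊢
  have h2 : (fun q => Mod.e q t ^ J.d * f q) =O[𝓝[Mod.subspace (W.next b t) c] y]
      fun q => ‖Mod.e q t‖ ^ J.d * (‖Mod.e q t‖ ^ m' * ‖killCoords {t} (Mod.e q)‖ ^ ν) := by
    refine h1.congr' ?_ ?_
    · filter_upwards [hgf] with q hq
      rw [hq]
    · filter_upwards [self_mem_nhdsWithin] with q hq
      rw [e_chartMap, hκ q hq, blowChart_self, mul_pow, ← pow_mul, ← mul_assoc, ← pow_add, hm,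
        pow_add, mul_assoc]
  obtain ⟨C, hC⟩ := h2.bound
  have h3 : AnalyticAt ℂ (f ∘ (Mod.chart _).symm) (Mod.e y) :=
    analyticAt_comp_symm Mod.chart_mem_maximalAtlas (mem_univ y) hf
  have h4 : AnalyticAt ℂ ((f ∘ (Mod.chart _).symm) ∘ killCoords c) (Mod.e y) := by
    refine AnalyticAt.comp ?_ ((killCoords c).analyticAt _)
    rwa [killCoords_eq_self hy]
  have hkt : ∀ x : Fin N → ℂ, killCoords c x t = x t := fun x => by
    rw [killCoords_apply, if_neg htc]
  have h5 := eventually_le_of_mul_pow_le (t := t) (d := J.d) (C := C) h4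
    (v := fun x => ‖x t‖ ^ m' * ‖killCoords {t} (killCoords c x)‖ ^ ν) (by fun_prop) (by
      have h6 := (Mod.tendsto_chart_symm (W := W.next b t) (y := y) (x := killCoords c)
        (l := 𝓝 (Mod.e y)) (by
          simpa [killCoords_eq_self hy] using (killCoords c).continuous.tendsto (Mod.e y))).2
      filter_upwards [(tendsto_killCoords hy).eventually hC, h6] with x hx h7
      rw [h7, hkt] at hx
      simpa only [Function.comp_apply, norm_mul, norm_pow, norm_norm] using hx)
  refine Asymptotics.IsBigO.of_bound C ?_
  filter_upwards [hgf, self_mem_nhdsWithin,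
    nhdsWithin_le_nhds (Mod.continuous_e.continuousAt.eventually h5)] with q h8 h9 h10
  rw [Function.comp_apply, killCoords_eq_self h9, Function.comp_apply, Mod.chart_symm_e] at h10
  rw [h8]
  simpa only [norm_mul, norm_pow, norm_norm] using h10

theorem killCoords_blowChart_univ (y : Fin N → ℂ) :
    killCoords {t} (blowChart Finset.univ t y) = y t • killCoords {t} y := by
  ext j
  by_cases hj : j = t
  · simp [killCoords_apply, hj]
  · simp [killCoords_apply, hj, blowChart]

theorem norm_killCoords_blowChart_univ (y : Fin N → ℂ) :
    ‖killCoords {t} (blowChart Finset.univ t y)‖ = ‖y t‖ ^ 1 * ‖killCoords {t} y‖ := by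
  rw [killCoords_blowChart_univ, norm_smul, pow_one]

theorem norm_killCoords_blowChart_insert {y : Fin N → ℂ} (hy : ∀ j ∈ c, y j = 0) :
    ‖killCoords {t} (blowChart (insert t c) t y)‖ = ‖y t‖ ^ 0 * ‖killCoords {t} y‖ := by
  have h : killCoords {t} (blowChart (insert t c) t y) = killCoords {t} y := by
    ext j
    by_cases hj : j = t
    · simp [killCoords_apply, hj]
    · by_cases hjc : j ∈ c
      · simp [killCoords_apply, hj, blowChart, hjc, hy j hjc]
      · simp [killCoords_apply, hj, blowChart, hjc]
  rw [h, pow_zero, one_mul]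

/-- The list of the centres of the test system: the origin `s` times, then the intersection of the
coordinate subspace `x j = 0`, `j ∈ c`, with the exceptional divisor `r` times. -/
def centers (t : Fin N) (c : Finset (Fin N)) (s r : ℕ) : List {b : Finset (Fin N) // t ∈ b} :=
  List.replicate s ⟨Finset.univ, Finset.mem_univ t⟩ ++
    List.replicate r ⟨insert t c, Finset.mem_insert_self t c⟩

theorem centers_succ_left (t : Fin N) (c : Finset (Fin N)) (s r : ℕ) :
    centers t c (s + 1) r = ⟨Finset.univ, Finset.mem_univ t⟩ :: centers t c s r := rfl

theorem centers_zero_succ (t : Fin N) (c : Finset (Fin N)) (r : ℕ) :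
    centers t c 0 (r + 1) = ⟨insert t c, Finset.mem_insert_self t c⟩ :: centers t c 0 r := rfl

theorem chartMap_mem_subspace {ht : t ∈ b} {y : Mod.{u} (W.next b t)} (hy : Mod.e y t = 0) :
    chartMap W ht y ∈ Mod.subspace W b := by
  intro j hj
  rw [e_chartMap, blowChart_of_mem hj, hy, zero_mul]

/-- The blowings-up of the divisor lower the exponent `m` by `d` and leave `ν` unchanged. -/
theorem permissible_divisor_steps (htc : t ∉ c) (r : ℕ) : ∀ (W : OpenNhd N) (a : Finset (Fin N))
    (S : Set (Mod.{u} W)) (_ : S = Mod.subspace W c) (L : List (Marked N S)),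
    (∀ J ∈ L, ∃ m ν, r * J.d ≤ m ∧ ∀ Q ∈ S, Mod.e Q t = 0 → HasEstimate t J m ν Q) →
    (chain t (centers t c 0 r) W a).ImmersedPermissible S L := by
  induction r with
  | zero => exact fun W a S hS L _ => trivial
  | succ r ih =>
    rintro W a S rfl L hL
    rw [centers_zero_succ, chain_cons_permissible]
    constructor
    · refine .of_forall fun Q hQ => ?_
      have hQc : Q ∈ Mod.subspace W c := fun j hj => hQ j (Finset.mem_insert_of_mem hj)
      have hQt : Mod.e Q t = 0 := hQ t (Finset.mem_insert_self t c)
      refine ⟨hQc, fun J hJ => le_order_of_isBigO hQc fun f hf => ?_⟩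
      obtain ⟨m, ν, hm, hest⟩ := hL J hJ
      have hdm : J.d ≤ m := le_trans (by rw [add_one_mul]; omega) hm
      refine (hest Q hQc hQt f hf).trans ?_
      have h1 : (fun q => ‖Mod.e q t‖ ^ m) =O[𝓝[Mod.subspace W c] Q]
          fun q => ‖Mod.e q - Mod.e Q‖ ^ J.d := by
        refine Asymptotics.IsBigO.of_bound 1 ?_
        have h2 : ∀ᶠ q in 𝓝[Mod.subspace W c] Q, ‖Mod.e q - Mod.e Q‖ < 1 := by
          have h3 : Continuous fun q : Mod.{u} W => ‖Mod.e q - Mod.e Q‖ := by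
            have := Mod.continuous_e.{u} (W := W)
            fun_prop
          exact nhdsWithin_le_nhds (h3.continuousAt.eventually (gt_mem_nhds (by simp)))
        filter_upwards [h2] with q hq
        have h4 : ‖Mod.e q t‖ ≤ ‖Mod.e q - Mod.e Q‖ := by
          simpa [hQt] using norm_le_pi_norm (Mod.e q - Mod.e Q) t
        simp only [norm_pow, norm_norm, one_mul]
        exact (pow_le_pow_left₀ (norm_nonneg _) h4 m).trans
          (pow_le_pow_of_le_one (norm_nonneg _) hq.le hdm)
      have h5 : (fun q : Mod.{u} W => ‖killCoords {t} (Mod.e q)‖ ^ ν)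
          =O[𝓝[Mod.subspace W c] Q] fun _ => (1 : ℝ) := by
        have h6 : Continuous fun q : Mod.{u} W => ‖killCoords {t} (Mod.e q)‖ ^ ν := by
          have := Mod.continuous_e.{u} (W := W)
          fun_prop
        exact (h6.continuousAt.norm.isBoundedUnder_le.isBigO_one ℝ).mono nhdsWithin_le_nhds
      simpa using h1.mul h5
    · refine ih _ _ _ (nextSet_subspace _ (Finset.subset_insert t c) htc) _ ?_
      intro J' hJ'
      obtain ⟨J, hJ, rfl⟩ := List.mem_map.1 hJ'
      obtain ⟨m, ν, hm, hest⟩ := hL J hJ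
      have hd : (nextMarked W (Finset.mem_insert_self t c) J).d = J.d := rfl
      rw [add_one_mul] at hm
      refine ⟨m - J.d, ν, by rw [hd]; omega, fun y hy hyt => ?_⟩
      rw [nextSet_subspace _ (Finset.subset_insert t c) htc] at hy
      have h1 := chartMap_mem_subspace (ht := Finset.mem_insert_self t c) hyt
      refine HasEstimate.next (m := m) (κ := 0) (Finset.subset_insert t c) htc
        (fun z hz => norm_killCoords_blowChart_insert hz) (by omega) hy (hest _ ?_ ?_)
      · exact fun j hj => h1 j (Finset.mem_insert_of_mem hj)
      · exact h1 t (Finset.mem_insert_self t c)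

/-- The first blowing-up, with centre the origin. -/
theorem permissible_point_step {W : OpenNhd N} {a : Finset (Fin N)}
    {bs : List {b : Finset (Fin N) // t ∈ b}} {L : List (Marked N (Mod.subspace.{u} W c))}
    (hL : ∀ J ∈ L, ∃ m ν, J.d ≤ ν ∧ HasEstimate t J m ν (Mod.origin W))
    (h : (chain t bs (W.next Finset.univ t) (insert t a)).ImmersedPermissible
      (nextSet W (Finset.mem_univ t) (Mod.subspace W c))
      (L.map fun J => nextMarked W (Finset.mem_univ t) J)) :
    (chain t (⟨Finset.univ, Finset.mem_univ t⟩ :: bs) W a).ImmersedPermissible _ L := by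
  rw [chain_cons_permissible]
  refine ⟨.of_forall fun Q hQ => ?_, h⟩
  have hQ0 : Q = Mod.origin W := by
    refine Mod.e_injective (funext fun j => ?_)
    rw [hQ j (Finset.mem_univ j), Mod.e_origin, Pi.zero_apply]
  subst hQ0
  have hc : Mod.origin W ∈ Mod.subspace.{u} W c := fun j _ => hQ j (Finset.mem_univ j)
  refine ⟨hc, fun J hJ => le_order_of_isBigO hc fun f hf => ?_⟩
  obtain ⟨m, ν, hν, hest⟩ := hL J hJ
  refine (hest f hf).trans (Asymptotics.IsBigO.of_bound 1 ?_)
  have h2 : ∀ᶠ q in 𝓝[Mod.subspace W c] Mod.origin W, ‖Mod.e q‖ < 1 := by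
    have h3 : Continuous fun q : Mod.{u} W => ‖Mod.e q‖ := Mod.continuous_e.norm
    exact nhdsWithin_le_nhds (h3.continuousAt.eventually (gt_mem_nhds (by simp [Mod.e_origin])))
  filter_upwards [h2] with q hq
  simp only [norm_pow, norm_norm, norm_mul, one_mul, Mod.e_origin, sub_zero]
  have h4 : ‖Mod.e q t‖ ^ m ≤ 1 :=
    pow_le_one₀ (norm_nonneg _) ((norm_le_pi_norm _ t).trans hq.le)
  have h5 : ‖killCoords {t} (Mod.e q)‖ ^ ν ≤ ‖Mod.e q‖ ^ J.d :=
    (pow_le_pow_left₀ (norm_nonneg _) (norm_killCoords_le _ _) ν).trans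
      (pow_le_pow_of_le_one (norm_nonneg _) hq.le hν)
  simpa using mul_le_mul h4 h5 (by positivity) zero_le_one

/-- The blowing-up of the origin raises the exponent `m` by `ν - d`. -/
theorem HasEstimate.next_univ (htc : t ∉ c) {J : Marked N (Mod.subspace.{u} W c)} {m ν : ℕ}
    (hν : J.d ≤ ν) (h : HasEstimate t J m ν (Mod.origin W))
    {y : Mod.{u} (W.next Finset.univ t)} (hy : y ∈ Mod.subspace (W.next Finset.univ t) c)
    (hyt : Mod.e y t = 0) :
    HasEstimate t (nextMarked W (Finset.mem_univ t) J) (m + (ν - J.d)) ν y := by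
  refine HasEstimate.next (m := m) (κ := 1) (Finset.subset_univ c) htc
    (fun z _ => norm_killCoords_blowChart_univ _) (by omega) hy ?_
  have h1 : chartMap W (Finset.mem_univ t) y = Mod.origin W := by
    refine Mod.e_injective (funext fun j => ?_)
    rw [chartMap_mem_subspace hyt j (Finset.mem_univ j), Mod.e_origin, Pi.zero_apply]
  rwa [h1]

/-- In adapted coordinates the test system is permissible as soon as the multiplicities are large
enough. -/
theorem permissible_of_hasEstimate (htc : t ∉ c) (r s : ℕ) : ∀ (W : OpenNhd N)
    (a : Finset (Fin N)) (S : Set (Mod.{u} W)) (_ : S = Mod.subspace W c) (L : List (Marked N S)),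
    (∀ J ∈ L, ∃ m ν, J.d ≤ ν ∧ r * J.d ≤ m + (s + 1) * (ν - J.d) ∧
      HasEstimate t J m ν (Mod.origin W)) →
    (chain t (centers t c (s + 1) r) W a).ImmersedPermissible S L := by
  induction s with
  | zero =>
    rintro W a S rfl L hL
    rw [centers_succ_left]
    refine permissible_point_step (fun J hJ => ?_) ?_
    · obtain ⟨m, ν, h1, -, h2⟩ := hL J hJ
      exact ⟨m, ν, h1, h2⟩
    · refine permissible_divisor_steps htc r _ _ _ (nextSet_subspace _ (Finset.subset_univ c) htc)
        _ fun J' hJ' => ?_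
      obtain ⟨J, hJ, rfl⟩ := List.mem_map.1 hJ'
      obtain ⟨m, ν, h1, h2, h3⟩ := hL J hJ
      have hd : (nextMarked W (Finset.mem_univ t) J).d = J.d := rfl
      refine ⟨m + (ν - J.d), ν, by rw [hd]; simpa using h2, fun y hy hyt => ?_⟩
      rw [nextSet_subspace _ (Finset.subset_univ c) htc] at hy
      exact h3.next_univ htc h1 hy hyt
  | succ s ih =>
    rintro W a S rfl L hL
    rw [centers_succ_left]
    refine permissible_point_step (fun J hJ => ?_) ?_
    · obtain ⟨m, ν, h1, -, h2⟩ := hL J hJ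
      exact ⟨m, ν, h1, h2⟩
    · refine ih _ _ _ (nextSet_subspace _ (Finset.subset_univ c) htc) _ fun J' hJ' => ?_
      obtain ⟨J, hJ, rfl⟩ := List.mem_map.1 hJ'
      obtain ⟨m, ν, h1, h2, h3⟩ := hL J hJ
      have hd : (nextMarked W (Finset.mem_univ t) J).d = J.d := rfl
      refine ⟨m + (ν - J.d), ν, h1, ?_, h3.next_univ htc h1 (fun j _ => ?_) ?_⟩
      · rw [hd]
        nlinarith
      · rw [Mod.e_origin, Pi.zero_apply]
      · rw [Mod.e_origin, Pi.zero_apply]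

end Sufficiency

/-! ### Necessity: one step of the test system -/

section Retraction

variable {N : ℕ} {W : OpenNhd N} {b : Finset (Fin N)} {t : Fin N} {S : Set (Mod.{u} W)}

/-- Near the origin, `ρ` is a holomorphic retraction onto `S` that preserves the coordinate `t`. -/
structure IsRetraction (t : Fin N) (S : Set (Mod.{u} W)) (ρ : (Fin N → ℂ) → (Fin N → ℂ)) :
    Prop where
  analyticAt : AnalyticAt ℂ ρ 0
  apply_coord : ∀ x, ρ x t = x t
  mem : ∀ᶠ x in 𝓝 0, ∃ q ∈ S, Mod.e q = ρ x
  fix : ∀ᶠ q in 𝓝[S] Mod.origin W, ρ (Mod.e q) = Mod.e q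

theorem IsRetraction.apply_zero {ρ : (Fin N → ℂ) → (Fin N → ℂ)} (hρ : IsRetraction t S ρ)
    (h0 : Mod.origin W ∈ S) : ρ 0 = 0 := by
  simpa [Mod.e_origin] using hρ.fix.self_of_nhdsWithin h0

theorem tendsto_e_origin : Tendsto (Mod.e : Mod.{u} W → _) (𝓝 (Mod.origin W)) (𝓝 0) := by
  simpa [ContinuousAt, Mod.e_origin] using
    (Mod.continuous_e.{u} (W := W)).continuousAt (x := Mod.origin W)

theorem tendsto_chart_symm_origin :
    Tendsto (Mod.chart.{u} W).symm (𝓝 0) (𝓝 (Mod.origin W)) := by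
  refine (Mod.tendsto_chart_symm (x := id) (y := Mod.origin W) ?_).1
  rw [Mod.e_origin]
  exact tendsto_id

/-- A retraction fixes the points of `S`, in the coordinates. -/
theorem IsRetraction.eventually_fix {ρ : (Fin N → ℂ) → (Fin N → ℂ)} (hρ : IsRetraction t S ρ) :
    ∀ᶠ x in 𝓝 0, ∀ q ∈ S, Mod.e q = x → ρ x = x := by
  filter_upwards [tendsto_chart_symm_origin.eventually (eventually_nhdsWithin_iff.1 hρ.fix)]
    with x hx q hq hqx
  subst hqx
  rw [Mod.chart_symm_e] at hx
  exact hx hq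

theorem IsRetraction.idempotent {ρ : (Fin N → ℂ) → (Fin N → ℂ)} (hρ : IsRetraction t S ρ)
    (h0 : ρ 0 = 0) : ∀ᶠ x in 𝓝 0, ρ (ρ x) = ρ x := by
  have h1 : Tendsto ρ (𝓝 0) (𝓝 0) := by
    simpa [ContinuousAt, h0] using hρ.analyticAt.continuousAt
  filter_upwards [hρ.mem, h1.eventually hρ.eventually_fix] with x ⟨q, hq, hqx⟩ h2
  exact h2 q hq hqx

/-- Outside the exceptional divisor the blowing-up is injective. -/
theorem blowChart_injOn {x y : Fin N → ℂ} (hx : x t ≠ 0)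
    (h : blowChart b t x = blowChart b t y) : x = y := by
  have h1 : x t = y t := by simpa [blowChart_self] using congrFun h t
  ext j
  have h2 := congrFun h j
  by_cases hj : j ∈ b ∧ j ≠ t
  · simp only [blowChart, if_pos hj, ← h1] at h2
    exact mul_left_cancel₀ hx h2
  · simpa only [blowChart, if_neg hj] using h2

theorem tendsto_blowChart (b : Finset (Fin N)) (t : Fin N) :
    Tendsto (blowChart b t) (𝓝 0) (𝓝 0) := by
  simpa [ContinuousAt, blowChart_zero] using (continuous_blowChart b t).continuousAt (x := 0)

/-- A map `ρ'` that lifts the retraction `ρ` is a retraction onto the transform of `S`: outside the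
exceptional divisor this holds because the blowing-up is injective there, and on the divisor by
continuity. -/
theorem IsRetraction.next {ρ ρ' : (Fin N → ℂ) → (Fin N → ℂ)} (hρ : IsRetraction t S ρ)
    (ht : t ∈ b) (hρ' : AnalyticAt ℂ ρ' 0) (hρt : ∀ x, ρ' x t = x t)
    (h : ∀ᶠ x in 𝓝 0, blowChart b t (ρ' x) = ρ (blowChart b t x)) :
    IsRetraction t (nextSet W ht S) ρ' where
  analyticAt := hρ'
  apply_coord := hρt
  mem := by
    have hmem := ((tendsto_blowChart b t).eventually hρ.mem)
    have key : ∀ x, blowChart b t (ρ' x) = ρ (blowChart b t x) →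
        (∃ q ∈ S, Mod.e q = ρ (blowChart b t x)) →
        ∃ y : Mod.{u} (W.next b t), Mod.e y = ρ' x ∧ (x t ≠ 0 → y ∈ nextSet W ht S) := by
      rintro x h1 ⟨q, hq, hqx⟩
      have h2 : ρ' x ∈ (W.next b t).carrier := by
        change blowChart b t (ρ' x) ∈ W.carrier
        rw [h1, ← hqx]
        exact Mod.e_mem q
      refine ⟨Mod.mk (ρ' x) h2, Mod.e_mk _ _, fun hx => ?_⟩
      rw [nextSet_eq]
      refine subset_closure ⟨?_, by rwa [Mod.e_mk, hρt]⟩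
      have h3 : chartMap W ht (Mod.mk (ρ' x) h2) = q :=
        Mod.e_injective (by rw [e_chartMap, Mod.e_mk, h1, hqx])
      rwa [h3]
    filter_upwards [h.eventually_nhds, hmem.eventually_nhds, hρ'.eventually_analyticAt]
      with x h1 h2 h3
    obtain ⟨y, hyx, hy⟩ := key x h1.self_of_nhds h2.self_of_nhds
    refine ⟨y, ?_, hyx⟩
    by_cases hxt : x t = 0
    · have h4 := tendsto_add_single x t
      have h5 : Tendsto (fun τ : ℂ => ρ' (x + τ • Pi.single t 1)) (𝓝[≠] 0) (𝓝 (Mod.e y)) := by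
        rw [hyx]
        exact h3.continuousAt.tendsto.comp h4
      obtain ⟨h6, h7⟩ := Mod.tendsto_chart_symm h5
      refine isClosed_nextSet.mem_of_tendsto h6 ?_
      filter_upwards [h4.eventually h1, h4.eventually h2, self_mem_nhdsWithin, h7]
        with τ h8 h9 h10 h11
      obtain ⟨z, hzx, hz⟩ := key _ h8 h9
      have h12 : (Mod.chart _).symm (ρ' (x + τ • Pi.single t 1)) = z :=
        Mod.e_injective (by rw [h11, hzx])
      rw [h12]
      refine hz ?_
      simpa [hxt] using h10
    · exact hy hxt
  fix := by
    have h1 := (tendsto_blowChart b t).eventually hρ.eventually_fix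
    have h2 : ∀ᶠ x in 𝓝 0, ∀ y : Mod.{u} (W.next b t), Mod.e y = x → chartMap W ht y ∈ S →
        x t ≠ 0 → ρ' x = x := by
      filter_upwards [h, h1] with x h3 h4 y hyx hy hx
      have h5 := h4 _ hy (by rw [e_chartMap, hyx])
      exact blowChart_injOn (by rwa [hρt]) (h3.trans h5)
    refine eventually_nhdsWithin_iff.2 ?_
    filter_upwards [tendsto_e_origin.eventually h2.eventually_nhds,
      tendsto_e_origin.eventually hρ'.eventually_analyticAt] with q h3 h4 hq
    rw [nextSet_eq] at hq
    by_contra hne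
    have h5 : ContinuousAt (fun y : Mod.{u} (W.next b t) => ρ' (Mod.e y)) q :=
      ContinuousAt.comp (g := ρ') h4.continuousAt Mod.continuous_e.continuousAt
    have h6 := (h5.sub Mod.continuous_e.continuousAt).eventually_ne (sub_ne_zero.2 hne)
    obtain ⟨y, ⟨hy, hyt⟩, h7, h8⟩ := ((mem_closure_iff_frequently.1 hq).and_eventually
      (h6.and (Mod.continuous_e.continuousAt.eventually h3))).exists
    exact h7 (sub_eq_zero.2 (h8 y rfl hy hyt))

/-- If the centre is contained in the singular locus, then an element of the ideal of `J` is
divisible by `t ^ d` after the blowing-up, and the quotient belongs to the transform of `J`. -/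
theorem IsRetraction.exists_quotient {ρ ρ' : (Fin N → ℂ) → (Fin N → ℂ)}
    (hρ : IsRetraction t S ρ) (ht : t ∈ b) (hρ' : IsRetraction t (nextSet W ht S) ρ')
    (h : ∀ᶠ x in 𝓝 0, blowChart b t (ρ' x) = ρ (blowChart b t x)) {J : Marked N S}
    (hperm : ∀ᶠ q in 𝓝 (Mod.origin W), q ∈ Mod.subspace W b →
      q ∈ S ∧ (J.d : ℕ∞) ≤ order (J.I q))
    {F : (Fin N → ℂ) → ℂ} (hF : AnalyticAt ℂ F 0)
    (hFJ : ∀ᶠ q in 𝓝 (Mod.origin W), q ∈ Mod.subspace W b → InIdeal (J.I q) (F ∘ Mod.e)) :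
    ∃ F' : (Fin N → ℂ) → ℂ, AnalyticAt ℂ F' 0 ∧
      (∀ᶠ x in 𝓝 0, F (ρ (blowChart b t x)) = x t ^ J.d * F' x) ∧
      ∀ᶠ y in 𝓝 (Mod.origin (W.next b t)), y ∈ nextSet W ht S → Mod.e y t = 0 →
        InIdeal ((nextMarked W ht J).I y) (F' ∘ Mod.e) := by
  have h0 : Mod.origin W ∈ S :=
    (hperm.self_of_nhds fun j _ => by rw [Mod.e_origin, Pi.zero_apply]).1
  have hρ0 := hρ.apply_zero h0
  have hβ : ∀ x, AnalyticAt ℂ (blowChart b t) x := fun x => analyticAt_blowChart b t x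
  have hρβ : AnalyticAt ℂ (fun x => ρ (blowChart b t x)) 0 := by
    refine AnalyticAt.fun_comp (g := ρ) ?_ (hβ 0)
    rw [blowChart_zero]
    exact hρ.analyticAt
  have hFρβ : AnalyticAt ℂ (fun x => F (ρ (blowChart b t x))) 0 := by
    refine AnalyticAt.fun_comp (g := F) ?_ hρβ
    rwa [blowChart_zero, hρ0]
  -- the function vanishes to order `d` along the curves transverse to the exceptional divisor
  obtain ⟨F', hF', hFF'⟩ := exists_eq_coord_pow_mul (i := t) (x₀ := 0) rfl J.d hFρβ (by
    have h1 := (tendsto_blowChart b t).eventually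
      (tendsto_chart_symm_origin.{u} (W := W).eventually (hperm.and hFJ))
    have h2 := (tendsto_blowChart b t).eventually (W.isOpen.mem_nhds W.zero_mem)
    have h3 := (tendsto_blowChart b t).eventually hρ.eventually_fix
    have h4 := ((tendsto_blowChart b t).eventually hρ.mem).eventually_nhds
    filter_upwards [h1, h2, h3, h4, hρβ.eventually_analyticAt] with x ⟨h5, h5'⟩ h6 h7 h8 h9 hxt
    set Q : Mod.{u} W := (Mod.chart W).symm (blowChart b t x) with hQ
    have heQ : Mod.e Q = blowChart b t x := Mod.e_chart_symm h6
    have hQY : Q ∈ Mod.subspace W b := fun j hj => by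
      rw [heQ, blowChart_of_mem hj, hxt, zero_mul]
    obtain ⟨hQS, hord⟩ := h5 hQY
    have hfix : ρ (blowChart b t x) = Mod.e Q := (h7 Q hQS heQ).trans heQ.symm
    have hbig := isBigO_of_mem_maxIdeal_pow (φ := Mod.chart W) Mod.chart_mem_maximalAtlas
      (mem_univ Q) hQS ((h5' hQY).mono (le_order_iff.1 hord))
    have hcurve := tendsto_add_single x t
    have hlim : Tendsto (fun τ : ℂ => ρ (blowChart b t (x + τ • Pi.single t 1))) (𝓝[≠] 0)
        (𝓝 (Mod.e Q)) := by
      rw [← hfix]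
      exact h9.continuousAt.tendsto.comp hcurve
    obtain ⟨hlim1, hlim2⟩ := Mod.tendsto_chart_symm hlim
    have hlim3 : Tendsto (fun τ : ℂ => (Mod.chart W).symm
        (ρ (blowChart b t (x + τ • Pi.single t 1)))) (𝓝[≠] 0) (𝓝[S] Q) := by
      refine tendsto_nhdsWithin_iff.2 ⟨hlim1, ?_⟩
      filter_upwards [hcurve.eventually h8] with τ ⟨q, hq, hqx⟩
      rwa [← hqx, Mod.chart_symm_e]
    refine ((hbig.comp_tendsto hlim3).congr' ?_ .rfl).trans ?_
    · filter_upwards [hlim2] with τ hτ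
      simp only [Function.comp_apply, hτ]
    · have hdiff : (fun τ : ℂ => ρ (blowChart b t (x + τ • Pi.single t 1)) - Mod.e Q)
          =O[𝓝[≠] 0] fun τ => τ := by
        have h10 := h9.differentiableAt.isBigO_sub
        rw [hfix] at h10
        refine (h10.comp_tendsto hcurve).trans ?_
        refine Asymptotics.IsBigO.of_bound ‖(Pi.single t 1 : Fin N → ℂ)‖ (.of_forall fun τ => ?_)
        simp [norm_smul, mul_comm]
      refine (hdiff.norm_left.pow J.d).congr' ?_ .rfl
      filter_upwards [hlim2] with τ hτ
      simp only [Function.comp_apply, Mod.coe_chart, hτ])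
  refine ⟨F', hF', hFF', ?_⟩
  have hβe := (tendsto_blowChart b t).comp (tendsto_e_origin.{u} (W := W.next b t))
  have htend : Tendsto (chartMap W ht) (𝓝 (Mod.origin (W.next b t))) (𝓝 (Mod.origin W)) := by
    refine (tendsto_chart_symm_origin.comp hβe).congr fun y => ?_
    simp only [Function.comp_apply]
    rw [← e_chartMap (ht := ht), Mod.chart_symm_e]
  have hte := tendsto_e_origin.{u} (W := W.next b t)
  have hfix : ∀ᶠ y in 𝓝 (Mod.origin.{u} (W.next b t)), y ∈ nextSet W ht S →
      ρ' (Mod.e y) = Mod.e y := eventually_nhdsWithin_iff.1 hρ'.fix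
  filter_upwards [htend.eventually hFJ, hte.eventually hρ'.analyticAt.eventually_analyticAt,
    hfix.eventually_nhds, hte.eventually hρ'.mem.eventually_nhds,
    hte.eventually hF'.eventually_analyticAt, hte.eventually (hFF'.and h).eventually_nhds]
    with y h1 h2 h3 h4 h5 h6 hyS hyt
  refine inIdeal_nextMarked hyt h2 (h3.self_of_nhds hyS) (.of_forall hρ'.apply_coord) h4
    (eventually_nhdsWithin_iff.2 h3) (h1 (chartMap_mem_subspace hyt)) h5 ?_
  refine eventually_nhdsWithin_iff.2 ?_
  filter_upwards [Mod.continuous_e.continuousAt.eventually h6, h3] with q ⟨h7, h8⟩ h9 hq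
  rw [← h7, ← h8, h9 hq]

end Retraction

/-! ### Necessity: the whole test system -/

section Necessity

variable {N : ℕ} {c : Finset (Fin N)} {t : Fin N}

theorem blowChart_eq_killCoords {b : Finset (Fin N)} {y : Fin N → ℂ}
    (hy : y t = 0) : blowChart b t y = killCoords b y := by
  ext j
  rw [killCoords_apply]
  split_ifs with hj
  · rw [blowChart_of_mem hj, hy, zero_mul]
  · exact blowChart_of_notMem hj y

/-- The blowings-up along the divisor: if `r + 1` of them are permissible, then the elements of the
ideal are of the order of growth of `t ^ (r * d)` on `S`. By hypothesis, `ρ` maps the exceptional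
divisor into the centre as soon as the centre is contained in `S`. The last blowing-up is only used
to know that the transform of `S` by the previous ones passes through the origin. -/
theorem exists_bound_of_divisor_steps (htc : t ∉ c) (r : ℕ) : ∀ (W : OpenNhd N)
    (a : Finset (Fin N)) (S : Set (Mod.{u} W)) (ρ : (Fin N → ℂ) → (Fin N → ℂ))
    (_ : IsRetraction t S ρ)
    (_ : (∀ᶠ q in 𝓝 (Mod.origin W), q ∈ Mod.subspace W (insert t c) → q ∈ S) →
      ∀ᶠ x in 𝓝 0, x t = 0 → ∀ j ∈ c, ρ x j = 0)
    (L : List (Marked N S)) (J : Marked N S) (_ : J ∈ L) (F : (Fin N → ℂ) → ℂ)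
    (_ : AnalyticAt ℂ F 0)
    (_ : ∀ᶠ q in 𝓝 (Mod.origin W), q ∈ S → Mod.e q t = 0 → InIdeal (J.I q) (F ∘ Mod.e))
    (_ : (chain t (centers t c 0 (r + 1)) W a).ImmersedPermissible S L),
    ∃ C, ∀ᶠ x in 𝓝 0, x t ≠ 0 → ‖F (ρ x)‖ ≤ C * ‖x t‖ ^ (r * J.d) := by
  induction r with
  | zero =>
    intro W a S ρ hρ _ L J _ F hF _ hperm
    rw [centers_zero_succ, chain_cons_permissible] at hperm
    have h0 : Mod.origin W ∈ S :=
      (hperm.1.self_of_nhds fun j _ => by rw [Mod.e_origin, Pi.zero_apply]).1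
    have h1 : ContinuousAt (fun x => ‖F (ρ x)‖) 0 := by
      refine ContinuousAt.norm (ContinuousAt.comp (g := F) ?_ hρ.analyticAt.continuousAt)
      rw [hρ.apply_zero h0]
      exact hF.continuousAt
    refine ⟨‖F (ρ 0)‖ + 1, ?_⟩
    filter_upwards [h1.eventually (gt_mem_nhds (lt_add_one _))] with x hx _
    simpa using hx.le
  | succ r ih =>
    intro W a S ρ hρ hP L J hJ F hF hFJ hperm
    rw [centers_zero_succ, chain_cons_permissible] at hperm
    obtain ⟨hperm1, hperm2⟩ := hperm
    set b : Finset (Fin N) := insert t c with hb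
    have ht : t ∈ b := Finset.mem_insert_self t c
    have h0 : Mod.origin W ∈ S :=
      (hperm1.self_of_nhds fun j _ => by rw [Mod.e_origin, Pi.zero_apply]).1
    have hρ0 := hρ.apply_zero h0
    have hY := hP (hperm1.mono fun q hq h => (hq h).1)
    have hk : ∀ j, ∃ k : (Fin N → ℂ) → ℂ, AnalyticAt ℂ k 0 ∧
        (j ∈ c → ∀ᶠ x in 𝓝 0, ρ x j = x t * k x) := by
      intro j
      by_cases hj : j ∈ c
      · obtain ⟨k, h1, h2⟩ := exists_eq_coord_mul (Φ := fun x => ρ x j) (x₀ := 0) (i := t)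
          (analyticAt_pi_iff.1 hρ.analyticAt j) rfl (hY.mono fun x hx hxt => hx hxt j hj)
        exact ⟨k, h1, fun _ => h2⟩
      · exact ⟨0, analyticAt_const, fun h => absurd h hj⟩
    choose k hk1 hk2 using hk
    -- the lift of `ρ` to the affine chart, on the complement of the divisor
    let Λ : (Fin N → ℂ) → (Fin N → ℂ) := fun x j =>
      if j = t then x t else if j ∈ c then k j x else ρ x j
    have hΛt : ∀ x, Λ x t = x t := fun x => if_pos rfl
    have hΛ : AnalyticAt ℂ Λ 0 := by
      refine analyticAt_pi_iff.2 fun j => ?_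
      by_cases hjt : j = t
      · simpa only [Λ, if_pos hjt] using analyticAt_coord t 0
      · by_cases hj : j ∈ c
        · simpa only [Λ, if_neg hjt, if_pos hj] using hk1 j
        · simpa only [Λ, if_neg hjt, if_neg hj] using analyticAt_pi_iff.1 hρ.analyticAt j
    have hβΛ : ∀ᶠ x in 𝓝 0, blowChart b t (Λ x) = ρ x := by
      have h1 : ∀ᶠ x in 𝓝 0, ∀ j ∈ c, ρ x j = x t * k j x :=
        (Filter.eventually_all_finset c).2 hk2
      filter_upwards [h1] with x hx
      ext j
      by_cases hjt : j = t
      · subst hjt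
        rw [blowChart_self, hΛt, hρ.apply_coord]
      · by_cases hj : j ∈ c
        · simp [blowChart, hb, hj, hjt, Λ, hx j hj]
        · simp [blowChart, hb, hj, hjt, Λ]
    have hρ'a : AnalyticAt ℂ (fun y => Λ (blowChart b t y)) 0 := by
      refine AnalyticAt.fun_comp (g := Λ) ?_ (analyticAt_blowChart b t 0)
      rwa [blowChart_zero]
    have hρ't : ∀ y, Λ (blowChart b t y) t = y t := fun y => by rw [hΛt, blowChart_self]
    have hβρ := (tendsto_blowChart b t).eventually hβΛ
    have hρ' := hρ.next ht hρ'a hρ't hβρ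
    obtain ⟨F', hF', hFF', hFJ'⟩ := hρ.exists_quotient (J := J) ht hρ' hβρ
      (hperm1.mono fun q hq h => ⟨(hq h).1, (hq h).2 J hJ⟩) hF (by
        filter_upwards [hFJ, hperm1] with q h1 h2 h3
        exact h1 (h2 h3).1 (h3 t ht))
    obtain ⟨C, hC⟩ := ih _ _ _ _ hρ' (by
      intro hYS
      have hkill : Tendsto (killCoords b) (𝓝 0) (𝓝 0) := by
        simpa using (killCoords b).continuous.tendsto 0
      filter_upwards [hkill.eventually hρ'.eventually_fix,
        (tendsto_chart_symm_origin.comp hkill).eventually hYS,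
        hkill.eventually ((W.next b t).isOpen.mem_nhds (W.next b t).zero_mem)]
        with x h1 h2 h3 hxt j hj
      have h4 : killCoords b (killCoords b x) = killCoords b x :=
        killCoords_eq_self fun j hj => by rw [killCoords_apply, if_pos hj]
      have h5 : blowChart b t (killCoords b x) = killCoords b x := by
        rw [blowChart_eq_killCoords, h4]
        rw [killCoords_apply, if_pos ht]
      have h6 := Mod.e_chart_symm.{u} (W := W.next b t) h3
      have h7 := h1 _ (h2 fun i hi => by
        rw [Function.comp_apply, h6, killCoords_apply, if_pos hi]) h6
      rw [h5] at h7
      rw [blowChart_eq_killCoords hxt, h7, killCoords_apply,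
        if_pos (Finset.mem_insert_of_mem hj)]) _ _ (List.mem_map_of_mem hJ) F' hF' hFJ' hperm2
    have h0' : Mod.origin (W.next b t) ∈ nextSet W ht S := by
      rw [centers_zero_succ, chain_cons_permissible] at hperm2
      exact (hperm2.1.self_of_nhds fun j _ => by rw [Mod.e_origin, Pi.zero_apply]).1
    have hΛ0 : Λ 0 = 0 := by
      have := hρ'.apply_zero h0'
      rwa [blowChart_zero] at this
    have hΛlim : Tendsto Λ (𝓝 0) (𝓝 0) := by
      simpa [ContinuousAt, hΛ0] using hΛ.continuousAt
    refine ⟨C, ?_⟩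
    filter_upwards [hρ.idempotent hρ0, hβΛ, hΛlim.eventually hFF', hΛlim.eventually hβρ,
      hΛlim.eventually hC] with x h1 h2 h3 h4 h5 hxt
    have h6 : Λ (blowChart b t (Λ x)) = Λ x := by
      refine blowChart_injOn (b := b) (t := t) (by rwa [hρ't, hΛt]) ?_
      rw [h4, h2, h1]
    rw [h6, hΛt] at h5
    rw [h2, h1, hΛt] at h3
    rw [h3, norm_mul, norm_pow]
    calc ‖x t‖ ^ J.d * ‖F' (Λ x)‖ ≤ ‖x t‖ ^ J.d * (C * ‖x t‖ ^ (r * J.d)) := by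
          gcongr
          exact h5 hxt
      _ = C * ‖x t‖ ^ ((r + 1) * J.d) := by ring

/-- The map `x ↦ H x x' + x t • e_t`, where `x'` is `x` with the coordinate `t` replaced by `0`. The
blowing-up of the origin lifts it to the map of the same form with `H` replaced by its inverse
image, which is constant on the exceptional divisor. -/
noncomputable def pointRetraction (t : Fin N) (H : (Fin N → ℂ) → ((Fin N → ℂ) →L[ℂ] (Fin N → ℂ)))
    (x : Fin N → ℂ) : Fin N → ℂ :=
  H x (killCoords {t} x) + x t • Pi.single t 1

theorem analyticAt_pointRetraction {H : (Fin N → ℂ) → ((Fin N → ℂ) →L[ℂ] (Fin N → ℂ))}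
    (hH : AnalyticAt ℂ H 0) : AnalyticAt ℂ (pointRetraction t H) 0 :=
  (hH.clm_apply ((killCoords {t}).analyticAt 0)).add
    ((analyticAt_coord t 0).smul analyticAt_const)

theorem pointRetraction_apply_coord {H : (Fin N → ℂ) → ((Fin N → ℂ) →L[ℂ] (Fin N → ℂ))}
    (hH : ∀ x v, H x v t = 0) (x : Fin N → ℂ) : pointRetraction t H x t = x t := by
  simp [pointRetraction, hH]

theorem blowChart_pointRetraction {H : (Fin N → ℂ) → ((Fin N → ℂ) →L[ℂ] (Fin N → ℂ))}
    (hH : ∀ x v, H x v t = 0) (y : Fin N → ℂ) :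
    blowChart Finset.univ t (pointRetraction t (fun y => H (blowChart Finset.univ t y)) y) =
      pointRetraction t H (blowChart Finset.univ t y) := by
  ext j
  by_cases hj : j = t
  · subst hj
    rw [blowChart_self, pointRetraction_apply_coord fun x v => hH _ v,
      pointRetraction_apply_coord hH, blowChart_self]
  · rw [blowChart_of_mem (Finset.mem_univ j)]
    simp [blowVec, pointRetraction, killCoords_blowChart_univ, hj, hH]

/-- If the linear map `A` is the identity on the coordinate subspace `x j = 0`, `j ∈ b`, and has no
larger rank than this subspace, then its values belong to the subspace. -/
theorem apply_eq_zero_of_finrank_range_le {A : (Fin N → ℂ) →L[ℂ] (Fin N → ℂ)}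
    {b : Finset (Fin N)} (hA : ∀ v : Fin N → ℂ, (∀ j ∈ b, v j = 0) → A v = v)
    (hrank : Module.finrank ℂ (LinearMap.range (A : (Fin N → ℂ) →ₗ[ℂ] (Fin N → ℂ))) + b.card ≤ N)
    (v : Fin N → ℂ) {j : Fin N} (hj : j ∈ b) : A v j = 0 := by
  let R : (Fin N → ℂ) →ₗ[ℂ] (b → ℂ) := LinearMap.funLeft ℂ ℂ (fun i : b => (i : Fin N))
  have hle : LinearMap.ker R ≤ LinearMap.range (A : (Fin N → ℂ) →ₗ[ℂ] (Fin N → ℂ)) := by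
    intro w hw
    refine ⟨w, hA w fun i hi => ?_⟩
    exact congrFun (LinearMap.mem_ker.1 hw) ⟨i, hi⟩
  have h1 := R.finrank_range_add_finrank_ker
  have h2 : Module.finrank ℂ (LinearMap.range R) ≤ b.card := by
    simpa using Submodule.finrank_le (LinearMap.range R)
  rw [Module.finrank_fin_fun] at h1
  have h3 := Submodule.eq_of_le_of_finrank_le hle (by omega)
  have h4 : A v ∈ LinearMap.ker R := h3 ▸ ⟨v, rfl⟩
  exact congrFun (LinearMap.mem_ker.1 h4) ⟨j, hj⟩

/-- If the test system is permissible, then the elements of the ideal have a high order of growth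
along the curves `τ ↦ ρ (τ ^ s x', τ)`. The subtraction `r - 1` is truncated: without blowings-up
along the divisor the order is `s * d`. -/
theorem isBigO_curve_of_permissible (htc : t ∉ c) (r s : ℕ) : ∀ (W : OpenNhd N)
    (a : Finset (Fin N)) (S : Set (Mod.{u} W))
    (H : (Fin N → ℂ) → ((Fin N → ℂ) →L[ℂ] (Fin N → ℂ))) (_ : AnalyticAt ℂ H 0)
    (_ : ∀ x v, H x v t = 0)
    (_ : Module.finrank ℂ (LinearMap.range (H 0 : (Fin N → ℂ) →ₗ[ℂ] (Fin N → ℂ))) +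
      (insert t c).card ≤ N)
    (_ : s = 0 → ∀ x, x t = 0 → H x = H 0)
    (_ : IsRetraction t S (pointRetraction t H))
    (L : List (Marked N S)) (J : Marked N S) (_ : J ∈ L) (F : (Fin N → ℂ) → ℂ)
    (_ : AnalyticAt ℂ F 0)
    (_ : ∀ᶠ q in 𝓝 (Mod.origin W), q ∈ S → Mod.e q t = 0 → (0 < s → q = Mod.origin W) →
      InIdeal (J.I q) (F ∘ Mod.e))
    (_ : (chain t (centers t c s r) W a).ImmersedPermissible S L),
    ∀ᶠ x in 𝓝 0, (fun τ : ℂ => F (pointRetraction t H (τ ^ s • killCoords {t} x +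
      τ • Pi.single t 1))) =O[𝓝[≠] 0] fun τ => τ ^ ((s + (r - 1)) * J.d) := by
  induction s with
  | zero =>
    intro W a S H hH hHt hrank hH0 hρ L J hJ F hF hFJ hperm
    obtain ⟨C, hC⟩ : ∃ C, ∀ᶠ x in 𝓝 0, x t ≠ 0 →
        ‖F (pointRetraction t H x)‖ ≤ C * ‖x t‖ ^ ((r - 1) * J.d) := by
      rcases r with - | r
      · have h0 : pointRetraction t H 0 = 0 := by simp [pointRetraction]
        have h1 : ContinuousAt (fun x => ‖F (pointRetraction t H x)‖) 0 := by
          refine ContinuousAt.norm (ContinuousAt.comp (g := F) ?_ hρ.analyticAt.continuousAt)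
          rw [h0]
          exact hF.continuousAt
        refine ⟨‖F (pointRetraction t H 0)‖ + 1, ?_⟩
        filter_upwards [h1.eventually (gt_mem_nhds (lt_add_one _))] with x hx _
        simpa using hx.le
      refine exists_bound_of_divisor_steps htc r W a S _ hρ (by
        intro hYS
        refine .of_forall fun x hxt j hj => ?_
        have hjt : j ≠ t := fun h => htc (h ▸ hj)
        simp only [pointRetraction, hxt, zero_smul, add_zero, hH0 rfl x hxt]
        refine apply_eq_zero_of_finrank_range_le (b := insert t c) (fun v hv => ?_) hrank _
          (Finset.mem_insert_of_mem hj)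
        have hlim : Tendsto (fun ε : ℂ => ε • v) (𝓝[≠] 0) (𝓝 0) := by
          have : ContinuousAt (fun ε : ℂ => ε • v) 0 := by fun_prop
          simpa [ContinuousAt] using this.tendsto.mono_left nhdsWithin_le_nhds
        obtain ⟨ε, h1, h2, h3, h4⟩ := ((hlim.eventually hρ.eventually_fix).and
          (((tendsto_chart_symm_origin.comp hlim).eventually hYS).and
          ((hlim.eventually (W.isOpen.mem_nhds W.zero_mem)).and self_mem_nhdsWithin))).exists
        have h5 := Mod.e_chart_symm.{u} h3
        have h6 : ∀ i ∈ insert t c, (ε • v) i = 0 := fun i hi => by simp [hv i hi]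
        have h7 := h1 _ (h2 fun i hi => by
          rw [Function.comp_apply, h5]
          exact h6 i hi) h5
        have h8 : (ε • v) t = 0 := h6 t (Finset.mem_insert_self t c)
        rw [pointRetraction, h8, zero_smul, add_zero, hH0 rfl _ h8,
          killCoords_eq_self (by simpa using h8), map_smul] at h7
        exact smul_right_injective _ h4 h7) L J hJ F hF (by
          filter_upwards [hFJ] with q hq h1 h2
          exact hq h1 h2 (by simp)) hperm
    have hlim : Tendsto (killCoords ({t} : Finset (Fin N))) (𝓝 0) (𝓝 0) := by
      simpa using (killCoords ({t} : Finset (Fin N))).continuous.tendsto 0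
    filter_upwards [hlim.eventually hC.eventually_nhds] with x hx
    refine Asymptotics.IsBigO.of_bound C ?_
    filter_upwards [(tendsto_add_single (killCoords {t} x) t).eventually hx, self_mem_nhdsWithin]
      with τ h1 h2
    have h3 : (killCoords {t} x + τ • (Pi.single t 1 : Fin N → ℂ)) t = τ := by
      simp [killCoords_apply]
    rw [h3] at h1
    simpa using h1 h2
  | succ s ih =>
    intro W a S H hH hHt hrank _ hρ L J hJ F hF hFJ hperm
    rw [centers_succ_left, chain_cons_permissible] at hperm
    obtain ⟨hperm1, hperm2⟩ := hperm
    have ht : t ∈ (Finset.univ : Finset (Fin N)) := Finset.mem_univ t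
    have hH' : AnalyticAt ℂ (fun y => H (blowChart Finset.univ t y)) 0 := by
      refine AnalyticAt.fun_comp (g := H) ?_ (analyticAt_blowChart _ t 0)
      rwa [blowChart_zero]
    have hH't : ∀ x v, H (blowChart Finset.univ t x) v t = 0 := fun x v => hHt _ v
    have hβρ := blowChart_pointRetraction hHt
    have hρ' := hρ.next ht (analyticAt_pointRetraction hH') (pointRetraction_apply_coord hH't)
      (.of_forall hβρ)
    obtain ⟨F', hF', hFF', hFJ'⟩ := hρ.exists_quotient (J := J) ht hρ' (.of_forall hβρ)
      (hperm1.mono fun q hq h => ⟨(hq h).1, (hq h).2 J hJ⟩) hF (by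
        filter_upwards [hFJ, hperm1] with q h1 h2 h3
        refine h1 (h2 h3).1 (h3 t ht) fun _ => Mod.e_injective (funext fun j => ?_)
        rw [h3 j (Finset.mem_univ j), Mod.e_origin, Pi.zero_apply])
    have hbc : blowChart Finset.univ t (0 : Fin N → ℂ) = 0 := blowChart_zero _ _
    have hcurve := ih _ _ _ _ hH' hH't (by rwa [hbc]) (fun _ x hx => by
      rw [hbc, blowChart_eq_killCoords hx]
      congr 1
      ext j
      rw [killCoords_apply, if_pos (Finset.mem_univ j), Pi.zero_apply]) hρ' _ _
      (List.mem_map_of_mem hJ) F' hF' (hFJ'.mono fun q hq h1 h2 _ => hq h1 h2) hperm2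
    have hρ'0 : pointRetraction t (fun y => H (blowChart Finset.univ t y)) 0 = 0 := by
      simp [pointRetraction]
    have hρ'lim : Tendsto (pointRetraction t fun y => H (blowChart Finset.univ t y))
        (𝓝 0) (𝓝 0) := by
      simpa [ContinuousAt, hρ'0] using hρ'.analyticAt.continuousAt
    have hlim : Tendsto (killCoords ({t} : Finset (Fin N))) (𝓝 0) (𝓝 0) := by
      simpa using (killCoords ({t} : Finset (Fin N))).continuous.tendsto 0
    have hkey : ∀ᶠ y in 𝓝 0, F (pointRetraction t H (blowChart Finset.univ t y)) =
        y t ^ J.d * F' (pointRetraction t (fun y => H (blowChart Finset.univ t y)) y) := by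
      filter_upwards [hρ'lim.eventually hFF', hρ'.idempotent hρ'0] with y h1 h2
      rw [← hβρ, h2, hβρ, hρ'.apply_coord] at h1
      exact h1
    have hlim' : Tendsto (fun x => (0 : ℂ) ^ s • killCoords {t} x) (𝓝 0) (𝓝 0) := by
      simpa using hlim.const_smul ((0 : ℂ) ^ s)
    filter_upwards [hcurve, hlim'.eventually hkey.eventually_nhds] with x h1 h2
    set y : ℂ → Fin N → ℂ := fun τ => τ ^ s • killCoords {t} x + τ • Pi.single t 1 with hy
    have hylim : Tendsto y (𝓝[≠] 0) (𝓝 ((0 : ℂ) ^ s • killCoords {t} x)) := by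
      have : ContinuousAt y 0 := by fun_prop
      simpa [ContinuousAt, hy] using this.tendsto.mono_left nhdsWithin_le_nhds
    have hyt : ∀ τ, y τ t = τ := fun τ => by simp [hy, killCoords_apply]
    have hβy : ∀ τ, blowChart Finset.univ t (y τ) =
        τ ^ (s + 1) • killCoords {t} x + τ • Pi.single t 1 := by
      intro τ
      ext j
      by_cases hj : j = t
      · subst hj
        rw [blowChart_self, hyt]
        simp [killCoords_apply]
      · simp only [blowChart, Finset.mem_univ, true_and, if_pos (show j ≠ t from hj), hyt]
        simp [hy, hj]
        ring
    refine (((Asymptotics.isBigO_refl (fun τ : ℂ => τ ^ J.d) (𝓝[≠] 0)).mul h1).congr' ?_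
      (.of_forall fun τ => ?_))
    · filter_upwards [hylim.eventually h2] with τ h3
      rw [← hβy, h3, hyt]
    · have hd : (nextMarked W ht J).d = J.d := rfl
      simp only [hd]
      ring

end Necessity

/-! ### Retractions onto submanifolds -/

section SubmanifoldRetraction

variable {n : ℕ} {M : Type u} [TopologicalSpace M] [ChartedSpace (Fin n → ℂ) M]

theorem finrank_range_killCoords (b : Finset (Fin n)) :
    Module.finrank ℂ (LinearMap.range (killCoords b : (Fin n → ℂ) →ₗ[ℂ] (Fin n → ℂ))) + b.card
      ≤ n := by
  have h1 : (killCoords b : (Fin n → ℂ) →ₗ[ℂ] (Fin n → ℂ)) =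
      (Matrix.diagonal fun j => if j ∈ b then (0 : ℂ) else 1).mulVecLin := by
    ext x j
    simp [killCoords_apply, Matrix.mulVec_diagonal]
  have h2 := Matrix.rank_diagonal fun j : Fin n => if j ∈ b then (0 : ℂ) else 1
  rw [Matrix.rank, ← h1] at h2
  rw [h2, Fintype.card_subtype]
  have h3 : (Finset.univ.filter fun j : Fin n => (if j ∈ b then (0 : ℂ) else 1) ≠ 0) = bᶜ := by
    ext j
    simp
  rw [h3, Finset.card_compl, Fintype.card_fin]
  have := b.card_le_univ
  rw [Fintype.card_fin] at this
  omega

theorem finrank_range_comp_killCoords_le {E F : Type*} [NormedAddCommGroup E] [NormedSpace ℂ E]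
    [NormedAddCommGroup F] [NormedSpace ℂ F] (A : (Fin n → ℂ) →L[ℂ] E) (b : Finset (Fin n))
    (B : F →L[ℂ] (Fin n → ℂ)) :
    Module.finrank ℂ (LinearMap.range (A.comp ((killCoords b).comp B) : F →ₗ[ℂ] E)) + b.card
      ≤ n := by
  refine le_trans (Nat.add_le_add_right ?_ _) (finrank_range_killCoords b)
  have h1 : LinearMap.range (A.comp ((killCoords b).comp B) : F →ₗ[ℂ] E) ≤
      (LinearMap.range (killCoords b : (Fin n → ℂ) →ₗ[ℂ] (Fin n → ℂ))).map
        (A : (Fin n → ℂ) →ₗ[ℂ] E) := by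
    rintro _ ⟨v, rfl⟩
    exact ⟨_, ⟨B v, rfl⟩, rfl⟩
  exact (Submodule.finrank_mono h1).trans (Submodule.finrank_map_le _ _)

theorem analyticAt_transition {φ ψ : OpenPartialHomeomorph M (Fin n → ℂ)} {P : M}
    (hφ : IsCoordAt φ P) (hψ : IsCoordAt ψ P) : AnalyticAt ℂ (fun x => ψ (φ.symm x)) 0 := by
  refine analyticAt_pi_iff.2 fun i => ?_
  rw [← hφ.2.2]
  exact analyticAt_comp_symm hφ.1 hφ.2.1 (f := (fun x : Fin n → ℂ => x i) ∘ ψ)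
    (contMDiffAt_comp_chart hψ.1 hψ.2.1 (analyticAt_coord i _))

/-- Hadamard's lemma for a map that fixes the origin. -/
theorem exists_eq_clm_apply {X : (Fin n → ℂ) → (Fin n → ℂ)} (hX : AnalyticAt ℂ X 0)
    (h0 : X 0 = 0) : ∃ G : (Fin n → ℂ) → ((Fin n → ℂ) →L[ℂ] (Fin n → ℂ)), AnalyticAt ℂ G 0 ∧
      ∀ᶠ x in 𝓝 0, X x = G x x := by
  obtain ⟨p, hp⟩ := hX
  obtain ⟨G, hG, hXG⟩ := hp.exists_hadamard
  exact ⟨G, hG.analyticAt, by simpa [h0] using hXG⟩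

/-- In arbitrary coordinates `φ`, a submanifold `S` has a local retraction of the form
`x ↦ H x x`, where the rank of the linear map `H 0` is at most the dimension of `S`. -/
theorem exists_retraction {φ ψ : OpenPartialHomeomorph M (Fin n → ℂ)} {P : M}
    (hφ : IsCoordAt φ P) (hψ : IsCoordAt ψ P) {b : Finset (Fin n)} {S : Set M}
    (hS : IsCoordSubspace ψ b S) :
    ∃ H : (Fin n → ℂ) → ((Fin n → ℂ) →L[ℂ] (Fin n → ℂ)), AnalyticAt ℂ H 0 ∧
      Module.finrank ℂ (LinearMap.range (H 0 : (Fin n → ℂ) →ₗ[ℂ] (Fin n → ℂ))) + b.card ≤ n ∧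
      (∀ᶠ x in 𝓝 0, ∃ q ∈ S, q ∈ φ.source ∧ φ q = H x x) ∧
      ∀ᶠ q in 𝓝[S] P, H (φ q) (φ q) = φ q := by
  -- in the coordinates `φ`, the retraction is the linear projection in the coordinates `ψ`
  have hX := analyticAt_transition hφ hψ
  have hX' := analyticAt_transition hψ hφ
  have hφP : φ.symm 0 = P := by rw [← hφ.2.2, φ.left_inv hφ.2.1]
  have hψP : ψ.symm 0 = P := by rw [← hψ.2.2, ψ.left_inv hψ.2.1]
  obtain ⟨G, hG, hXG⟩ := exists_eq_clm_apply hX (by rw [hφP, hψ.2.2])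
  obtain ⟨G', hG', hXG'⟩ := exists_eq_clm_apply hX' (by rw [hψP, hφ.2.2])
  have hK : AnalyticAt ℂ (fun x => killCoords b (ψ (φ.symm x))) 0 :=
    AnalyticAt.fun_comp (g := killCoords b) ((killCoords b).analyticAt _) hX
  have hK0 : killCoords b (ψ (φ.symm 0)) = 0 := by rw [hφP, hψ.2.2, map_zero]
  have hKlim : Tendsto (fun x => killCoords b (ψ (φ.symm x))) (𝓝 0) (𝓝 0) := by
    simpa [ContinuousAt, hK0] using hK.continuousAt
  have hψlim : Tendsto ψ.symm (𝓝 0) (𝓝 P) := by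
    have := ψ.continuousAt_symm (ψ.map_source hψ.2.1)
    rwa [ContinuousAt, hψ.2.2, hψP] at this
  have hφlim : Tendsto φ (𝓝 P) (𝓝 0) := by
    have := φ.continuousAt hφ.2.1
    rwa [ContinuousAt, hφ.2.2] at this
  have hψt : ∀ᶠ y in 𝓝 0, y ∈ ψ.target := by
    have := ψ.open_target.mem_nhds (ψ.map_source hψ.2.1)
    rwa [hψ.2.2] at this
  have hH : ∀ᶠ x in 𝓝 0, (G' (killCoords b (ψ (φ.symm x)))).comp ((killCoords b).comp (G x)) x =
      φ (ψ.symm (killCoords b (ψ (φ.symm x)))) := by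
    filter_upwards [hXG, hKlim.eventually hXG'] with x h1 h2
    rw [h2]
    simp [h1]
  refine ⟨fun x => (G' (killCoords b (ψ (φ.symm x)))).comp ((killCoords b).comp (G x)), ?_, ?_,
    ?_, ?_⟩
  · refine AnalyticAt.clm_comp ?_ (analyticAt_const.clm_comp hG)
    refine AnalyticAt.fun_comp (g := G') ?_ hK
    rwa [hK0]
  · exact finrank_range_comp_killCoords_le _ _ _
  · filter_upwards [hH, hKlim.eventually hψt,
      hKlim.eventually (hψlim.eventually (φ.open_source.mem_nhds hφ.2.1))] with x h1 h2 h3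
    refine ⟨ψ.symm (killCoords b (ψ (φ.symm x))), ?_, h3, h1.symm⟩
    refine (hS _ (ψ.map_target h2)).2 fun i hi => ?_
    rw [ψ.right_inv h2, killCoords_apply, if_pos hi]
  · refine eventually_nhdsWithin_iff.2 ?_
    filter_upwards [hφlim.eventually hH, φ.open_source.mem_nhds hφ.2.1,
      ψ.open_source.mem_nhds hψ.2.1] with q h1 h2 h3 hq
    rw [h1, φ.left_inv h2, killCoords_eq_self ((hS q h3).1 hq), ψ.left_inv h3]

end SubmanifoldRetraction

/-! ### The test systems of a coordinate system -/

section TestSystems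

variable {n : ℕ} {A : Ambient.{u} n} {φ : OpenPartialHomeomorph A.M (Fin n → ℂ)} {P : A.M}
  {a c : Finset (Fin n)}

/-- The test system that multiplies by a line, and then blows up `s` times the origin and `r` times
the intersection of the subspace with the equations in `c` and the exceptional divisor. -/
noncomputable def testSystem (hP : P ∈ A.K) (hφ : IsCoordAt φ P) (ha : IsHyperplanes φ a A.E)
    (c : Finset (Fin n)) (s r : ℕ) : TestSystem A :=
  .proj (m := 1) (cylinderProj hφ) _ (isOpenProjection_cylinderProj hP hφ ha)
    (chain (Fin.last n) (centers (Fin.last n) (c.map Fin.castSuccEmb) s r) (cylinder hφ)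
      (a.map Fin.castSuccEmb))

theorem last_notMem_map (c : Finset (Fin n)) : Fin.last n ∉ c.map Fin.castSuccEmb := by
  simp only [Finset.mem_map, Fin.castSuccEmb_apply, not_exists, not_and]
  exact fun i _ => i.castSucc_ne_last

theorem cylinderProj_preimage (hφ : IsCoordAt φ P) {S : Set A.M} (hc : IsCoordSubspace φ c S) :
    cylinderProj.{u} hφ ⁻¹' S = Mod.subspace (cylinder hφ) (c.map Fin.castSuccEmb) := by
  ext x
  rw [mem_preimage, hc _ (cylinderProj_mem_source hφ x), chart_cylinderProj]
  simp [Mod.subspace, Fin.init]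

theorem norm_init_le (x : Fin (n + 1) → ℂ) :
    ‖(Fin.init x : Fin n → ℂ)‖ ≤ ‖killCoords {Fin.last n} x‖ := by
  refine (pi_norm_le_iff_of_nonneg (norm_nonneg _)).2 fun i => ?_
  have h1 := norm_le_pi_norm (killCoords {Fin.last n} x) i.castSucc
  rw [killCoords_apply, if_neg (by simp)] at h1
  exact h1

/-- Sufficiency: the test system of coordinates adapted to `S` is permissible if the multiplicities
at `P` are large enough. -/
theorem testSystem_permissible (hP : P ∈ A.K) (hφ : IsCoordAt φ P) (ha : IsHyperplanes φ a A.E)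
    {S : Set A.M} (hc : IsCoordSubspace φ c S) (hPS : P ∈ S) {L : List (Marked n S)} (s r : ℕ)
    (hL : ∀ J ∈ L, ∃ ν : ℕ, (ν : ℕ∞) ≤ order (J.I P) ∧ J.d ≤ ν ∧
      r * J.d ≤ (s + 1) * (ν - J.d)) :
    (testSystem hP hφ ha c (s + 1) r).ImmersedPermissible S L := by
  change (chain _ _ _ _).ImmersedPermissible (cylinderProj.{u} hφ ⁻¹' S) _
  refine permissible_of_hasEstimate (last_notMem_map c) r s _ _ _ (cylinderProj_preimage hφ hc) _ ?_
  intro J' hJ'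
  obtain ⟨J, hJ, rfl⟩ := List.mem_map.1 hJ'
  obtain ⟨ν, hν, h1, h2⟩ := hL J hJ
  refine ⟨0, ν, h1, by rw [zero_add]; exact h2, fun f hf => ?_⟩
  have h3 : ∀ R, R = P → ∀ f, InIdeal (J.I R) f →
      (fun q => (1 : ℂ) * f q) =O[𝓝[S] R] fun q => ‖φ q‖ ^ ν := by
    rintro _ rfl f hf
    have := isBigO_of_mem_maxIdeal_pow hφ.1 hφ.2.1 hPS (hf.mono (le_order_iff.1 hν))
    simpa [hφ.2.2] using this
  have h4 : Tendsto (cylinderProj.{u} hφ) (𝓝[cylinderProj.{u} hφ ⁻¹' S] (Mod.origin _))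
      (𝓝[S] (cylinderProj.{u} hφ (Mod.origin _))) :=
    (contMDiff_cylinderProj hφ).continuous.continuousWithinAt.tendsto_nhdsWithin fun _ h => h
  have h5 := isBigO_pullback h4 (h3 _ (cylinderProj_origin hφ)) hf
  simp only [one_mul] at h5
  refine h5.trans (Asymptotics.IsBigO.of_bound 1 (.of_forall fun q => ?_))
  simp only [chart_cylinderProj, norm_pow, norm_norm, one_mul, pow_zero]
  exact pow_le_pow_left₀ (norm_nonneg _) (norm_init_le _) _

/-- The inclusion of `ℂⁿ` in `ℂⁿ⁺¹` as the hyperplane where the last coordinate vanishes. -/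
noncomputable def snocZero (n : ℕ) : (Fin n → ℂ) →L[ℂ] (Fin (n + 1) → ℂ) :=
  ContinuousLinearMap.pi fun i =>
    Fin.lastCases (motive := fun _ => (Fin n → ℂ) →L[ℂ] ℂ) 0 (fun j => .proj j) i

theorem snocZero_last (x : Fin n → ℂ) : snocZero n x (Fin.last n) = 0 := by
  simp [snocZero]

theorem init_snocZero (x : Fin n → ℂ) : (Fin.init (snocZero n x) : Fin n → ℂ) = x := by
  ext j
  simp [snocZero, Fin.init]

/-- The projection `ℂⁿ⁺¹ → ℂⁿ` to the coordinates other than the last one. -/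
noncomputable def initCLM (n : ℕ) : (Fin (n + 1) → ℂ) →L[ℂ] (Fin n → ℂ) :=
  ContinuousLinearMap.pi fun i => .proj i.castSucc

theorem initCLM_apply (x : Fin (n + 1) → ℂ) : initCLM n x = Fin.init x := rfl

theorem init_killCoords (x : Fin (n + 1) → ℂ) :
    (Fin.init (killCoords {Fin.last n} x) : Fin n → ℂ) = Fin.init x := by
  ext j
  rw [Fin.init, killCoords_apply, if_neg (by simp), Fin.init]

theorem init_pointRetraction {H : (Fin n → ℂ) → ((Fin n → ℂ) →L[ℂ] (Fin n → ℂ))}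
    (x : Fin (n + 1) → ℂ) :
    (Fin.init (pointRetraction (Fin.last n)
      (fun x => (snocZero n).comp ((H (initCLM n x)).comp (initCLM n))) x) : Fin n → ℂ) =
        H (Fin.init x) (Fin.init x) := by
  have h1 : (Fin.init (x (Fin.last n) • (Pi.single (Fin.last n) 1 : Fin (n + 1) → ℂ)) :
      Fin n → ℂ) = 0 := by
    ext j
    simp [Fin.init, j.castSucc_ne_last]
  rw [← initCLM_apply] at h1
  rw [pointRetraction, ← initCLM_apply, map_add, h1, add_zero]
  simp only [ContinuousLinearMap.comp_apply, initCLM_apply (snocZero n _), init_snocZero,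
    initCLM_apply, init_killCoords]

/-- Necessity: if the test system is permissible for marked ideals on a submanifold `S` of
codimension equal to the number of elements of `c`, then the multiplicities at `P` are large. -/
theorem le_order_of_permissible (hP : P ∈ A.K) (hφ : IsCoordAt φ P) (ha : IsHyperplanes φ a A.E)
    {S : Set A.M} {e : ℕ} (hS : IsTransverseSubspace n A.E S e) (hce : c.card + e = n)
    {L : List (Marked n S)} {s r : ℕ}
    (h : (testSystem hP hφ ha c (s + 1) r).ImmersedPermissible S L) :
    P ∈ S ∧ ∀ J ∈ L, ∀ k : ℕ, (∀ j < k, (s + 1) * j < (s + 1 + (r - 1)) * J.d) →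
      (k : ℕ∞) ≤ order (J.I P) := by
  change (chain _ _ _ _).ImmersedPermissible (cylinderProj.{u} hφ ⁻¹' S) _ at h
  have hPS : P ∈ S := by
    rw [centers_succ_left, chain_cons_permissible] at h
    have h1 := (h.1.self_of_nhds fun j _ => by rw [Mod.e_origin, Pi.zero_apply]).1
    rwa [mem_preimage, cylinderProj_origin] at h1
  refine ⟨hPS, fun J hJ k hk => le_order_iff.2 fun g hg => ?_⟩
  obtain ⟨f, hf, hgf⟩ := exists_rep g
  -- the coordinates `φ` need not be adapted to `S`
  obtain ⟨ψ, -, b, hψ, -, hb, -, hbe⟩ := hS.2 P hPS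
  obtain ⟨H, hH, hrank, hmem, hfix⟩ := exists_retraction hφ hψ hb
  have hfφ : AnalyticAt ℂ (f ∘ φ.symm) 0 := by
    have := analyticAt_comp_symm hφ.1 hφ.2.1 hf
    rwa [hφ.2.2] at this
  have hinit : Tendsto (Fin.init : (Fin (n + 1) → ℂ) → (Fin n → ℂ)) (𝓝 0) (𝓝 0) := by
    have := (initCLM n).continuous.tendsto 0
    rwa [map_zero] at this
  have hH' : AnalyticAt ℂ (fun x => (snocZero n).comp ((H (initCLM n x)).comp (initCLM n))) 0 := by
    refine analyticAt_const.clm_comp (AnalyticAt.clm_comp ?_ analyticAt_const)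
    refine AnalyticAt.fun_comp (g := H) ?_ ((initCLM n).analyticAt 0)
    rwa [map_zero]
  have hH't : ∀ x v, (snocZero n).comp ((H (initCLM n x)).comp (initCLM n)) v (Fin.last n) = 0 :=
    fun x v => snocZero_last _
  have hρ : IsRetraction (Fin.last n) (cylinderProj.{u} hφ ⁻¹' S) (pointRetraction (Fin.last n)
      fun x => (snocZero n).comp ((H (initCLM n x)).comp (initCLM n))) := by
    refine ⟨analyticAt_pointRetraction hH', pointRetraction_apply_coord hH't, ?_, ?_⟩
    · filter_upwards [hinit.eventually hmem] with x ⟨q, hqS, hqs, hq⟩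
      rw [← init_pointRetraction] at hq
      refine ⟨Mod.mk _ ?_, ?_, Mod.e_mk _ _⟩
      · change (Fin.init (pointRetraction _ _ x) : Fin n → ℂ) ∈ φ.target
        rw [← hq]
        exact φ.map_source hqs
      · rw [mem_preimage, cylinderProj, Mod.e_mk, ← hq, φ.left_inv hqs]
        exact hqS
    · have hlim : Tendsto (cylinderProj.{u} hφ) (𝓝[cylinderProj.{u} hφ ⁻¹' S] (Mod.origin _))
          (𝓝[S] (cylinderProj.{u} hφ (Mod.origin _))) :=
        (contMDiff_cylinderProj hφ).continuous.continuousWithinAt.tendsto_nhdsWithin fun _ h => h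
      rw [cylinderProj_origin] at hlim
      filter_upwards [hlim.eventually hfix] with q hq
      rw [chart_cylinderProj, ← init_pointRetraction] at hq
      rw [← Fin.snoc_init_self (pointRetraction _ _ _), hq, pointRetraction_apply_coord hH't,
        Fin.snoc_init_self]
  have hF : AnalyticAt ℂ (fun x : Fin (n + 1) → ℂ => (f ∘ φ.symm) (initCLM n x)) 0 := by
    refine AnalyticAt.fun_comp (g := f ∘ φ.symm) ?_ ((initCLM n).analyticAt 0)
    rwa [map_zero]
  have hin : ∀ R, R = P → InIdeal (J.I R) f := by
    rintro _ rfl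
    exact ⟨g, hg, hgf⟩
  have hcurve := isBigO_curve_of_permissible (last_notMem_map c) r (s + 1) _ _ _ _ hH' hH't (by
      rw [Finset.card_insert_of_notMem (last_notMem_map c), Finset.card_map, map_zero]
      have h1 : LinearMap.range ((snocZero n).comp ((H 0).comp (initCLM n)) :
          (Fin (n + 1) → ℂ) →ₗ[ℂ] (Fin (n + 1) → ℂ)) ≤
          (LinearMap.range (H 0 : (Fin n → ℂ) →ₗ[ℂ] (Fin n → ℂ))).map
            (snocZero n : (Fin n → ℂ) →ₗ[ℂ] (Fin (n + 1) → ℂ)) := by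
        rintro _ ⟨v, rfl⟩
        exact ⟨_, ⟨initCLM n v, rfl⟩, rfl⟩
      have h2 := (Submodule.finrank_mono h1).trans (Submodule.finrank_map_le _ _)
      omega) (by simp) hρ _ (J.pullback (cylinderProj.{u} hφ) _)
      (List.mem_map_of_mem (f := fun J : Marked n S =>
        J.pullback (cylinderProj.{u} hφ) (cylinderProj.{u} hφ ⁻¹' S)) hJ) _ hF (by
      refine .of_forall fun q _ _ hq => ?_
      have hq := hq s.succ_pos
      subst hq
      have hfσ : ContMDiffAt 𝓘(ℂ, Fin (n + 1) → ℂ) 𝓘(ℂ, ℂ) ω (f ∘ cylinderProj.{u} hφ)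
          (Mod.origin _) := by
        refine ContMDiffAt.comp _ ?_ (contMDiff_cylinderProj hφ).contMDiffAt
        rwa [cylinderProj_origin]
      obtain ⟨g', hg', hg'f⟩ := hin _ (cylinderProj_origin.{u} hφ)
      exact ⟨germOf _ hfσ, Ideal.subset_span ⟨f, g', hg', hg'f, rfl⟩, rfl⟩) h
  refine mem_maxIdeal_pow_of_retraction hφ.1 hφ.2.1 (ρ := fun x => H x x) hfix hgf ?_
  rw [hφ.2.2]
  have hHa : AnalyticAt ℂ (fun x => H x x) 0 := hH.clm_apply analyticAt_id
  refine vanishesToOrder_of_isBigO_curve (s := s + 1) (m := (s + 1 + (r - 1)) * J.d)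
    (AnalyticAt.fun_comp (g := f ∘ φ.symm) (by simpa using hfφ) hHa) s.succ_pos hk ?_
  have hsnoc : Tendsto (snocZero n) (𝓝 0) (𝓝 0) := by
    simpa using (snocZero n).continuous.tendsto 0
  filter_upwards [hsnoc.eventually hcurve] with x hx
  refine hx.congr_left fun τ => ?_
  rw [initCLM_apply, init_pointRetraction, killCoords_eq_self (by simp [snocZero_last])]
  have h1 : (Fin.init (τ ^ (s + 1) • snocZero n x + τ • (Pi.single (Fin.last n) 1 :
      Fin (n + 1) → ℂ)) : Fin n → ℂ) = τ ^ (s + 1) • x := by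
    have h2 : (Fin.init (Pi.single (Fin.last n) 1 : Fin (n + 1) → ℂ) : Fin n → ℂ) = 0 := by
      ext j
      simp [Fin.init, j.castSucc_ne_last]
    rw [← initCLM_apply, map_add, map_smul, map_smul, initCLM_apply, initCLM_apply,
      init_snocZero, h2, smul_zero, add_zero]
  rw [h1, zero_add]

end TestSystems

/-! ### Comparison of equivalent immersed idealistic spaces -/

section Comparison

variable {n e : ℕ} {A : Ambient.{u} n}

theorem ImmersedIdealisticSpace.Equivalent.sing_subset {Vα Vβ : ImmersedIdealisticSpace A e}
    (h : Vα.Equivalent Vβ) : Vα.sing ∩ A.K ⊆ Vβ.sing ∩ A.K := by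
  rintro P ⟨⟨hPN, hord⟩, hPK⟩
  obtain ⟨φ, a, c, hφ, ha, hc, -, hce⟩ := Vα.isTransverse.2 P hPN
  -- a single blowing-up, with centre a point
  have h1 := testSystem_permissible hPK hφ ha hc hPN 0 0 (L := Vα.L) fun J hJ =>
    ⟨J.d, hord J hJ, le_rfl, by simp⟩
  obtain ⟨h2, h3⟩ := le_order_of_permissible hPK hφ ha Vβ.isTransverse hce ((h _).1 h1)
  exact ⟨⟨h2, fun J hJ => h3 J hJ J.d fun j hj => by simpa using hj⟩, hPK⟩

/-- The form in which a lower bound for `o / d'` is used: also for `o = ⊤`, it is a bound for a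
natural number `ν ≤ o`. -/
theorem exists_nat_le_of_div_lt_div {k d d' : ℕ} {o : ℕ∞} (hd : 0 < d) (hkd : d ≤ k)
    (h : (k : ENNReal) / d < (o : ENNReal) / d') :
    ∃ ν : ℕ, (ν : ℕ∞) ≤ o ∧ d' ≤ ν ∧ k * d' < ν * d := by
  induction o with
  | top =>
    refine ⟨k * d' + 1, le_top, ?_, ?_⟩
    · exact (Nat.le_mul_of_pos_left d' (hd.trans_le hkd)).trans (Nat.le_succ _)
    · exact (Nat.lt_succ_self _).trans_le (Nat.le_mul_of_pos_right _ hd)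
  | coe ν =>
    have h1 : k * d' < ν * d := by
      by_contra! hle
      refine h.not_ge ?_
      rw [ENat.toENNReal_coe]
      refine ENNReal.div_le_of_le_mul ?_
      have hd0 : (d : ENNReal) ≠ 0 := by exact_mod_cast hd.ne'
      rw [ENNReal.mul_comm_div, ← mul_div_assoc,
        ENNReal.le_div_iff_mul_le (.inl hd0) (.inl (ENNReal.natCast_ne_top d))]
      exact_mod_cast hle
    refine ⟨ν, le_rfl, ?_, h1⟩
    by_contra! hlt
    exact absurd h1 (not_lt.2 (by nlinarith))

/-- If Hironaka's order of `Vα` at `P` were larger than the quotient `k / d` of an ideal of `Vβ`,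
then a test system with suitable numbers of blowings-up would be permissible for `Vα` only. -/
theorem ImmersedIdealisticSpace.Equivalent.delta_le {Vα Vβ : ImmersedIdealisticSpace A e}
    (h : Vα.Equivalent Vβ) {P : A.M} (hP : P ∈ Vα.sing ∩ A.K) : Vα.delta P ≤ Vβ.delta P := by
  obtain ⟨⟨-, hordβ⟩, -⟩ := h.sing_subset hP
  obtain ⟨⟨hPN, -⟩, hPK⟩ := hP
  obtain ⟨φ, a, c, hφ, ha, hc, -, hce⟩ := Vα.isTransverse.2 P hPN
  refine le_iInf₂ fun J hJ => ?_
  have hd := (Vβ.isIdealistic.1 J hJ).2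
  by_contra! hlt
  obtain ⟨k, hk⟩ : ∃ k : ℕ, order (J.I P) = k := by
    refine ENat.ne_top_iff_exists.1 (fun htop => ?_) |>.imp fun _ h => h.symm
    rw [htop, ENat.toENNReal_top, ENNReal.top_div_of_ne_top (ENNReal.natCast_ne_top _)] at hlt
    exact not_top_lt hlt
  rw [hk, ENat.toENNReal_coe] at hlt
  have hkd : J.d ≤ k := by
    have := hordβ J hJ
    rw [hk] at this
    exact_mod_cast this
  -- for `s = d m` and `r = m (k - d) + 2`, the inequalities `k d' + 1 ≤ ν d` and `2 d' ≤ m` imply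
  -- `r d' ≤ s (ν - d')`, the condition for `Vα`, while `s k < (s + r - 1) d` for `J`
  set m := 2 * (Vα.L.map Marked.d).sum + 1 with hm
  have hm0 : 0 < J.d * m := Nat.mul_pos hd (Nat.succ_pos _)
  have hs : J.d * m - 1 + 1 = J.d * m := Nat.sub_add_cancel hm0
  -- now `k = d + l`
  obtain ⟨l, rfl⟩ := Nat.exists_eq_add_of_le hkd
  have h1 := testSystem_permissible hPK hφ ha hc hPN (J.d * m - 1) (m * l + 2) (L := Vα.L)
    fun J' hJ' => by
      obtain ⟨ν, h2, h3, h4⟩ := exists_nat_le_of_div_lt_div hd hkd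
        (hlt.trans_le (iInf₂_le J' hJ'))
      refine ⟨ν, h2, h3, ?_⟩
      have h5 : J'.d ≤ (Vα.L.map Marked.d).sum :=
        List.single_le_sum (by simp) _ (List.mem_map_of_mem hJ')
      obtain ⟨μ, rfl⟩ := Nat.exists_eq_add_of_le h3
      rw [hs, Nat.add_sub_cancel_left]
      have h6 : l * J'.d + 1 ≤ μ * J.d := by nlinarith
      have h7 := Nat.mul_le_mul_left m h6
      nlinarith
  obtain ⟨-, h2⟩ := le_order_of_permissible hPK hφ ha Vβ.isTransverse hce ((h _).1 h1)
  have h3 := h2 J hJ (J.d + l + 1) fun j hj => by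
    rw [hs]
    have h4 : J.d * m * j ≤ J.d * m * (J.d + l) := Nat.mul_le_mul_left _ (by omega)
    have h5 : m * l + 2 - 1 = m * l + 1 := by omega
    rw [h5]
    nlinarith
  rw [hk] at h3
  have h4 : J.d + l + 1 ≤ J.d + l := by exact_mod_cast h3
  omega

theorem ImmersedIdealisticSpace.Equivalent.symm {Vα Vβ : ImmersedIdealisticSpace A e}
    (h : Vα.Equivalent Vβ) : Vβ.Equivalent Vα := fun S => (h S).symm

theorem ImmersedIdealisticSpace.Equivalent.sing_eq_and_delta_eq
    {Vα Vβ : ImmersedIdealisticSpace A e} (h : Vα.Equivalent Vβ) :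
    Vα.sing ∩ A.K = Vβ.sing ∩ A.K ∧ ∀ P ∈ Vα.sing ∩ A.K, Vα.delta P = Vβ.delta P :=
  ⟨h.sing_subset.antisymm h.symm.sing_subset, fun _ hP =>
    (h.delta_le hP).antisymm (h.symm.delta_le (h.sing_subset hP))⟩

end Comparison

/-! ### Idealistic spaces as immersed idealistic spaces -/

section Immersion

variable {n : ℕ}

theorem strictTransform_univ {M M' : Type u} [TopologicalSpace M] [ChartedSpace (Fin n → ℂ) M]
    [TopologicalSpace M'] [ChartedSpace (Fin n → ℂ) M'] {π : M' → M} {Y : Set M}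
    (h : IsBlowUp n π Y) : strictTransform π Y univ = univ := by
  refine eq_univ_of_forall fun Q => ?_
  by_cases hQ : π Q ∈ Y
  · obtain ⟨φ, b, ψ, hφ, hY, hψ, hcover, -⟩ := h.local_model _ hQ
    have hQb : Q ∈ ⋃ i ∈ b, (ψ i).source := hcover ▸ hφ.2.1
    obtain ⟨i, hi, hQi⟩ := mem_iUnion₂.1 hQb
    obtain ⟨-, -, hπ⟩ := hψ i hi
    have hcoord : ∀ R ∈ (ψ i).source, φ (π R) i = ψ i R i := fun R hR => by
      rw [hπ R hR, blowChart_self]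
    have hQ0 : ψ i Q i = 0 := by
      rw [← hcoord Q hQi]
      exact (hY _ hφ.2.1).1 hQ i hi
    -- move the point away from the exceptional divisor
    have h1 := tendsto_add_single (ψ i Q) i
    have h2 := ((ψ i).continuousAt_symm ((ψ i).map_source hQi)).tendsto.comp h1
    rw [(ψ i).left_inv hQi] at h2
    refine mem_closure_of_tendsto h2 ?_
    filter_upwards [h1.eventually ((ψ i).open_target.mem_nhds ((ψ i).map_source hQi)),
      self_mem_nhdsWithin] with τ h3 h4
    refine ⟨mem_univ _, fun h5 => h4 ?_⟩
    have h6 := (ψ i).map_target h3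
    have h7 : π ((ψ i).symm (ψ i Q + τ • Pi.single i 1)) ∈ φ.source := by
      have : (ψ i).symm (ψ i Q + τ • Pi.single i 1) ∈ π ⁻¹' φ.source := by
        rw [hcover]
        exact mem_iUnion₂.2 ⟨i, hi, h6⟩
      exact this
    have h8 := (hY _ h7).1 h5 i hi
    rw [hcoord _ h6, (ψ i).right_inv h3] at h8
    simpa [hQ0] using h8
  · exact subset_closure ⟨mem_univ _, hQ⟩

theorem TestSystem.permissible_iff_immersedPermissible {A : Ambient.{u} n} (S : TestSystem A) :
    ∀ L : List (Marked n (univ : Set A.M)), S.Permissible L ↔ S.ImmersedPermissible univ L := by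
  induction S with
  | nil A => exact fun L => Iff.rfl
  | proj σ w h S ih => exact fun L => ih _
  | blowUp Y π h S ih =>
    intro L
    have h1 : ∀ N', N' = univ →
        (S.Permissible (L.map fun J => J.controlled π Y univ) ↔
          S.ImmersedPermissible N' (L.map fun J => J.controlled π Y N')) := by
      rintro _ rfl
      exact ih _
    exact and_congr_right fun _ => h1 _ (strictTransform_univ h.blowUp)

/-- An idealistic space, considered as an idealistic space immersed in its own ambient space. -/
noncomputable def IdealisticSpace.toImmersed {A : Ambient.{u} n} (X : IdealisticSpace A) :
    ImmersedIdealisticSpace A n where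
  N := univ
  isTransverse := by
    refine ⟨isClosed_univ, fun P _ => ?_⟩
    obtain ⟨φ, a, hφ, ha⟩ := A.isNCDivisor_E P
    exact ⟨φ, a, ∅, hφ, ha, fun x _ => by simp, Finset.disjoint_empty_right a, by simp⟩
  L := X.L
  isIdealistic := X.isIdealistic

theorem IdealisticSpace.Equivalent.toImmersed {A : Ambient.{u} n} {X₁ X₂ : IdealisticSpace A}
    (h : X₁.Equivalent X₂) : X₁.toImmersed.Equivalent X₂.toImmersed := fun S =>
  (S.permissible_iff_immersedPermissible _).symm.trans
    ((h S).trans (S.permissible_iff_immersedPermissible _))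

end Immersion

end Idealistic

theorem mainTheorem3 {n : ℕ} (A : Idealistic.Ambient.{u} n) :
    (∀ Mα Mβ : Idealistic.IdealisticSpace A, Mα.Equivalent Mβ →
      Mα.sing ∩ A.K = Mβ.sing ∩ A.K ∧
      ∀ P ∈ Mα.sing ∩ A.K, Mα.delta P = Mβ.delta P) ∧
    (∀ (e : ℕ) (Vα Vβ : Idealistic.ImmersedIdealisticSpace A e), Vα.Equivalent Vβ →
      Vα.sing ∩ A.K = Vβ.sing ∩ A.K ∧
      ∀ P ∈ Vα.sing ∩ A.K, Vα.delta P = Vβ.delta P) :=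
  ⟨fun _ _ h => h.toImmersed.sing_eq_and_delta_eq, fun _ _ _ h => h.sing_eq_and_delta_eq⟩
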